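/- **Setting.** Let $X$ be a measurable space, let $Y$ be a real separable Hilbert space, and let $\mathcal H$ be a separable real reproducing kernel Hilbert space of functions on $X$ with kernel $k$, whose sections $k(\cdot,t)$ are measurable; put $\phi(x)=k(x,\cdot)$. For $u\in\mathcal H$ and $v$ in a Hilbert space, $v\otimes u$ is the operator $h\mapsto\langle h,u\rangle v$; $\mathcal S_2(\mathcal H,Y)$ is the space of Hilbert–Schmidt operators from $\mathcal H$ to $Y$. For a compact self-adjoint operator $A$, $g(A)=\sum_\mu g(\mu)P_\mu$, where $\mu$ runs over the eigenvalues of $A$ and $P_\mu$ is the orthogonal projection onto the eigenspace. Let $p_X,q_X$ be probability measures on $X$ and $p(dy|x)$ a Markov kernel from $X$ to $Y$; the source distribution is $p(dx,dy)=p_X(dx)\,p(dy|x)$, the target distribution is $q(dx,dy)=q_X(dx)\,p(dy|x)$, and $f^*(x)=\int_Y y\,p(dy|x)$ is the regression function. Assume: 1. $k(x,x)\le\kappa^2$ for all $x\in X$, where $\kappa\ge 0$. 2. $dq_X=\beta\,dp_X$ with a measurable $\beta:X\to[0,\infty)$ such that $\beta(x)\le b$ for all $x$. 3. $\|y\|_Y\le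 M'$ for $p$-almost every $(x,y)$. 4. (Source condition.) $f^*(x)=C_*\phi(x)$ for $q_X$-almost every $x$, with $C_*\in\mathcal S_2(\mathcal H,Y)$, and $C_*=C_o\,\varphi(C_X)$ for some $C_o\in\mathcal S_2(\mathcal H,Y)$, where $C_X=\mathbb E_{q_X}[\phi(x)\otimes\phi(x)]$ and $\varphi:[0,\infty)\to[0,\infty)$ is an index function, i.e. continuous, strictly increasing, with $\varphi(0)=0$. Let $s\ge b\kappa^2$ and let $g_\lambda:[0,s]\to\mathbb R$, $0<\lambda\le s$, be a regularization family: there are positive constants $D,B,\gamma$ with $$|\sigma g_\lambda(\sigma)|\le D,\qquad |g_\lambda(\sigma)|\le \frac B\lambda,\qquad |1-\sigma g_\lambda(\sigma)|\le\gamma\qquad\text{for all }\lambda,\sigma\in(0,s].$$ Let $\nu>0$ and $\gamma_\nu$ be such that $|1-\sigma g_\lambda(\sigma)|\,\sigma^\nu\le\gamma_\nu\lambda^\nu$ for all $\lambda,\sigma\in(0,s]$ (for example, $\nu$ is the qualification of the family, the largest such exponent). Suppose that $\nu$ covers $\psi(t)=\varphi(t)\sqrt t$ with constant $c>0$: $$c\,\frac{t^\nu}{\psi(t)}\le\inf_{t\le\sigma\le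 s}\frac{\sigma^\nu}{\psi(\sigma)}\qquad\text{for all }0<t\le s.$$ For $n\ge1$ and a sample $\mathbf z=((x_i,y_i))_{i=1}^n$ drawn independently from $p$, let $$\widehat C_X^\beta=\frac1n\sum_{i=1}^n\beta(x_i)\,\phi(x_i)\otimes\phi(x_i),\quad \widehat C_{YX}^\beta=\frac1n\sum_{i=1}^n\beta(x_i)\,y_i\otimes\phi(x_i),\quad \widehat f_{\mathbf z,\lambda}(x)=\widehat C_{YX}^\beta\,g_\lambda(\widehat C_X^\beta)\,\phi(x).$$ Let $\mathcal N(\lambda)=\operatorname{Tr}\big(C_X(C_X+\lambda I)^{-1}\big)$. **Theorem.** Let $0<\delta<1$ and let $0<\lambda\le s$ satisfy $$2\left(\frac{2b\kappa^2}{\sqrt\lambda\,n}+\sqrt{\frac{b\kappa^2\mathcal N(\lambda)}{n}}\right)\log\frac2\delta\le\frac{\sqrt\lambda}{2}.$$ Then with probability at least $1-\delta$ over $\mathbf z$ (that is, on a measurable set of samples of at least this probability), $$\big\|f^*-\widehat f_{\mathbf z,\lambda}\big\|_{L_2(q_X,Y)}\le\left(\frac{A_1}{n}\sqrt{\frac1\lambda}+A_2\sqrt{\frac{\mathcal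 N(\lambda)}{n}}\right)\log\frac2\delta+A_3\sqrt\lambda\,\varphi(\lambda),$$ where, with $\bar\nu=\lfloor\nu-\tfrac12\rfloor$ and $M=M'+\kappa\|C_*\|_{\mathcal S_2(\mathcal H,Y)}$, $$\begin{aligned} A_1&=2^{2\nu-\bar\nu+2}(\gamma_\nu+\gamma)\max(1,\tfrac1c)\,\bar\nu\,b\,\kappa^2\,\|C_*\|_{\mathcal S_2(\mathcal H,Y)}+10\,b\,M\,\kappa\,(B+D),\\ A_2&=2^{2\nu-\bar\nu+1}(\gamma_\nu+\gamma)\max(1,\tfrac1c)\,\bar\nu\,\sqrt b\,\kappa\,\|C_*\|_{\mathcal S_2(\mathcal H,Y)}+5\,M\sqrt b\,(B+D),\\ A_3&=2^{2\nu-\bar\nu}(\gamma_\nu+\gamma)\max(1,\tfrac1c)\,\|C_o\|_{\mathcal S_2(\mathcal H,Y)}. \end{aligned}$$ -/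

import Mathlib

open MeasureTheory ProbabilityTheory InnerProductSpace
open scoped ENNReal

noncomputable section

namespace CovariateShift

/-! ### Hilbert-Schmidt operators and traces -/

section Operators

variable {H Y : Type*} [NormedAddCommGroup H] [InnerProductSpace ℝ H] [CompleteSpace H]
  [NormedAddCommGroup Y] [InnerProductSpace ℝ Y] [CompleteSpace Y]

/-- The index set of some fixed Hilbert basis of `H`. -/
def basisIndex (H : Type*) [NormedAddCommGroup H] [InnerProductSpace ℝ H] [CompleteSpace H] :
    Set H :=
  (exists_hilbertBasis ℝ H).choose

/-- Some fixed Hilbert (that is, complete orthonormal) basis of `H`. -/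
def someBasis (H : Type*) [NormedAddCommGroup H] [InnerProductSpace ℝ H] [CompleteSpace H] :
    HilbertBasis (basisIndex H) ℝ H :=
  (exists_hilbertBasis ℝ H).choose_spec.choose

/-- The squared Hilbert-Schmidt norm `∑ᵢ ‖T eᵢ‖²`, for a Hilbert basis `(eᵢ)`, as an extended
nonnegative real. It does not depend on the basis, see `hsNormSq_eq`. -/
def hsNormSq (T : H →L[ℝ] Y) : ℝ≥0∞ :=
  ∑' i, ‖T (someBasis H i)‖ₑ ^ 2

/-- `T ∈ S₂(H, Y)`: the operator `T` is Hilbert-Schmidt. -/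
def IsHilbertSchmidt (T : H →L[ℝ] Y) : Prop :=
  hsNormSq T ≠ ∞

/-- The Hilbert-Schmidt norm `‖T‖_{S₂(H, Y)}` (meaningful for Hilbert-Schmidt operators). -/
def hsNorm (T : H →L[ℝ] Y) : ℝ :=
  √(hsNormSq T).toReal

/-- The trace `∑ᵢ ⟨T eᵢ, eᵢ⟩` of a trace class operator. -/
def opTrace (T : H →L[ℝ] H) : ℝ :=
  ∑' i, ⟪T (someBasis H i), someBasis H i⟫_ℝ

/-- Parseval's identity. -/
theorem tsum_enorm_inner_sq {ι E : Type*} [NormedAddCommGroup E] [InnerProductSpace ℝ E]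
    (e : HilbertBasis ι ℝ E) (v : E) :
    ∑' i, ‖⟪v, e i⟫_ℝ‖ₑ ^ 2 = ‖v‖ₑ ^ 2 := by
  have h := e.hasSum_inner_mul_inner v v
  have hsq : ∀ i, ⟪v, e i⟫_ℝ * ⟪e i, v⟫_ℝ = ‖⟪v, e i⟫_ℝ‖ ^ 2 := fun i => by
    rw [real_inner_comm v (e i), Real.norm_eq_abs, sq_abs, sq]
  simp only [hsq, real_inner_self_eq_norm_sq] at h
  have hE : ∀ x : ℝ, ‖x‖ₑ ^ 2 = ENNReal.ofReal (‖x‖ ^ 2) := fun x => by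
    rw [ENNReal.ofReal_pow (norm_nonneg _), ofReal_norm]
  simp only [hE]
  rw [← ENNReal.ofReal_tsum_of_nonneg (fun _ => by positivity) h.summable, h.tsum_eq,
    ENNReal.ofReal_pow (norm_nonneg _), ofReal_norm]

theorem tsum_enorm_sq_eq_adjoint {ι κ : Type*} (e : HilbertBasis ι ℝ H)
    (f : HilbertBasis κ ℝ Y) (T : H →L[ℝ] Y) :
    ∑' i, ‖T (e i)‖ₑ ^ 2 = ∑' j, ‖T.adjoint (f j)‖ₑ ^ 2 := by
  simp only [← tsum_enorm_inner_sq f (T _), ← tsum_enorm_inner_sq e (T.adjoint _)]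
  rw [ENNReal.tsum_comm]
  simp only [ContinuousLinearMap.adjoint_inner_left, real_inner_comm]

/-- The Hilbert-Schmidt norm may be computed in any Hilbert basis. -/
theorem hsNormSq_eq {ι : Type*} (e : HilbertBasis ι ℝ H) (T : H →L[ℝ] Y) :
    hsNormSq T = ∑' i, ‖T (e i)‖ₑ ^ 2 := by
  rw [hsNormSq, tsum_enorm_sq_eq_adjoint (someBasis H) (someBasis Y),
    tsum_enorm_sq_eq_adjoint e (someBasis Y)]

/-! ### Functional calculus of compact self-adjoint operators -/

/-- The orthogonal projection of `H` onto the eigenspace `ker (A - μ I)`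
(it is zero if `μ` is not an eigenvalue of `A`). -/
def eigenProj (A : H →L[ℝ] H) (μ : ℝ) : H →L[ℝ] H :=
  (A - μ • ContinuousLinearMap.id ℝ H).ker.starProjection

/-- The functional calculus `g(A) h = ∑_μ g(μ) P_μ h` of a compact self-adjoint operator `A`
on `H`; the sum runs over the eigenvalues `μ` of `A` (zero included, if it is one), and `P_μ` is
the orthogonal projection onto the eigenspace of `μ`. -/
def specFun (g : ℝ → ℝ) (A : H →L[ℝ] H) (h : H) : H :=
  ∑' μ : ℝ, g μ • eigenProj A μ h

theorem eigenProj_of_eigenvector {A : H →L[ℝ] H} {μ : ℝ} {v : H} (hv : A v = μ • v) :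
    eigenProj A μ v = v := by
  rw [eigenProj, Submodule.starProjection_eq_self_iff]
  simp [LinearMap.mem_ker, hv]

theorem eigenProj_of_eigenvector_ne {A : H →L[ℝ] H} (hA : A.IsSymmetric) {μ μ' : ℝ}
    (hne : μ' ≠ μ) {v : H} (hv : A v = μ • v) : eigenProj A μ' v = 0 := by
  rw [eigenProj, Submodule.starProjection_apply_eq_zero_iff, Submodule.mem_orthogonal]
  intro w hw
  have hw' : A w = μ' • w := by simpa [LinearMap.mem_ker, sub_eq_zero] using hw
  have h : ⟪A w, v⟫_ℝ = ⟪w, A v⟫_ℝ := hA w v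
  rw [hw', hv, real_inner_smul_left, real_inner_smul_right] at h
  have h' : (μ' - μ) * ⟪w, v⟫_ℝ = 0 := by linarith
  exact (mul_eq_zero.mp h').resolve_left (sub_ne_zero.mpr hne)

/-- On an eigenvector, `g(A)` acts as multiplication by the value of `g` at the eigenvalue. -/
theorem specFun_of_eigenvector (g : ℝ → ℝ) {A : H →L[ℝ] H} (hA : A.IsSymmetric) {μ : ℝ}
    {v : H} (hv : A v = μ • v) : specFun g A v = g μ • v := by
  rw [specFun, tsum_eq_single μ, eigenProj_of_eigenvector hv]
  intro μ' hne
  rw [eigenProj_of_eigenvector_ne hA hne hv, smul_zero]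

/-- The effective dimension `N(λ) = Tr (C (C + λ I)⁻¹)`. -/
def effDim (C : H →L[ℝ] H) (lam : ℝ) : ℝ :=
  opTrace (C ∘L Ring.inverse (C + lam • ContinuousLinearMap.id ℝ H))

end Operators

/-! ### Index functions and regularization families -/

/-- `φ : [0, ∞) → [0, ∞)` is an index function: it is continuous and strictly increasing, and
`φ(0) = 0`. -/
structure IsIndexFunction (φ : ℝ → ℝ) : Prop where
  continuousOn : ContinuousOn φ (Set.Ici 0)
  strictMonoOn : StrictMonoOn φ (Set.Ici 0)
  map_zero : φ 0 = 0

/-- `(g_λ)`, `0 < λ ≤ s`, is a regularization family of functions `g_λ = g lam` on `[0, s]`, with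
constants `D`, `B` and `γ`. -/
structure IsRegularizationFamily (g : ℝ → ℝ → ℝ) (s D B γ : ℝ) : Prop where
  D_pos : 0 < D
  B_pos : 0 < B
  γ_pos : 0 < γ
  abs_mul_le : ∀ lam ∈ Set.Ioc 0 s, ∀ σ ∈ Set.Ioc 0 s, |σ * g lam σ| ≤ D
  abs_le : ∀ lam ∈ Set.Ioc 0 s, ∀ σ ∈ Set.Ioc 0 s, |g lam σ| ≤ B / lam
  abs_residual_le : ∀ lam ∈ Set.Ioc 0 s, ∀ σ ∈ Set.Ioc 0 s, |1 - σ * g lam σ| ≤ γ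

/-- The family `(g_λ)` satisfies the qualification inequality
`sup_{0 < σ ≤ s} |1 - σ g_λ(σ)| σ^ν ≤ γ_ν λ^ν` with exponent `ν > 0` and a constant `γ_ν`
independent of `λ`. The qualification of the family is the largest such exponent. -/
structure HasQualification (g : ℝ → ℝ → ℝ) (s ν γν : ℝ) : Prop where
  pos : 0 < ν
  residual_le : ∀ lam ∈ Set.Ioc 0 s, ∀ σ ∈ Set.Ioc 0 s,
    |1 - σ * g lam σ| * σ ^ ν ≤ γν * lam ^ ν

/-- The exponent `ν` covers the index function `ψ` with constant `c > 0`: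
`c t^ν / ψ(t) ≤ inf_{t ≤ σ ≤ s} σ^ν / ψ(σ)` for all `0 < t ≤ s`. -/
def Covers (ν s : ℝ) (ψ : ℝ → ℝ) (c : ℝ) : Prop :=
  0 < c ∧ ∀ t ∈ Set.Ioc 0 s, ∀ σ ∈ Set.Icc t s, c * (t ^ ν / ψ t) ≤ σ ^ ν / ψ σ

/-! ### Kernels, covariance operators and the estimator -/

section Learning

variable {X H : Type*} [NormedAddCommGroup H] [InnerProductSpace ℝ H] [CompleteSpace H]
  [RKHS ℝ H X ℝ]

/-- The reproducing kernel `k : X × X → ℝ` of a scalar-valued reproducing kernel Hilbert space. -/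
def scalarKernel (H : Type*) {X : Type*} [NormedAddCommGroup H] [InnerProductSpace ℝ H]
    [CompleteSpace H] [RKHS ℝ H X ℝ] (x t : X) : ℝ :=
  RKHS.kernel H x t 1

/-- The feature map `x ↦ k(x, ·)`. -/
def featureMap (H : Type*) {X : Type*} [NormedAddCommGroup H] [InnerProductSpace ℝ H]
    [CompleteSpace H] [RKHS ℝ H X ℝ] (x : X) : H :=
  RKHS.kerFun H x 1

theorem featureMap_apply (x t : X) : featureMap H x t = scalarKernel H t x :=
  RKHS.kerFun_apply H x 1 t

theorem inner_featureMap (f : H) (x : X) : ⟪featureMap H x, f⟫_ℝ = f x := by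
  simp [featureMap]

/-- The covariance operator `C_X = E_q[φ(x) ⊗ φ(x)]`. -/
def covOp (H : Type*) {X : Type*} [NormedAddCommGroup H] [InnerProductSpace ℝ H]
    [CompleteSpace H] [RKHS ℝ H X ℝ] [MeasurableSpace X] (qX : Measure X) : H →L[ℝ] H :=
  ∫ x, rankOne ℝ (featureMap H x) (featureMap H x) ∂qX

/-- The weighted empirical covariance operator `(1/n) ∑ᵢ β(xᵢ) φ(xᵢ) ⊗ φ(xᵢ)`. -/
def empCovOp (H : Type*) {X Y : Type*} [NormedAddCommGroup H] [InnerProductSpace ℝ H]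
    [CompleteSpace H] [RKHS ℝ H X ℝ] {n : ℕ} (β : X → ℝ) (z : Fin n → X × Y) : H →L[ℝ] H :=
  (1 / n : ℝ) • ∑ i, β (z i).1 • rankOne ℝ (featureMap H (z i).1) (featureMap H (z i).1)

/-- The weighted empirical cross-covariance operator `(1/n) ∑ᵢ β(xᵢ) yᵢ ⊗ φ(xᵢ)`. -/
def empCrossCovOp (H : Type*) {X Y : Type*} [NormedAddCommGroup H] [InnerProductSpace ℝ H]
    [CompleteSpace H] [RKHS ℝ H X ℝ] [NormedAddCommGroup Y] [InnerProductSpace ℝ Y]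
    {n : ℕ} (β : X → ℝ) (z : Fin n → X × Y) : H →L[ℝ] Y :=
  (1 / n : ℝ) • ∑ i, β (z i).1 • rankOne ℝ (z i).2 (featureMap H (z i).1)

/-- The estimator `x ↦ Ĉ_YX g_λ(Ĉ_X) φ(x)` built from the filter function `gl = g_λ`. -/
def estimator (H : Type*) {X Y : Type*} [NormedAddCommGroup H] [InnerProductSpace ℝ H]
    [CompleteSpace H] [RKHS ℝ H X ℝ] [NormedAddCommGroup Y] [InnerProductSpace ℝ Y]
    {n : ℕ} (β : X → ℝ) (gl : ℝ → ℝ) (z : Fin n → X × Y) (x : X) : Y :=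
  empCrossCovOp H β z (specFun gl (empCovOp H β z) (featureMap H x))

/-- The regression function `f*(x) = ∫ y p(dy | x)`. -/
def regressionFun {X Y : Type*} [MeasurableSpace X] [MeasurableSpace Y] [NormedAddCommGroup Y]
    [InnerProductSpace ℝ Y] (K : Kernel X Y) (x : X) : Y :=
  ∫ y, y ∂(K x)

/-- `𝓑_{n,λ} = 2 (2 b κ² / (√λ n) + √(b κ² N(λ) / n))`. -/
def Bnl (n : ℕ) (lam b κ N : ℝ) : ℝ :=
  2 * (2 * b * κ ^ 2 / (√lam * n) + √(b * κ ^ 2 * N / n))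

end Learning

end CovariateShift

end

/-! Write T = C_X, T̂ for the weighted empirical covariance, W = C_*, G = g_λ(T̂). Since T = E_q[φ ⊗
φ], the L₂(q_X) norm of x ↦ A φ(x) is the Hilbert–Schmidt norm of A T^{1/2}
(`lintegral_enorm_apply_featureMap_sq`). So the error is the Hilbert–Schmidt norm of (W − Ĉ_YX G)
T^{1/2}. With ε = Ĉ_YX − W T̂ this operator is the bias W (1 − T̂ G) T^{1/2} minus the sample error
ε G T^{1/2}.

Probability. Randomness enters only through (T̂ − T)(T + λ)^{-1/2} and ε (T + λ)^{-1/2}. The weight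
β turns p into q, so both are centred averages of independent vectors, the second because f* = W φ
holds q_X-almost everywhere. Hilbert–Schmidt operators become vectors of ℓ², and a Bernstein
inequality applies; the variance is governed by N(λ). For moderate δ the Bernstein bound is too weak
for the stated constants, and Chebyshev's inequality takes over (`deviation_prob_add_le`).

Comparison. Under the condition on λ the first deviation gives ‖(T + λ)x‖ ≤ 2‖(T̂ + λ)x‖. Heinz's
inequality (`heinz`) extends this to powers θ ∈ [0, 1]. Factors in T can thus be traded for factors
in T̂, on which the filter acts by scalar multiplication. This settles the sample error
(`hsENorm_sample_le`).

Bias (`hsENorm_bias_le`). By the source and covering conditions W = Z (T + λ)^{θ+m} with θ + m = ν −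
1/2, m an integer and ‖Z‖ of order φ(λ) λ^{-(ν−1/2)}. Heinz reaches powers up to 1 only, so the m-th
power is moved from T to T̂ by telescoping. Each of the m differences costs ‖C_*‖ times the first
deviation, hence the factor ν̄ in A₁ and A₂; what remains gives A₃.

T and T̂ are compact and symmetric, hence each is diagonal in some Hilbert basis, and all functional
calculus is done on eigenvalues there. -/

set_option linter.unusedSectionVars false

open MeasureTheory ProbabilityTheory InnerProductSpace
open scoped ENNReal

noncomputable section

namespace CovariateShift

/-! ### Operators that are diagonal in a Hilbert basis -/

section Diagonal

universe u

variable {ι κ H Y : Type*} [NormedAddCommGroup H] [InnerProductSpace ℝ H] [CompleteSpace H]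
  [NormedAddCommGroup Y] [InnerProductSpace ℝ Y] [CompleteSpace Y]

/-- A Hilbert basis of a separable space is countable. -/
theorem hilbertBasis_countable [TopologicalSpace.SeparableSpace H] (e : HilbertBasis ι ℝ H) :
    Countable ι := by
  refine Pairwise.countable_of_isOpen_disjoint (s := fun i => Metric.ball (e i) (1 / 2))
    (fun i j hij => ?_) (fun i => Metric.isOpen_ball)
    (fun i => ⟨e i, Metric.mem_ball_self (by norm_num)⟩)
  refine Metric.ball_disjoint_ball ?_
  have h : ‖e i - e j‖ ^ 2 = 2 := by
    rw [norm_sub_sq_real, e.orthonormal.1 i, e.orthonormal.1 j, e.orthonormal.2 hij]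
    norm_num
  rw [dist_eq_norm]
  nlinarith [norm_nonneg (e i - e j)]

/-- `A` is diagonal in the basis `e`, with eigenvalues `f`. -/
def IsDiag (e : HilbertBasis ι ℝ H) (f : ι → ℝ) (A : H →L[ℝ] H) : Prop :=
  ∀ i, A (e i) = f i • e i

theorem clm_ext_hilbertBasis (e : HilbertBasis ι ℝ H) {A B : H →L[ℝ] Y}
    (h : ∀ i, A (e i) = B (e i)) : A = B := by
  refine ContinuousLinearMap.ext_on (s := Set.range e) ?_ ?_
  · have := e.dense_span
    rw [Submodule.dense_iff_topologicalClosure_eq_top]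
    exact this
  · rintro _ ⟨i, rfl⟩
    exact h i

theorem hasSum_inner_sq (e : HilbertBasis ι ℝ H) (x : H) :
    HasSum (fun i => ⟪e i, x⟫_ℝ ^ 2) (‖x‖ ^ 2) := by
  have h := e.hasSum_inner_mul_inner x x
  rw [real_inner_self_eq_norm_sq] at h
  simpa only [real_inner_comm x, ← sq] using h

namespace IsDiag

variable {e : HilbertBasis ι ℝ H} {f g : ι → ℝ} {A B : H →L[ℝ] H}

theorem unique (hA : IsDiag e f A) (hB : IsDiag e f B) : A = B :=
  clm_ext_hilbertBasis e fun i => by rw [hA i, hB i]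

theorem comp (hA : IsDiag e f A) (hB : IsDiag e g B) :
    IsDiag e (fun i => f i * g i) (A ∘L B) := fun i => by
  simp [hB i, hA i, smul_smul, mul_comm]

theorem add (hA : IsDiag e f A) (hB : IsDiag e g B) : IsDiag e (fun i => f i + g i) (A + B) :=
  fun i => by simp [hB i, hA i, add_smul]

theorem sub (hA : IsDiag e f A) (hB : IsDiag e g B) : IsDiag e (fun i => f i - g i) (A - B) :=
  fun i => by simp [hB i, hA i, sub_smul]

theorem smul (c : ℝ) (hA : IsDiag e f A) : IsDiag e (fun i => c * f i) (c • A) :=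
  fun i => by simp [hA i, smul_smul]

protected theorem id : IsDiag e (fun _ => 1) (ContinuousLinearMap.id ℝ H) := fun i => by simp

theorem inner_apply (hA : IsDiag e f A) (x : H) (i : ι) : ⟪e i, A x⟫_ℝ = f i * ⟪e i, x⟫_ℝ := by
  classical
  have h := ((e.hasSum_repr x).mapL A).mapL (innerSL ℝ (e i))
  simp only [map_smul, hA _, innerSL_apply_apply, smul_eq_mul] at h
  have h2 := hasSum_single (f := fun b => (e.repr x) b * (f b * ⟪e i, e b⟫_ℝ)) i (fun j hj => by
    rw [e.orthonormal.2 hj.symm]; simp)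
  rw [h.unique h2, e.repr_apply_apply, real_inner_self_eq_norm_sq, e.orthonormal.1 i]
  ring

theorem hasSum_norm_sq (hA : IsDiag e f A) (x : H) :
    HasSum (fun i => f i ^ 2 * ⟪e i, x⟫_ℝ ^ 2) (‖A x‖ ^ 2) := by
  have h := hasSum_inner_sq e (A x)
  simpa only [hA.inner_apply, mul_pow] using h

theorem norm_apply_le_of_le (hA : IsDiag e f A) (hB : IsDiag e g B) (h : ∀ i, |f i| ≤ |g i|)
    (x : H) : ‖A x‖ ≤ ‖B x‖ := by
  refine (sq_le_sq₀ (norm_nonneg _) (norm_nonneg _)).1 ?_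
  exact hasSum_le (fun i => mul_le_mul_of_nonneg_right (sq_le_sq.mpr (h i)) (sq_nonneg _))
    (hA.hasSum_norm_sq x) (hB.hasSum_norm_sq x)

theorem norm_le (hA : IsDiag e f A) {C : ℝ} (hC : 0 ≤ C) (h : ∀ i, |f i| ≤ C) : ‖A‖ ≤ C := by
  refine A.opNorm_le_bound hC fun x => ?_
  have := hA.norm_apply_le_of_le (IsDiag.id.smul C) (fun i => by simpa [abs_of_nonneg hC] using h i) x
  simpa [norm_smul, abs_of_nonneg hC] using this

theorem isSymmetric (hA : IsDiag e f A) (x y : H) : ⟪A x, y⟫_ℝ = ⟪x, A y⟫_ℝ := by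
  have h1 := e.hasSum_inner_mul_inner (A x) y
  have h2 := e.hasSum_inner_mul_inner x (A y)
  refine h1.unique ?_
  convert h2 using 2 with i
  rw [hA.inner_apply, real_inner_comm, hA.inner_apply, real_inner_comm x]
  ring

theorem adjoint_eq (hA : IsDiag e f A) : A.adjoint = A := by
  rw [eq_comm, ContinuousLinearMap.eq_adjoint_iff]
  exact hA.isSymmetric

end IsDiag

/-- A bounded family of eigenvalues defines a diagonal operator. -/
theorem exists_isDiag (e : HilbertBasis ι ℝ H) {f : ι → ℝ} {C : ℝ} (hf : ∀ i, |f i| ≤ C) :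
    ∃ A : H →L[ℝ] H, IsDiag e f A := by
  classical
  have hmem : ∀ v : lp (fun _ : ι => ℝ) 2, Memℓp (fun i => f i * v i) 2 := fun v => by
    refine memℓp_gen ?_
    have hv := (lp.memℓp v).summable (by norm_num)
    refine Summable.of_nonneg_of_le (fun i => by positivity) (fun i => ?_)
      (hv.mul_left (C ^ (2 : ℝ)))
    rw [Real.norm_eq_abs, Real.norm_eq_abs, abs_mul, ENNReal.toReal_ofNat, Real.rpow_two,
      Real.rpow_two, Real.rpow_two, mul_pow]
    have := hf i
    gcongr
  let D : lp (fun _ : ι => ℝ) 2 →ₗ[ℝ] lp (fun _ : ι => ℝ) 2 :=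
    { toFun := fun v => ⟨fun i => f i * v i, hmem v⟩
      map_add' := fun v w => lp.ext (funext fun i => mul_add _ _ _)
      map_smul' := fun c v => lp.ext (funext fun i => mul_left_comm _ _ _) }
  have hD : ∀ v, ‖D v‖ ≤ |C| * ‖v‖ := fun v => by
    refine (sq_le_sq₀ (norm_nonneg _) (by positivity)).1 ?_
    have h1 := lp.hasSum_norm (p := 2) (by norm_num) (D v)
    have h2 := (lp.hasSum_norm (p := 2) (by norm_num) v).mul_left (|C| ^ 2)
    simp only [ENNReal.toReal_ofNat, Real.rpow_two] at h1 h2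
    rw [mul_pow]
    refine hasSum_le (fun i => ?_) h1 h2
    change ‖f i * v i‖ ^ 2 ≤ _
    rw [norm_mul, mul_pow, Real.norm_eq_abs (f i)]
    have := (hf i).trans (le_abs_self C)
    gcongr
  let D' : lp (fun _ : ι => ℝ) 2 →L[ℝ] lp (fun _ : ι => ℝ) 2 := D.mkContinuous _ hD
  refine ⟨(e.repr.symm : lp (fun _ : ι => ℝ) 2 →L[ℝ] H) ∘L D' ∘L (e.repr : H →L[ℝ] _),
    fun i => ?_⟩
  have : D' (e.repr (e i)) = f i • e.repr (e i) := by
    refine lp.ext (funext fun j => ?_)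
    change f j * e.repr (e i) j = f i * e.repr (e i) j
    rcases eq_or_ne j i with rfl | h
    · rfl
    · simp [e.repr_self, h]
  change e.repr.symm (D' (e.repr (e i))) = _
  rw [this, map_smul, LinearIsometryEquiv.symm_apply_apply]

/-- The diagonal operator with eigenvalues `f`; zero if there is no such bounded operator. -/
def diagOp (e : HilbertBasis ι ℝ H) (f : ι → ℝ) : H →L[ℝ] H :=
  open scoped Classical in if h : ∃ A, IsDiag e f A then h.choose else 0

theorem isDiag_diagOp (e : HilbertBasis ι ℝ H) {f : ι → ℝ} {C : ℝ} (hf : ∀ i, |f i| ≤ C) :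
    IsDiag e f (diagOp e f) := by
  have h := exists_isDiag e hf
  rw [diagOp, dif_pos h]
  exact h.choose_spec

/-- A compact symmetric operator is diagonal in some Hilbert basis. -/
theorem exists_hilbertBasis_isDiag {H : Type u} [NormedAddCommGroup H] [InnerProductSpace ℝ H]
    [CompleteSpace H] {A : H →L[ℝ] H} (hc : IsCompactOperator A)
    (hs : A.IsSymmetric) :
    ∃ (ι : Type u) (e : HilbertBasis ι ℝ H) (a : ι → ℝ), IsDiag e a A := by
  let V : ℝ → Submodule ℝ H := fun μ => (A - μ • ContinuousLinearMap.id ℝ H).ker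
  have hmem : ∀ μ v, v ∈ V μ ↔ A v = μ • v := fun μ v => by
    simp [V, LinearMap.mem_ker, sub_eq_zero]
  have hclosed : ∀ μ, IsClosed (V μ : Set H) := fun μ =>
    (A - μ • ContinuousLinearMap.id ℝ H).isClosed_ker
  have : ∀ μ, CompleteSpace (V μ) := fun μ => (hclosed μ).completeSpace_coe
  have hV : ∀ μ, V μ = Module.End.eigenspace (A : Module.End ℝ H) μ := fun μ => by
    ext v; rw [hmem, Module.End.mem_eigenspace_iff]; rfl
  have horth : OrthogonalFamily ℝ (fun μ => V μ) fun μ => (V μ).subtypeₗᵢ := by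
    intro μ μ' hne v w
    have h : ⟪A v, (w : H)⟫_ℝ = ⟪(v : H), A w⟫_ℝ := hs v w
    rw [(hmem μ v).1 v.2, (hmem μ' w).1 w.2, real_inner_smul_left, real_inner_smul_right] at h
    have h' : (μ - μ') * ⟪(v : H), (w : H)⟫_ℝ = 0 := by linarith
    exact (mul_eq_zero.mp h').resolve_left (sub_ne_zero.mpr hne)
  -- The bases of all eigenspaces are joined. The index μ may run over all reals, since a trivial
  -- eigenspace has an empty basis; the kernel is the case μ = 0.
  have hon := horth.orthonormal_sigma_orthonormal
    (v_family := fun μ => (someBasis (V μ) : basisIndex (V μ) → V μ))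
    (fun μ => (someBasis (V μ)).orthonormal)
  refine ⟨Σ μ, basisIndex (V μ), HilbertBasis.mkOfOrthogonalEqBot hon ?_, fun i => i.1,
    fun i => ?_⟩
  · rw [eq_bot_iff]
    intro x hx
    have h := ContinuousLinearMap.orthogonalComplement_iSup_eigenspaces_eq_bot hc hs
    rw [← h, ← Submodule.iInf_orthogonal, Submodule.mem_iInf]
    intro μ
    rw [← hV, Submodule.mem_orthogonal']
    intro v hv
    have h0 : innerSL ℝ x ∘L (V μ).subtypeL = 0 :=
      clm_ext_hilbertBasis (someBasis (V μ)) fun i =>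
        (Submodule.mem_orthogonal' _ _).1 hx _ (Submodule.subset_span ⟨⟨μ, i⟩, rfl⟩)
    exact DFunLike.congr_fun h0 ⟨v, hv⟩
  · rw [HilbertBasis.coe_mkOfOrthogonalEqBot]
    exact (hmem _ _).1 (Subtype.property _)

/-- The spectral functional calculus of a diagonal operator. -/
theorem IsDiag.specFun_eq {e : HilbertBasis ι ℝ H} {a : ι → ℝ} {A G : H →L[ℝ] H}
    (hA : IsDiag e a A) (g : ℝ → ℝ) (hG : IsDiag e (fun i => g (a i)) G) (h : H) :
    specFun g A h = G h := by
  classical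
  have hproj : ∀ μ i, eigenProj A μ (e i) = if a i = μ then e i else 0 := fun μ i => by
    split_ifs with hi
    · exact eigenProj_of_eigenvector (by rw [hA i, hi])
    · exact eigenProj_of_eigenvector_ne hA.isSymmetric (fun h => hi h.symm) (hA i)
  have hsum : HasSum (fun i => e.repr h i • g (a i) • e i) (G h) := by
    simpa only [map_smul, hG _] using (e.hasSum_repr h).mapL G
  -- The basis expansion of G h is grouped by eigenvalue; the fibre over μ sums to g(μ) P_μ h.
  rw [← (Equiv.sigmaFiberEquiv a).hasSum_iff] at hsum
  refine (hsum.sigma fun μ => ?_).tsum_eq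
  have h1 : HasSum (fun i => e.repr h i • eigenProj A μ (e i)) (eigenProj A μ h) := by
    simpa only [map_smul] using (e.hasSum_repr h).mapL (eigenProj A μ)
  have h2 := (hasSum_subtype_iff_of_support_subset (s := {i | a i = μ}) ?_).2 (h1.const_smul (g μ))
  · have hfun : ((fun i => g μ • e.repr h i • eigenProj A μ (e i)) ∘ ((↑) : {i | a i = μ} → ι)) =
        fun c => ((fun i => e.repr h i • g (a i) • e i) ∘ Equiv.sigmaFiberEquiv a) ⟨μ, c⟩ := by
      funext i
      have hi : a i.1 = μ := i.2
      simp [hproj, hi, smul_comm (g μ)]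
    rw [hfun] at h2
    exact h2
  · intro i hi
    by_contra hne
    simp only [Set.mem_ofPred_eq] at hne
    simp [hproj, hne] at hi

/-! ### The Heinz inequality through parallel sums -/

section Heinz

/-- After clearing the denominator, the difference of the two sides is the square of a²(x − y) − s
y. -/
theorem mul_div_add_mul_sq_le (a s x y : ℝ) (hs : 0 < s) :
    a ^ 2 * s / (a ^ 2 + s) * x ^ 2 ≤ a ^ 2 * (x - y) ^ 2 + s * y ^ 2 := by
  rw [div_mul_eq_mul_div, div_le_iff₀ (by positivity)]
  nlinarith [sq_nonneg (a ^ 2 * (x - y) - s * y)]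

/-- The quadratic form `∑ᵢ aᵢ² s / (aᵢ² + s) ⟨eᵢ, x⟩²`, which is the minimum over `y` of
`‖A (x - y)‖² + s ‖y‖²` for the diagonal operator `A` with eigenvalues `aᵢ`. -/
def parallelForm (e : HilbertBasis ι ℝ H) (a : ι → ℝ) (s : ℝ) (x : H) : ℝ≥0∞ :=
  ∑' i, ENNReal.ofReal (a i ^ 2 * s / (a i ^ 2 + s) * ⟪e i, x⟫_ℝ ^ 2)

theorem IsDiag.hasSum_parallel {e : HilbertBasis ι ℝ H} {a : ι → ℝ} {A : H →L[ℝ] H}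
    (hA : IsDiag e a A) (s : ℝ) (x y : H) :
    HasSum (fun i => a i ^ 2 * (⟪e i, x⟫_ℝ - ⟪e i, y⟫_ℝ) ^ 2 + s * ⟪e i, y⟫_ℝ ^ 2)
      (‖A (x - y)‖ ^ 2 + s * ‖y‖ ^ 2) := by
  simpa only [inner_sub_right] using
    (hA.hasSum_norm_sq (x - y)).add ((hasSum_inner_sq e y).mul_left s)

theorem IsDiag.parallelForm_le {e : HilbertBasis ι ℝ H} {a : ι → ℝ} {A : H →L[ℝ] H}
    (hA : IsDiag e a A) {s : ℝ} (hs : 0 < s) (x y : H) :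
    parallelForm e a s x ≤ ENNReal.ofReal (‖A (x - y)‖ ^ 2 + s * ‖y‖ ^ 2) := by
  have h := hA.hasSum_parallel s x y
  rw [parallelForm, ← h.tsum_eq, ENNReal.ofReal_tsum_of_nonneg (fun i => by positivity) h.summable]
  exact ENNReal.tsum_le_tsum fun i =>
    ENNReal.ofReal_le_ofReal (mul_div_add_mul_sq_le _ _ _ _ hs)

theorem IsDiag.exists_parallelForm_eq {e : HilbertBasis ι ℝ H} {a : ι → ℝ} {A : H →L[ℝ] H}
    (hA : IsDiag e a A) {s : ℝ} (hs : 0 < s) (x : H) :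
    ∃ y, ENNReal.ofReal (‖A (x - y)‖ ^ 2 + s * ‖y‖ ^ 2) = parallelForm e a s x := by
  -- The minimizer is y = D x: in each coordinate a²(x − y)² + s y² is least at y = a² x / (a² + s).
  obtain ⟨D, hD⟩ := exists_isDiag e (f := fun i => a i ^ 2 / (a i ^ 2 + s)) (C := 1) fun i => by
    rw [abs_of_nonneg (by positivity), div_le_one (by positivity)]
    linarith
  refine ⟨D x, ?_⟩
  have h := hA.hasSum_parallel s x (D x)
  rw [parallelForm, ← h.tsum_eq, ENNReal.ofReal_tsum_of_nonneg (fun i => by positivity) h.summable]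
  refine tsum_congr fun i => ?_
  rw [hD.inner_apply]
  congr 1
  have : a i ^ 2 + s ≠ 0 := by positivity
  field_simp
  ring

/-- The constant in the integral representation of `a ↦ a ^ (2 θ)`. -/
def heinzConst (θ : ℝ) : ℝ≥0∞ :=
  ∫⁻ τ : ℝ, ENNReal.ofReal (Real.exp (θ * τ) / (1 + Real.exp τ))

theorem heinzConst_ne_zero (θ : ℝ) : heinzConst θ ≠ 0 := by
  rw [heinzConst]
  have hm : Measurable fun τ : ℝ => ENNReal.ofReal (Real.exp (θ * τ) / (1 + Real.exp τ)) := by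
    fun_prop
  rw [Ne, lintegral_eq_zero_iff hm]
  intro h
  have hpos : ∀ τ : ℝ, 0 < Real.exp (θ * τ) / (1 + Real.exp τ) := fun τ => by positivity
  have : ∀ᵐ _ : ℝ, False := by
    filter_upwards [h] with τ hτ
    simp only [Pi.zero_apply, ENNReal.ofReal_eq_zero] at hτ
    exact absurd (hpos τ) (not_lt.2 hτ)
  rw [Filter.eventually_const] at this
  simp at this

theorem heinzConst_ne_top {θ : ℝ} (h0 : 0 < θ) (h1 : θ < 1) : heinzConst θ ≠ ∞ := by
  have hI1 : IntegrableOn (fun τ : ℝ => Real.exp (θ * τ)) (Set.Iic 0) :=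
    integrableOn_exp_mul_Iic h0 0
  have hI2 : IntegrableOn (fun τ : ℝ => Real.exp ((θ - 1) * τ)) (Set.Ioi 0) :=
    integrableOn_exp_mul_Ioi (by linarith) 0
  have hm : Measurable fun τ : ℝ => Real.exp (θ * τ) / (1 + Real.exp τ) := by fun_prop
  have h : Integrable fun τ : ℝ => Real.exp (θ * τ) / (1 + Real.exp τ) := by
    rw [← integrableOn_univ, ← Set.Iic_union_Ioi (a := (0 : ℝ))]
    refine IntegrableOn.union (hI1.mono' hm.aestronglyMeasurable ?_)
      (hI2.mono' hm.aestronglyMeasurable ?_)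
    · refine Filter.Eventually.of_forall fun τ => ?_
      rw [Real.norm_of_nonneg (by positivity)]
      exact div_le_self (by positivity) (by linarith [Real.exp_pos τ])
    · refine Filter.Eventually.of_forall fun τ => ?_
      rw [Real.norm_of_nonneg (by positivity), sub_mul, one_mul, Real.exp_sub]
      gcongr
      linarith
  exact h.lintegral_lt_top.ne

/-- With s = e^τ, scaling by a² becomes the translation τ ↦ τ + 2 log a, under which Lebesgue
measure is invariant. The factor a^{2θ} comes out and the remaining constant does not depend on a.
-/
theorem lintegral_parallel {θ a : ℝ} (ha : 0 < a) {c : ℝ} (hc : 0 ≤ c) :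
    ∫⁻ τ : ℝ, ENNReal.ofReal (Real.exp ((θ - 1) * τ)) *
        ENNReal.ofReal (a ^ 2 * Real.exp τ / (a ^ 2 + Real.exp τ) * c) =
      ENNReal.ofReal ((a ^ θ) ^ 2 * c) * heinzConst θ := by
  rw [← lintegral_add_right_eq_self _ (2 * Real.log a), heinzConst,
    ← lintegral_const_mul _ (by fun_prop)]
  refine lintegral_congr fun τ => ?_
  rw [← ENNReal.ofReal_mul (by positivity), ← ENNReal.ofReal_mul (by positivity)]
  congr 1
  have h2 : Real.exp (2 * Real.log a) = a ^ 2 := by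
    rw [mul_comm, Real.exp_mul, Real.exp_log ha, Real.rpow_two]
  have h3 : (a ^ θ) ^ 2 = Real.exp (θ * (2 * Real.log a)) := by
    rw [Real.rpow_def_of_pos ha, ← Real.exp_nat_mul]
    congr 1; push_cast; ring
  rw [Real.exp_add, h2, h3, sub_mul, one_mul, Real.exp_sub, Real.exp_add, h2, mul_add,
    Real.exp_add]
  have := Real.exp_pos τ
  field_simp

theorem IsDiag.lintegral_parallelForm [Countable ι] {e : HilbertBasis ι ℝ H} {a : ι → ℝ} {θ : ℝ}
    {A' : H →L[ℝ] H} (ha : ∀ i, 0 < a i) (hA' : IsDiag e (fun i => a i ^ θ) A') (x : H) :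
    ∫⁻ τ : ℝ, ENNReal.ofReal (Real.exp ((θ - 1) * τ)) * parallelForm e a (Real.exp τ) x =
      ENNReal.ofReal (‖A' x‖ ^ 2) * heinzConst θ := by
  have hs := hA'.hasSum_norm_sq x
  simp only [parallelForm, ← ENNReal.tsum_mul_left]
  rw [lintegral_tsum fun i => by fun_prop, ← hs.tsum_eq,
    ENNReal.ofReal_tsum_of_nonneg (fun i => by positivity) hs.summable, ← ENNReal.tsum_mul_right]
  exact tsum_congr fun i => lintegral_parallel (ha i) (sq_nonneg _)

/-- The Heinz inequality, for positive diagonal operators: if `‖A x‖ ≤ ‖B x‖` for all `x`, then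
`‖A ^ θ x‖ ≤ ‖B ^ θ x‖` for all `0 < θ < 1`. -/
theorem heinz_aux [Countable ι] [Countable κ] {e : HilbertBasis ι ℝ H} {e' : HilbertBasis κ ℝ H}
    {a : ι → ℝ} {b : κ → ℝ} {A B A' B' : H →L[ℝ] H} (hA : IsDiag e a A) (hB : IsDiag e' b B)
    (ha : ∀ i, 0 < a i) (hb : ∀ i, 0 < b i) (h : ∀ x, ‖A x‖ ≤ ‖B x‖) {θ : ℝ} (h0 : 0 < θ)
    (h1 : θ < 1) (hA' : IsDiag e (fun i => a i ^ θ) A') (hB' : IsDiag e' (fun i => b i ^ θ) B')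
    (x : H) : ‖A' x‖ ≤ ‖B' x‖ := by
  -- As a minimum over y of quantities increasing in ‖A (x − y)‖, the parallel form respects the
  -- order of A and B, although they are diagonal in different bases.
  have key : ∀ s, 0 < s → parallelForm e a s x ≤ parallelForm e' b s x := fun s hs => by
    obtain ⟨y, hy⟩ := hB.exists_parallelForm_eq hs x
    rw [← hy]
    refine (hA.parallelForm_le hs x y).trans (ENNReal.ofReal_le_ofReal ?_)
    have := h (x - y)
    gcongr
  have hle := lintegral_mono (μ := volume) fun τ : ℝ =>
    mul_le_mul_right (key (Real.exp τ) (Real.exp_pos τ)) (ENNReal.ofReal (Real.exp ((θ - 1) * τ)))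
  rw [hA'.lintegral_parallelForm ha, hB'.lintegral_parallelForm hb,
    ENNReal.mul_le_mul_iff_left (heinzConst_ne_zero θ) (heinzConst_ne_top h0 h1),
    ENNReal.ofReal_le_ofReal_iff (sq_nonneg _)] at hle
  exact (sq_le_sq₀ (norm_nonneg _) (norm_nonneg _)).1 hle

theorem heinz [Countable ι] [Countable κ] {e : HilbertBasis ι ℝ H} {e' : HilbertBasis κ ℝ H}
    {a : ι → ℝ} {b : κ → ℝ} {A B A' B' : H →L[ℝ] H} (hA : IsDiag e a A) (hB : IsDiag e' b B)
    (ha : ∀ i, 0 < a i) (hb : ∀ i, 0 < b i) {k : ℝ} (hk : 0 < k) (h : ∀ x, ‖A x‖ ≤ k * ‖B x‖)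
    {θ : ℝ} (h0 : 0 ≤ θ) (h1 : θ ≤ 1) (hA' : IsDiag e (fun i => a i ^ θ) A')
    (hB' : IsDiag e' (fun i => b i ^ θ) B') (x : H) : ‖A' x‖ ≤ k ^ θ * ‖B' x‖ := by
  -- The integral defining `heinzConst` diverges at θ = 0 and θ = 1, so the endpoints are treated
  -- directly.
  rcases h0.eq_or_lt with rfl | h0
  · simp only [Real.rpow_zero] at hA' hB' ⊢
    rw [hA'.unique IsDiag.id, hB'.unique IsDiag.id, one_mul]
  rcases h1.eq_or_lt with rfl | h1
  · simp only [Real.rpow_one] at hA' hB' ⊢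
    rw [hA'.unique hA, hB'.unique hB]
    exact h x
  have hBk := hB.smul k
  have hBk' : IsDiag e' (fun i => (k * b i) ^ θ) (k ^ θ • B') := fun i => by
    simp only [Real.mul_rpow hk.le (hb i).le]
    exact hB'.smul (k ^ θ) i
  have := heinz_aux hA hBk ha (fun i => mul_pos hk (hb i))
    (fun x => by simpa [norm_smul, abs_of_pos hk] using h x) h0 h1 hA' hBk' x
  simpa [norm_smul, abs_of_nonneg (Real.rpow_nonneg hk.le θ)] using this

end Heinz

end Diagonal

/-! ### Hilbert–Schmidt norms and their ℓ² coordinates -/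

section HilbertSchmidt

variable {ι H Y V : Type*} [NormedAddCommGroup H] [InnerProductSpace ℝ H] [CompleteSpace H]
  [NormedAddCommGroup Y] [InnerProductSpace ℝ Y] [CompleteSpace Y]

/-- The Hilbert-Schmidt norm as an extended nonnegative real. -/
def hsENorm (T : H →L[ℝ] Y) : ℝ≥0∞ :=
  hsNormSq T ^ (1 / 2 : ℝ)

theorem hsENorm_eq_tsum (e : HilbertBasis ι ℝ H) (T : H →L[ℝ] Y) :
    hsENorm T = (∑' i, ‖T (e i)‖ₑ ^ (2 : ℝ)) ^ (1 / 2 : ℝ) := by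
  simp only [hsENorm, hsNormSq_eq e, ENNReal.rpow_two]

/-- Minkowski's inequality for the counting measure on the index set. -/
theorem hsENorm_add_le (S T : H →L[ℝ] Y) : hsENorm (S + T) ≤ hsENorm S + hsENorm T := by
  simp only [hsENorm_eq_tsum (someBasis H)]
  let _ : MeasurableSpace (basisIndex H) := ⊤
  have h := ENNReal.lintegral_Lp_add_le (μ := Measure.count) (p := 2)
    (f := fun i => ‖S (someBasis H i)‖ₑ) (g := fun i => ‖T (someBasis H i)‖ₑ)
    measurable_from_top.aemeasurable measurable_from_top.aemeasurable one_le_two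
  simp only [lintegral_count] at h
  refine le_trans ?_ h
  gcongr
  exact enorm_add_le _ _

theorem hsENorm_neg (T : H →L[ℝ] Y) : hsENorm (-T) = hsENorm T := by
  simp [hsENorm, hsNormSq]

theorem hsENorm_sub_le (S T : H →L[ℝ] Y) : hsENorm (S - T) ≤ hsENorm S + hsENorm T := by
  rw [sub_eq_add_neg, ← hsENorm_neg T]
  exact hsENorm_add_le _ _

theorem hsENorm_zero : hsENorm (0 : H →L[ℝ] Y) = 0 := by
  simp [hsENorm, hsNormSq]

theorem hsENorm_sum_le (s : Finset ι) (T : ι → H →L[ℝ] Y) :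
    hsENorm (∑ i ∈ s, T i) ≤ ∑ i ∈ s, hsENorm (T i) :=
  Finset.le_sum_of_subadditive _ hsENorm_zero.le hsENorm_add_le _ _

theorem enorm_apply_le (T : H →L[ℝ] Y) (x : H) : ‖T x‖ₑ ≤ ‖T‖ₑ * ‖x‖ₑ := T.le_opENorm x

/-- After passing to adjoints, A* is applied last, and its operator norm comes out of each term. -/
theorem hsENorm_comp_le (T : H →L[ℝ] Y) (A : H →L[ℝ] H) :
    hsENorm (T ∘L A) ≤ hsENorm T * ‖A‖ₑ := by
  have h : hsNormSq (T ∘L A) ≤ hsNormSq T * ‖A‖ₑ ^ 2 := by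
    rw [hsNormSq, tsum_enorm_sq_eq_adjoint _ (someBasis Y), hsNormSq,
      tsum_enorm_sq_eq_adjoint _ (someBasis Y), ← ENNReal.tsum_mul_right]
    refine ENNReal.tsum_le_tsum fun i => ?_
    rw [ContinuousLinearMap.adjoint_comp, ← mul_pow, mul_comm]
    gcongr
    refine (enorm_apply_le A.adjoint _).trans_eq ?_
    rw [← ofReal_norm A.adjoint, LinearIsometryEquiv.norm_map, ofReal_norm]
    rfl
  rw [hsENorm, hsENorm]
  refine (ENNReal.rpow_le_rpow h (by norm_num)).trans_eq ?_
  rw [ENNReal.mul_rpow_of_nonneg _ _ (by norm_num), ← ENNReal.rpow_two, ← ENNReal.rpow_mul]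
  norm_num

theorem hsENorm_comp_le_ofReal {T : H →L[ℝ] Y} {A : H →L[ℝ] H} {c d : ℝ}
    (hc : 0 ≤ c) (hT : hsENorm T ≤ ENNReal.ofReal c) (hA : ‖A‖ ≤ d) :
    hsENorm (T ∘L A) ≤ ENNReal.ofReal (c * d) := by
  rw [ENNReal.ofReal_mul hc]
  refine (hsENorm_comp_le T A).trans (mul_le_mul' hT ?_)
  rw [← ofReal_norm]
  exact ENNReal.ofReal_le_ofReal hA

theorem enorm_apply_le_hsENorm (T : H →L[ℝ] Y) (x : H) : ‖T x‖ₑ ≤ hsENorm T * ‖x‖ₑ := by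
  have h : ‖T x‖ₑ ^ 2 ≤ hsNormSq T * ‖x‖ₑ ^ 2 := by
    rw [hsNormSq, tsum_enorm_sq_eq_adjoint _ (someBasis Y), ← tsum_enorm_inner_sq (someBasis Y),
      ← ENNReal.tsum_mul_right]
    refine ENNReal.tsum_le_tsum fun i => ?_
    rw [← mul_pow, ← ContinuousLinearMap.adjoint_inner_right, mul_comm]
    gcongr
    rw [← ofReal_norm, ← ofReal_norm x, ← ofReal_norm (T.adjoint _),
      ← ENNReal.ofReal_mul (norm_nonneg _)]
    exact ENNReal.ofReal_le_ofReal (norm_inner_le_norm _ _)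
  have h2 := ENNReal.rpow_le_rpow h (z := 1 / 2) (by norm_num)
  rw [ENNReal.mul_rpow_of_nonneg _ _ (by norm_num), ← ENNReal.rpow_two, ← ENNReal.rpow_two,
    ← ENNReal.rpow_mul, ← ENNReal.rpow_mul] at h2
  simpa [hsENorm] using h2

theorem opNorm_le_of_hsENorm_le {T : H →L[ℝ] Y} {c : ℝ} (hc : 0 ≤ c)
    (hT : hsENorm T ≤ ENNReal.ofReal c) : ‖T‖ ≤ c := by
  refine T.opNorm_le_bound hc fun x => ?_
  have h := (enorm_apply_le_hsENorm T x).trans (mul_le_mul_left hT _)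
  rwa [← ofReal_norm, ← ofReal_norm, ← ENNReal.ofReal_mul hc,
    ENNReal.ofReal_le_ofReal_iff (by positivity)] at h

theorem hsENorm_eq_ofReal_hsNorm {T : H →L[ℝ] Y} (hT : IsHilbertSchmidt T) :
    hsENorm T = ENNReal.ofReal (hsNorm T) := by
  rw [hsENorm, hsNorm, Real.sqrt_eq_rpow, ← ENNReal.ofReal_rpow_of_nonneg ENNReal.toReal_nonneg
    (by norm_num), ENNReal.ofReal_toReal hT]

/-! The tensors `v ⊗ u` as elements of the Hilbert space `ℓ²(ι, V)` -/

variable [NormedAddCommGroup V] [InnerProductSpace ℝ V]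

theorem memℓp_tensor (e : HilbertBasis ι ℝ H) (v : V) (u : H) :
    Memℓp (fun i => ⟪e i, u⟫_ℝ • v) 2 := by
  refine memℓp_gen ?_
  simp only [norm_smul, ENNReal.toReal_ofNat, Real.rpow_two, mul_pow, Real.norm_eq_abs, sq_abs]
  exact (hasSum_inner_sq e u).summable.mul_right _

/-- The coordinates of the rank one operator `v ⊗ u` with respect to the Hilbert basis `e`, as a
bilinear map. -/
def hsTensorLinear (e : HilbertBasis ι ℝ H) : V →ₗ[ℝ] H →ₗ[ℝ] lp (fun _ : ι => V) 2 :=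
  LinearMap.mk₂ ℝ (fun v u => (⟨_, memℓp_tensor e v u⟩ : lp (fun _ : ι => V) 2))
    (fun _ _ _ => lp.ext (funext fun _ => smul_add _ _ _))
    (fun _ _ _ => lp.ext (funext fun _ => smul_comm _ _ _))
    (fun _ _ _ => lp.ext (funext fun _ => by
      rw [lp.coeFn_add, Pi.add_apply]
      simp only [inner_add_right, add_smul]))
    (fun _ _ _ => lp.ext (funext fun _ => by
      rw [lp.coeFn_smul, Pi.smul_apply]
      simp only [real_inner_smul_right, mul_smul]))

theorem norm_hsTensorLinear_le (e : HilbertBasis ι ℝ H) (v : V) (u : H) :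
    ‖hsTensorLinear e v u‖ ≤ 1 * ‖v‖ * ‖u‖ := by
  refine (sq_le_sq₀ (norm_nonneg _) (by positivity)).1 ?_
  have h1 := lp.hasSum_norm (p := 2) (by norm_num)
    (⟨_, memℓp_tensor e v u⟩ : lp (fun _ : ι => V) 2)
  have h2 := (hasSum_inner_sq e u).mul_right (‖v‖ ^ 2)
  simp only [ENNReal.toReal_ofNat, Real.rpow_two, norm_smul, mul_pow, Real.norm_eq_abs,
    sq_abs] at h1
  refine (h1.unique h2).le.trans_eq ?_
  ring

/-- The coordinates of the rank one operator `v ⊗ u` with respect to the Hilbert basis `e`. -/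
def hsTensor (e : HilbertBasis ι ℝ H) : V →L[ℝ] H →L[ℝ] lp (fun _ : ι => V) 2 :=
  LinearMap.mkContinuous₂ (hsTensorLinear e) 1 (norm_hsTensorLinear_le e)

theorem norm_hsTensor_le (e : HilbertBasis ι ℝ H) (v : V) (u : H) :
    ‖hsTensor e v u‖ ≤ ‖v‖ * ‖u‖ := by
  have h := norm_hsTensorLinear_le e v u
  rw [one_mul] at h
  exact h

/-- Transfers Hilbert–Schmidt norms to the Hilbert space ℓ²(ι, Y), where Bochner integrals and
concentration inequalities apply. -/
theorem hsENorm_eq_of_coord (e : HilbertBasis ι ℝ H) (T : H →L[ℝ] Y)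
    (w : lp (fun _ : ι => Y) 2) (h : ∀ i, T (e i) = w i) :
    hsENorm T = ENNReal.ofReal ‖w‖ := by
  have hw := lp.hasSum_norm (p := 2) (by norm_num) w
  simp only [ENNReal.toReal_ofNat, Real.rpow_two] at hw
  have : hsNormSq T = ENNReal.ofReal (‖w‖ ^ 2) := by
    rw [hsNormSq_eq e, ← hw.tsum_eq, ENNReal.ofReal_tsum_of_nonneg (fun _ => sq_nonneg _) hw.summable]
    refine tsum_congr fun i => ?_
    rw [h, ENNReal.ofReal_pow (norm_nonneg _), ofReal_norm]
  rw [hsENorm, this, ENNReal.ofReal_rpow_of_nonneg (sq_nonneg _) (by norm_num),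
    ← Real.sqrt_eq_rpow, Real.sqrt_sq (norm_nonneg _)]

end HilbertSchmidt

/-! ### Concentration of sums of independent Hilbert space valued vectors -/

section Concentration

variable {Z G : Type*} [MeasurableSpace Z] [NormedAddCommGroup G] [InnerProductSpace ℝ G]

/-- The power series of cosh has only even powers, with nonnegative coefficients, so substituting √x
leaves a nonnegative combination of the convex functions xⁿ. -/
theorem convexOn_cosh_sqrt : ConvexOn ℝ (Set.Ici 0) fun x => Real.cosh (√x) := by
  refine ⟨convex_Ici 0, fun x hx y hy a b ha hb hab => ?_⟩
  have hc : ∀ z ∈ Set.Ici (0 : ℝ), HasSum (fun n : ℕ => z ^ n / ((2 * n).factorial : ℝ))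
      (Real.cosh (√z)) := fun z hz => by
    have h := Real.hasSum_cosh (√z)
    simpa only [pow_mul, Real.sq_sqrt (Set.mem_Ici.1 hz)] using h
  refine hasSum_le (fun n => ?_) (hc _ (convex_Ici 0 hx hy ha hb hab))
    (((hc x hx).mul_left a).add ((hc y hy).mul_left b))
  have h := (convexOn_pow n).2 hx hy ha hb hab
  simp only [smul_eq_mul] at h ⊢
  calc _ ≤ (a * x ^ n + b * y ^ n) / ((2 * n).factorial : ℝ) := by gcongr
    _ = _ := by ring

/-- Let r be the cosine of the angle between v and ξ. Then ‖v + ξ‖² is the convex combination of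
(‖v‖ − ‖ξ‖)² and (‖v‖ + ‖ξ‖)² with weights (1 − r)/2 and (1 + r)/2; convexity of cosh √x and the
addition formulas do the rest. -/
theorem cosh_norm_add_le_aux {v ξ : G} (hv : v ≠ 0) (hξ : ξ ≠ 0) :
    Real.cosh ‖v + ξ‖ ≤ Real.cosh ‖v‖ * Real.cosh ‖ξ‖ +
      ⟪v, ξ⟫_ℝ / (‖v‖ * ‖ξ‖) * (Real.sinh ‖v‖ * Real.sinh ‖ξ‖) := by
  have ha : 0 < ‖v‖ := norm_pos_iff.2 hv
  have hd : 0 < ‖ξ‖ := norm_pos_iff.2 hξ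
  have hr := abs_le.1 (abs_real_inner_div_norm_mul_norm_le_one v ξ)
  set a := ‖v‖ with ha'
  set d := ‖ξ‖ with hd'
  set r := ⟪v, ξ⟫_ℝ / (a * d) with hr'
  have hin : ⟪v, ξ⟫_ℝ = r * (a * d) := by rw [hr']; field_simp
  have h := convexOn_cosh_sqrt.2 (Set.mem_Ici.2 (sq_nonneg (a - d)))
    (Set.mem_Ici.2 (sq_nonneg (a + d))) (show 0 ≤ (1 - r) / 2 by linarith)
    (show 0 ≤ (1 + r) / 2 by linarith) (by ring)
  simp only [smul_eq_mul] at h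
  have hx : (1 - r) / 2 * (a - d) ^ 2 + (1 + r) / 2 * (a + d) ^ 2 = ‖v + ξ‖ ^ 2 := by
    rw [norm_add_sq_real, hin]; ring
  rw [hx, Real.sqrt_sq (norm_nonneg _), Real.sqrt_sq_eq_abs, Real.sqrt_sq_eq_abs, Real.cosh_abs,
    Real.cosh_abs, Real.cosh_sub, Real.cosh_add] at h
  linarith

/-- The last term is linear in ξ and integrates to zero for centred ξ. Replacing sinh ‖ξ‖ by ‖ξ‖
there costs at most cosh ‖v‖ (sinh ‖ξ‖ − ‖ξ‖), as r ≤ 1, and this is absorbed by exp d − 1 − d ≤ d²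
for d = ‖ξ‖. -/
theorem cosh_norm_add_le (v ξ : G) (hξ : ‖ξ‖ ≤ 1) :
    Real.cosh ‖v + ξ‖ ≤ Real.cosh ‖v‖ * (1 + ‖ξ‖ ^ 2) + Real.sinh ‖v‖ / ‖v‖ * ⟪v, ξ⟫_ℝ := by
  have hexp : Real.exp ‖ξ‖ - 1 - ‖ξ‖ ≤ ‖ξ‖ ^ 2 :=
    (le_abs_self _).trans (Real.abs_exp_sub_one_sub_id_le (by rwa [abs_norm]))
  rcases eq_or_ne ξ 0 with rfl | hξ0
  · simp
  have hd := norm_pos_iff.2 hξ0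
  have hsd : ‖ξ‖ ≤ Real.sinh ‖ξ‖ := Real.self_le_sinh_iff.2 hd.le
  rw [← Real.cosh_add_sinh] at hexp
  rcases eq_or_ne v 0 with rfl | hv0
  · simp only [zero_add, norm_zero, Real.cosh_zero, one_mul, inner_zero_left, mul_zero, add_zero]
    linarith
  have ha := norm_pos_iff.2 hv0
  have hr := (abs_le.1 (abs_real_inner_div_norm_mul_norm_le_one v ξ)).2
  refine (cosh_norm_add_le_aux hv0 hξ0).trans ?_
  have h1 : Real.sinh ‖v‖ / ‖v‖ * ⟪v, ξ⟫_ℝ =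
      ⟪v, ξ⟫_ℝ / (‖v‖ * ‖ξ‖) * (Real.sinh ‖v‖ * ‖ξ‖) := by field_simp
  rw [h1]
  set r := ⟪v, ξ⟫_ℝ / (‖v‖ * ‖ξ‖)
  have hsa : 0 ≤ Real.sinh ‖v‖ := Real.sinh_nonneg_iff.2 ha.le
  have hca : Real.sinh ‖v‖ ≤ Real.cosh ‖v‖ := (Real.sinh_lt_cosh _).le
  have h2 : r * Real.sinh ‖v‖ ≤ Real.cosh ‖v‖ := by nlinarith
  have h3 := mul_le_mul_of_nonneg_right h2 (sub_nonneg.2 hsd)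
  have h4 := mul_le_mul_of_nonneg_left hexp (Real.cosh_pos ‖v‖).le
  linarith

/-- Iterated conditioning for a sum of independent, identically distributed vectors. -/
theorem lintegral_pi_sum_le (μ : Measure Z) [IsProbabilityMeasure μ] {F : Z → G}
    (hF : StronglyMeasurable F) (Ψ : ℕ → G → ℝ≥0∞) (hΨ : Continuous (Ψ 0))
    (hstep : ∀ n v, ∫⁻ z, Ψ n (v + F z) ∂μ ≤ Ψ (n + 1) v) (n : ℕ) (v : G) :
    ∫⁻ z, Ψ 0 (v + ∑ i, F (z i)) ∂(Measure.pi fun _ : Fin n => μ) ≤ Ψ n v := by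
  induction n generalizing v with
  | zero => simp
  | succ n ih =>
    -- The first summand is split off and absorbed into the starting vector, which is why v is
    -- arbitrary in the induction.
    have hmp := (measurePreserving_piFinSuccAbove (fun _ : Fin (n + 1) => μ) 0).symm
    rw [← hmp.lintegral_comp_emb (MeasurableEquiv.measurableEmbedding _)]
    have hsum : ∀ p : Z × (Fin n → Z),
        v + ∑ i, F ((MeasurableEquiv.piFinSuccAbove (fun _ => Z) 0).symm p i) =
          (v + F p.1) + ∑ i, F (p.2 i) := fun p => by
      rw [Fin.sum_univ_succ, add_assoc]
      rfl
    simp only [hsum]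
    have hm : StronglyMeasurable fun p : Z × (Fin n → Z) => (v + F p.1) + ∑ i, F (p.2 i) := by
      refine (stronglyMeasurable_const.add (hF.comp_measurable measurable_fst)).add ?_
      refine Finset.stronglyMeasurable_fun_sum _ fun i _ => hF.comp_measurable ?_
      fun_prop
    rw [lintegral_prod _ (hΨ.comp_stronglyMeasurable hm).measurable.aemeasurable]
    exact (lintegral_mono fun z => ih (v + F z)).trans (hstep n v)

variable [CompleteSpace G]

theorem integrable_of_norm_le {μ : Measure Z} [IsFiniteMeasure μ] {F : Z → G}
    (hF : StronglyMeasurable F) {L : ℝ} (hL : ∀ᵐ z ∂μ, ‖F z‖ ≤ L) : Integrable F μ :=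
  Integrable.of_bound hF.aestronglyMeasurable L hL

theorem integrable_norm_sq_of_norm_le {μ : Measure Z} [IsFiniteMeasure μ] {F : Z → G}
    (hF : StronglyMeasurable F) {L : ℝ} (hL : ∀ᵐ z ∂μ, ‖F z‖ ≤ L) :
    Integrable (fun z => ‖F z‖ ^ 2) μ := by
  refine Integrable.of_bound (hF.norm.pow 2).aestronglyMeasurable (L ^ 2) ?_
  filter_upwards [hL] with z hz
  rw [norm_pow, norm_norm]
  gcongr

theorem lintegral_cosh_step (μ : Measure Z) [IsProbabilityMeasure μ] {F : Z → G}
    (hF : StronglyMeasurable F) (hL : ∀ᵐ z ∂μ, ‖F z‖ ≤ 1) (h0 : ∫ z, F z ∂μ = 0) {W : ℝ}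
    (hW : ∫ z, ‖F z‖ ^ 2 ∂μ ≤ W) (v : G) :
    ∫⁻ z, ENNReal.ofReal (Real.cosh ‖v + F z‖) ∂μ ≤
      ENNReal.ofReal (1 + W) * ENNReal.ofReal (Real.cosh ‖v‖) := by
  have hi1 := integrable_of_norm_le hF hL
  have hi2 := integrable_norm_sq_of_norm_le hF hL
  have hle : ∀ᵐ z ∂μ, Real.cosh ‖v + F z‖ ≤
      Real.cosh ‖v‖ * (1 + ‖F z‖ ^ 2) + Real.sinh ‖v‖ / ‖v‖ * ⟪v, F z⟫_ℝ := by
    filter_upwards [hL] with z hz using cosh_norm_add_le v _ hz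
  have hint1 : Integrable (fun z => Real.cosh ‖v‖ * (1 + ‖F z‖ ^ 2)) μ :=
    ((integrable_const _).add hi2).const_mul _
  have hint2 : Integrable (fun z => Real.sinh ‖v‖ / ‖v‖ * ⟪v, F z⟫_ℝ) μ :=
    (hi1.const_inner v).const_mul _
  refine (lintegral_mono_ae (hle.mono fun z hz => ENNReal.ofReal_le_ofReal hz)).trans ?_
  rw [← ofReal_integral_eq_lintegral_ofReal (hint1.fun_add hint2)
    (hle.mono fun z hz => (Real.cosh_pos _).le.trans hz)]
  have h1W : 0 ≤ 1 + W := by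
    have : 0 ≤ ∫ z, ‖F z‖ ^ 2 ∂μ := integral_nonneg fun z => sq_nonneg _
    linarith
  rw [← ENNReal.ofReal_mul h1W]
  refine ENNReal.ofReal_le_ofReal ?_
  rw [integral_add hint1 hint2, integral_const_mul, integral_const_mul, integral_inner hi1, h0,
    inner_zero_right, mul_zero, add_zero, integral_add (integrable_const _) hi2, integral_const]
  simp only [probReal_univ, one_smul]
  nlinarith [Real.cosh_pos ‖v‖]

theorem lintegral_sq_step (μ : Measure Z) [IsProbabilityMeasure μ] {F : Z → G}
    (hF : StronglyMeasurable F) {L : ℝ} (hL : ∀ᵐ z ∂μ, ‖F z‖ ≤ L) (h0 : ∫ z, F z ∂μ = 0) {W : ℝ}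
    (hW : ∫ z, ‖F z‖ ^ 2 ∂μ ≤ W) {c : ℝ} (hc : 0 ≤ c) (v : G) :
    ∫⁻ z, ENNReal.ofReal (‖v + F z‖ ^ 2 + c) ∂μ ≤ ENNReal.ofReal (‖v‖ ^ 2 + (c + W)) := by
  have hi1 := integrable_of_norm_le hF hL
  have hi2 := integrable_norm_sq_of_norm_le hF hL
  have heq : ∀ z, ‖v + F z‖ ^ 2 + c = (‖v‖ ^ 2 + c) + 2 * ⟪v, F z⟫_ℝ + ‖F z‖ ^ 2 := fun z => by
    rw [norm_add_sq_real]; ring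
  have hint2 : Integrable (fun z => 2 * ⟪v, F z⟫_ℝ) μ := (hi1.const_inner v).const_mul _
  have hint : Integrable (fun z => ‖v + F z‖ ^ 2 + c) μ := by
    simp only [heq]
    exact ((integrable_const _).add hint2).add hi2
  rw [← ofReal_integral_eq_lintegral_ofReal hint (.of_forall fun z => by positivity)]
  refine ENNReal.ofReal_le_ofReal ?_
  simp only [heq]
  rw [integral_add ((integrable_const _).fun_add hint2) hi2, integral_add (integrable_const _) hint2,
    integral_const_mul, integral_inner hi1, h0, integral_const]
  simp only [probReal_univ, one_smul, inner_zero_right]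
  linarith

theorem stronglyMeasurable_pi_sum {F : Z → G} (hF : StronglyMeasurable F) (n : ℕ) :
    StronglyMeasurable fun z : Fin n → Z => ∑ i, F (z i) :=
  Finset.stronglyMeasurable_fun_sum _ fun i _ => hF.comp_measurable (by fun_prop)

theorem lintegral_pi_norm_sq_le (μ : Measure Z) [IsProbabilityMeasure μ] {F : Z → G}
    (hF : StronglyMeasurable F) {L : ℝ} (hL : ∀ᵐ z ∂μ, ‖F z‖ ≤ L) (h0 : ∫ z, F z ∂μ = 0) {W : ℝ}
    (hW : ∫ z, ‖F z‖ ^ 2 ∂μ ≤ W) (n : ℕ) :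
    ∫⁻ z, ENNReal.ofReal (‖∑ i, F (z i)‖ ^ 2) ∂(Measure.pi fun _ : Fin n => μ) ≤
      ENNReal.ofReal (n * W) := by
  have hW0 : 0 ≤ W := (integral_nonneg fun z => sq_nonneg _).trans hW
  have h := lintegral_pi_sum_le μ hF (fun k v => ENNReal.ofReal (‖v‖ ^ 2 + k * W))
    (ENNReal.continuous_ofReal.comp (by fun_prop)) (fun k v => by
      refine (lintegral_sq_step μ hF hL h0 hW (by positivity) v).trans_eq ?_
      congr 2; push_cast; ring) n 0
  simpa using h

/-- The degenerate case of zero variance, where the deviation inequalities below cannot divide by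
their scale. -/
theorem measure_pi_norm_sum_pos_eq_zero (μ : Measure Z) [IsProbabilityMeasure μ] {F : Z → G}
    (hF : StronglyMeasurable F) {L : ℝ} (hL : ∀ᵐ z ∂μ, ‖F z‖ ≤ L) (h0 : ∫ z, F z ∂μ = 0) {W : ℝ}
    (hW : ∫ z, ‖F z‖ ^ 2 ∂μ ≤ W) {n : ℕ} (hn : n * W = 0) :
    (Measure.pi fun _ : Fin n => μ) {z | 0 < ‖∑ i, F (z i)‖} = 0 := by
  have h := lintegral_pi_norm_sq_le μ hF hL h0 hW n
  have hm : Measurable fun z : Fin n → Z => ENNReal.ofReal (‖∑ i, F (z i)‖ ^ 2) :=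
    ((stronglyMeasurable_pi_sum hF n).norm.measurable.pow_const 2).ennreal_ofReal
  rw [hn] at h
  have h' := (lintegral_eq_zero_iff hm).1 (by simpa using h)
  rw [← nonpos_iff_eq_zero, ← ae_iff.1 h']
  refine measure_mono fun z hz => ?_
  have : 0 < ‖∑ i, F (z i)‖ := hz
  change ¬ (ENNReal.ofReal (‖∑ i, F (z i)‖ ^ 2) = 0)
  rw [ENNReal.ofReal_eq_zero, not_le]
  positivity

/-- Chebyshev's inequality for sums of independent Hilbert space valued random vectors. -/
theorem measure_pi_norm_sum_gt_le (μ : Measure Z) [IsProbabilityMeasure μ] {F : Z → G}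
    (hF : StronglyMeasurable F) {L : ℝ} (hL : ∀ᵐ z ∂μ, ‖F z‖ ≤ L) (h0 : ∫ z, F z ∂μ = 0) {σ : ℝ}
    (hσ : 0 ≤ σ) (hW : ∫ z, ‖F z‖ ^ 2 ∂μ ≤ σ ^ 2) (n : ℕ) {a : ℝ} (ha : 0 < a) :
    (Measure.pi fun _ : Fin n => μ) {z | a * (σ * √n) < ‖∑ i, F (z i)‖} ≤
      ENNReal.ofReal (1 / a ^ 2) := by
  have h := lintegral_pi_norm_sq_le μ hF hL h0 hW n
  have hm : Measurable fun z : Fin n → Z => ENNReal.ofReal (‖∑ i, F (z i)‖ ^ 2) :=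
    ((stronglyMeasurable_pi_sum hF n).norm.measurable.pow_const 2).ennreal_ofReal
  have hsq : (σ * √n) ^ 2 = n * σ ^ 2 := by
    rw [mul_pow, Real.sq_sqrt (Nat.cast_nonneg n), mul_comm]
  rcases (mul_nonneg hσ (Real.sqrt_nonneg n)).eq_or_lt with hz | hpos
  · rw [← hz] at hsq ⊢
    have := measure_pi_norm_sum_pos_eq_zero μ hF hL h0 hW (n := n) (by rw [← hsq]; ring)
    simp only [mul_zero, this, zero_le]
  · have hpos2 : 0 < (a * (σ * √n)) ^ 2 := by positivity
    have hsub : {z : Fin n → Z | a * (σ * √n) < ‖∑ i, F (z i)‖} ⊆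
        {z | ENNReal.ofReal ((a * (σ * √n)) ^ 2) ≤ ENNReal.ofReal (‖∑ i, F (z i)‖ ^ 2)} := by
      intro z hz
      have hz' : a * (σ * √n) < ‖∑ i, F (z i)‖ := hz
      refine ENNReal.ofReal_le_ofReal ?_
      gcongr
    refine (measure_mono hsub).trans ((meas_ge_le_lintegral_div hm.aemeasurable
      (ENNReal.ofReal_pos.2 hpos2).ne' ENNReal.ofReal_ne_top).trans ?_)
    refine (ENNReal.div_le_div_right h _).trans_eq ?_
    rw [← ENNReal.ofReal_div_of_pos hpos2, ← hsq]
    congr 1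
    have := hpos.ne'
    rw [mul_pow a, div_mul_cancel_right₀ (by positivity), one_div]

/-- A Bernstein inequality for sums of independent Hilbert space valued random vectors. -/
theorem measure_pi_norm_sum_gt_le_exp (μ : Measure Z) [IsProbabilityMeasure μ] {F : Z → G}
    (hF : StronglyMeasurable F) {L : ℝ} (hL0 : 0 ≤ L) (hL : ∀ᵐ z ∂μ, ‖F z‖ ≤ L)
    (h0 : ∫ z, F z ∂μ = 0) {σ : ℝ} (hσ : 0 ≤ σ) (hW : ∫ z, ‖F z‖ ^ 2 ∂μ ≤ σ ^ 2) (n : ℕ)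
    {t : ℝ} :
    (Measure.pi fun _ : Fin n => μ) {z | 2 * t * (L + σ * √n) < ‖∑ i, F (z i)‖} ≤
      ENNReal.ofReal (2 * Real.exp (1 - 2 * t)) := by
  have hσn := mul_nonneg hσ (Real.sqrt_nonneg n)
  rcases (add_nonneg hL0 hσn).eq_or_lt with hz | hpos
  · have hz' : σ * √n = 0 := by linarith
    have := measure_pi_norm_sum_pos_eq_zero μ hF hL h0 hW (n := n) (by
      rw [← Real.sq_sqrt (Nat.cast_nonneg n), ← mul_pow, mul_comm, hz']; ring)
    simp only [← hz, mul_zero, this, zero_le]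
  -- At this scale the summands have norm at most 1 and n s² σ² ≤ 1, so the expectation of cosh is
  -- at most e. Markov's inequality with cosh x ≥ exp x / 2 then gives 2 exp(1 − 2t).
  set s := (L + σ * √n)⁻¹ with hs
  have hspos : 0 < s := inv_pos.2 hpos
  have hsL : s * (L + σ * √n) = 1 := inv_mul_cancel₀ hpos.ne'
  have hstep := lintegral_cosh_step μ (F := fun z => s • F z) (hF.const_smul s)
    (by
      filter_upwards [hL] with z hz
      rw [norm_smul, Real.norm_of_nonneg hspos.le]
      nlinarith)
    (by rw [integral_smul, h0, smul_zero]) (W := s ^ 2 * σ ^ 2)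
    (by
      simp only [norm_smul, mul_pow, Real.norm_eq_abs, sq_abs]
      rw [integral_const_mul]
      gcongr)
  have h := lintegral_pi_sum_le μ (hF.const_smul s)
    (fun k v => ENNReal.ofReal (1 + s ^ 2 * σ ^ 2) ^ k * ENNReal.ofReal (Real.cosh ‖v‖))
    (by
      simp only [pow_zero, one_mul]
      exact ENNReal.continuous_ofReal.comp (by fun_prop)) (fun k v => by
      rw [lintegral_const_mul' _ _ (by finiteness), pow_succ (ENNReal.ofReal _) k, mul_assoc]
      exact mul_le_mul_right (hstep v) _) n 0
  simp only [pow_zero, one_mul, zero_add, norm_zero, Real.cosh_zero, ENNReal.ofReal_one, mul_one,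
    Pi.smul_apply, ← Finset.smul_sum, norm_smul, Real.norm_of_nonneg hspos.le] at h
  have hexp : ENNReal.ofReal (1 + s ^ 2 * σ ^ 2) ^ n ≤ ENNReal.ofReal (Real.exp 1) := by
    rw [← ENNReal.ofReal_pow (by positivity)]
    refine ENNReal.ofReal_le_ofReal ?_
    calc (1 + s ^ 2 * σ ^ 2) ^ n ≤ Real.exp (s ^ 2 * σ ^ 2) ^ n := by
          gcongr
          rw [add_comm]
          exact Real.add_one_le_exp _
      _ = Real.exp ((s * (σ * √n)) ^ 2) := by
          rw [← Real.exp_nat_mul, mul_pow, mul_pow, Real.sq_sqrt (Nat.cast_nonneg n)]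
          ring_nf
      _ ≤ Real.exp 1 := by
          refine Real.exp_le_exp.2 (pow_le_one₀ (by positivity) ?_)
          nlinarith
  have hm : Measurable fun z : Fin n → Z => ENNReal.ofReal (Real.cosh (s * ‖∑ i, F (z i)‖)) :=
    (Real.continuous_cosh.measurable.comp
      ((stronglyMeasurable_pi_sum hF n).norm.measurable.const_mul s)).ennreal_ofReal
  have hpos2 : 0 < Real.exp (2 * t) / 2 := by positivity
  have hsub : {z : Fin n → Z | 2 * t * (L + σ * √n) < ‖∑ i, F (z i)‖} ⊆
      {z | ENNReal.ofReal (Real.exp (2 * t) / 2) ≤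
        ENNReal.ofReal (Real.cosh (s * ‖∑ i, F (z i)‖))} := by
    intro z hz
    have hz' : 2 * t * (L + σ * √n) < ‖∑ i, F (z i)‖ := hz
    refine ENNReal.ofReal_le_ofReal ?_
    have h2 : 2 * t ≤ s * ‖∑ i, F (z i)‖ := by
      have := mul_le_mul_of_nonneg_left hz'.le hspos.le
      rwa [mul_left_comm, hsL, mul_one] at this
    rw [Real.cosh_eq]
    have := Real.exp_le_exp.2 h2
    have := Real.exp_pos (-(s * ‖∑ i, F (z i)‖))
    linarith
  refine (measure_mono hsub).trans ((meas_ge_le_lintegral_div hm.aemeasurable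
    (ENNReal.ofReal_pos.2 hpos2).ne' ENNReal.ofReal_ne_top).trans ?_)
  refine (ENNReal.div_le_div_right (h.trans hexp) _).trans_eq ?_
  rw [← ENNReal.ofReal_div_of_pos hpos2, Real.exp_sub]
  congr 1
  field_simp

/-- Deviation of an average of independent, identically distributed, bounded Hilbert space valued
random vectors from the mean. -/
theorem measure_pi_norm_average_sub_gt_le (μ : Measure Z) [IsProbabilityMeasure μ] {F : Z → G}
    (hF : StronglyMeasurable F) {L : ℝ} (hL0 : 0 ≤ L) (hL : ∀ᵐ z ∂μ, ‖F z‖ ≤ L) {σ : ℝ}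
    (hσ : 0 ≤ σ) (hW : ∫ z, ‖F z‖ ^ 2 ∂μ ≤ σ ^ 2) {n : ℕ} (hn : 1 ≤ n) {a t : ℝ} (ha : 2 ≤ a)
    (ht : 0 < t) :
    (Measure.pi fun _ : Fin n => μ)
        {z | a * (2 * L / n + σ / √n) * t < ‖(1 / n : ℝ) • ∑ i, F (z i) - ∫ z, F z ∂μ‖} ≤
      ENNReal.ofReal (min (2 * Real.exp (1 - 2 * t)) (1 / (a * t) ^ 2)) := by
  have hn0 : (0 : ℝ) < n := by exact_mod_cast hn
  have hi1 := integrable_of_norm_le hF hL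
  have hi2 := integrable_norm_sq_of_norm_le hF hL
  set m := ∫ z, F z ∂μ with hm
  have hmL : ‖m‖ ≤ L := by
    have := norm_integral_le_of_norm_le_const hL
    simpa using this
  have hF' : StronglyMeasurable fun z => F z - m := hF.sub stronglyMeasurable_const
  -- Centring may double the uniform bound but does not increase the second moment.
  have hL' : ∀ᵐ z ∂μ, ‖F z - m‖ ≤ 2 * L := by
    filter_upwards [hL] with z hz
    have := norm_sub_le (F z) m
    linarith
  have h0 : ∫ z, (F z - m) ∂μ = 0 := by
    rw [integral_sub hi1 (integrable_const _), integral_const, probReal_univ, one_smul, hm,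
      sub_self]
  have hW' : ∫ z, ‖F z - m‖ ^ 2 ∂μ ≤ σ ^ 2 := by
    simp only [norm_sub_sq_real]
    have hint : Integrable (fun z => 2 * ⟪F z, m⟫_ℝ) μ := (hi1.inner_const m).const_mul _
    have hsub : Integrable (fun z => ‖F z‖ ^ 2 - 2 * ⟪F z, m⟫_ℝ) μ := hi2.sub hint
    have h3 : ∫ z, ⟪F z, m⟫_ℝ ∂μ = ‖m‖ ^ 2 := by
      simp only [real_inner_comm m]
      rw [integral_inner hi1, ← hm, real_inner_self_eq_norm_sq]
    rw [integral_add hsub (integrable_const _), integral_sub hi2 hint,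
      integral_const_mul, h3, integral_const, probReal_univ, one_smul]
    nlinarith [sq_nonneg ‖m‖]
  have heq : ∀ z : Fin n → Z, ‖(1 / n : ℝ) • ∑ i, F (z i) - m‖ =
      (1 / n : ℝ) * ‖∑ i, (F (z i) - m)‖ := fun z => by
    rw [← Real.norm_of_nonneg (show (0 : ℝ) ≤ 1 / n by positivity), ← norm_smul,
      Finset.sum_sub_distrib, smul_sub]
    simp [← Nat.cast_smul_eq_nsmul ℝ, smul_smul, hn0.ne']
  have hsub : ∀ c : ℝ, c ≤ n * (a * (2 * L / n + σ / √n) * t) →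
      {z : Fin n → Z | a * (2 * L / n + σ / √n) * t < ‖(1 / n : ℝ) • ∑ i, F (z i) - m‖} ⊆
        {z | c < ‖∑ i, (F (z i) - m)‖} := fun c hc z hz => by
    have hz' : a * (2 * L / n + σ / √n) * t < ‖(1 / n : ℝ) • ∑ i, F (z i) - m‖ := hz
    rw [heq, one_div, ← div_eq_inv_mul, lt_div_iff₀ hn0, mul_comm] at hz'
    exact hc.trans_lt hz'
  have hr : n * (a * (2 * L / n + σ / √n) * t) = a * t * (2 * L + σ * √n) := by
    have hs : √(n : ℝ) ≠ 0 := by positivity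
    have hss : (n : ℝ) = √n * √n := (Real.mul_self_sqrt hn0.le).symm
    have : (n : ℝ) * (σ / √n) = σ * √n := by
      nth_rewrite 1 [hss]
      field_simp
    calc _ = a * t * (n * (2 * L / n) + n * (σ / √n)) := by ring
      _ = _ := by rw [this, mul_div_cancel₀ _ hn0.ne']
  have hσn : 0 ≤ σ * √n := by positivity
  -- The Bernstein bound uses only a ≥ 2; the Chebyshev bound keeps a but drops the term 2L.
  rw [ENNReal.ofReal_min, le_min_iff]
  constructor
  · refine (measure_mono (hsub (2 * t * (2 * L + σ * √n)) ?_)).trans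
      (measure_pi_norm_sum_gt_le_exp μ hF' (by linarith) hL' h0 hσ hW' n)
    rw [hr]
    gcongr
  · refine (measure_mono (hsub (a * t * (σ * √n)) ?_)).trans
      (measure_pi_norm_sum_gt_le μ hF' hL' h0 hσ hW' n (by positivity))
    rw [hr]
    gcongr
    linarith

/-- The two deviation probabilities of `measure_pi_norm_average_sub_gt_le` with `a = 2` and
`a = 5 / 2` add up to at most `δ`. -/
theorem deviation_prob_add_le {δ : ℝ} (hδ0 : 0 < δ) (hδ1 : δ < 1) :
    min (2 * Real.exp (1 - 2 * Real.log (2 / δ))) (1 / (2 * Real.log (2 / δ)) ^ 2) +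
      min (2 * Real.exp (1 - 2 * Real.log (2 / δ))) (1 / (5 / 2 * Real.log (2 / δ)) ^ 2) ≤ δ := by
  have hδ : δ = 2 * Real.exp (-Real.log (2 / δ)) := by
    rw [Real.exp_neg, Real.exp_log (by positivity)]
    field_simp
  set t := Real.log (2 / δ) with ht
  have ht2 : Real.log 2 ≤ t := Real.log_le_log (by norm_num) (by rw [le_div_iff₀ hδ0]; linarith)
  have hl := Real.log_two_gt_d9
  rw [hδ]
  -- Here δ = 2 exp(−t). For t ≥ log 2 + 1 each exponential bound is at most exp(−t) = δ/2. Below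
  -- that threshold Chebyshev is used: 1/2² + 1/(5/2)² = 41/100, and 41/(100 t²) ≤ 2 exp(−t) on the
  -- remaining range log 2 ≤ t ≤ log 2 + 1.
  rcases le_total t (Real.log 2 + 1) with h | h
  · obtain ⟨u, hu⟩ : ∃ u, u = t - Real.log 2 := ⟨_, rfl⟩
    have htu : t = Real.log 2 + u := by linarith
    have hu0 : 0 ≤ u := by linarith
    have hu1 : u ≤ 1 := by linarith
    have hexp : Real.exp u ≤ 1 + u + u ^ 2 := by
      have := (le_abs_self _).trans (Real.abs_exp_sub_one_sub_id_le (x := u) (by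
        rwa [abs_of_nonneg hu0]))
      linarith
    have het : Real.exp t = 2 * Real.exp u := by
      rw [htu, Real.exp_add, Real.exp_log (by norm_num)]
    have hsq : (0.693 + u) ^ 2 ≤ t ^ 2 := by
      rw [htu]
      gcongr
      linarith
    have hmain : 41 / 100 * Real.exp t ≤ 2 * t ^ 2 := by
      rw [het]
      nlinarith
    have htpos : 0 < t := by linarith
    calc _ ≤ 1 / (2 * t) ^ 2 + 1 / (5 / 2 * t) ^ 2 := add_le_add (min_le_right _ _) (min_le_right _ _)
      _ = 41 / 100 / t ^ 2 := by field_simp; norm_num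
      _ ≤ 2 / Real.exp t := by
        rw [div_le_div_iff₀ (by positivity) (Real.exp_pos t)]
        exact hmain
      _ = _ := by rw [Real.exp_neg]; rfl
  · have h4 : 2 * Real.exp (1 - 2 * t) ≤ Real.exp (-t) := by
      have : (2 : ℝ) = Real.exp (Real.log 2) := (Real.exp_log (by norm_num)).symm
      nth_rewrite 1 [this]
      rw [← Real.exp_add]
      exact Real.exp_le_exp.2 (by linarith)
    refine (add_le_add (min_le_left _ _) (min_le_left _ _)).trans ?_
    linarith

end Concentration

/-! ### The feature map, covariance operators and the effective dimension -/

section Covariance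

variable {ι X H Y : Type*} [MeasurableSpace X] [NormedAddCommGroup H] [InnerProductSpace ℝ H]
  [CompleteSpace H] [TopologicalSpace.SeparableSpace H] [RKHS ℝ H X ℝ]
  [NormedAddCommGroup Y] [InnerProductSpace ℝ Y] [CompleteSpace Y]

theorem norm_featureMap_le {κ : ℝ} (hκ : 0 ≤ κ) (hk : ∀ x : X, scalarKernel H x x ≤ κ ^ 2) (x : X) :
    ‖featureMap H x‖ ≤ κ := by
  refine (sq_le_sq₀ (norm_nonneg _) hκ).1 ?_
  rw [← real_inner_self_eq_norm_sq, inner_featureMap, featureMap_apply]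
  exact hk x

/-- Kernel sections span a dense subspace, and convergence in H implies pointwise convergence
because evaluations are continuous. -/
theorem measurable_rkhs (hk_meas : ∀ t : X, Measurable fun x => scalarKernel H x t) (f : H) :
    Measurable fun x => f x := by
  have hf : f ∈ closure (Submodule.span ℝ {RKHS.kerFun H x v | (x : X) (v : ℝ)} : Set H) := by
    rw [← Submodule.topologicalClosure_coe, RKHS.kerFun_dense]
    trivial
  obtain ⟨u, hu, hlim⟩ := mem_closure_iff_seq_limit.1 hf
  refine measurable_of_tendsto_metrizable (f := fun n x => u n x) (fun n => ?_)
    (tendsto_pi_nhds.2 fun x => ((RKHS.continuous_eval x).tendsto f).comp hlim)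
  refine Submodule.span_induction (p := fun g _ => Measurable fun x => g x) ?_ ?_ ?_ ?_ (hu n)
  · rintro _ ⟨t, v, rfl⟩
    have h : ∀ x, RKHS.kerFun H t v x = v * scalarKernel H x t := fun x => by
      rw [RKHS.kerFun_apply, scalarKernel, ← smul_eq_mul, ← map_smul, smul_eq_mul, mul_one]
    simp only [h]
    exact (hk_meas t).const_mul v
  · simp only [RKHS.coe_zero]
    exact measurable_const
  · intro g h _ _ hg hh
    simp only [RKHS.coe_add]
    exact hg.add hh
  · intro c g _ hg
    simp only [RKHS.coe_smul]
    exact hg.const_smul c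

/-- The coefficients of φ(x) in a Hilbert basis are values at x of elements of H, hence measurable
in x; the basis is countable, so the limit of the partial sums is strongly measurable. -/
theorem stronglyMeasurable_featureMap (hk_meas : ∀ t : X, Measurable fun x => scalarKernel H x t) :
    StronglyMeasurable (featureMap H : X → H) := by
  have := hilbertBasis_countable (someBasis H)
  refine stronglyMeasurable_of_tendsto (f := fun (s : Finset (basisIndex H)) x =>
    ∑ i ∈ s, (someBasis H).repr (featureMap H x) i • someBasis H i) Filter.atTop (fun s => ?_)
    (tendsto_pi_nhds.2 fun x => (someBasis H).hasSum_repr (featureMap H x))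
  refine Finset.stronglyMeasurable_fun_sum _ fun i _ => ?_
  simp only [HilbertBasis.repr_apply_apply, real_inner_comm (featureMap H _), inner_featureMap]
  exact (measurable_rkhs hk_meas _).stronglyMeasurable.smul_const _

/-! ### The covariance operators -/

variable {qX : Measure X} [IsProbabilityMeasure qX] {κ : ℝ}

theorem integrable_rankOne_featureMap (hκ : 0 ≤ κ)
    (hk_meas : ∀ t : X, Measurable fun x => scalarKernel H x t)
    (hk : ∀ x : X, scalarKernel H x x ≤ κ ^ 2) :
    Integrable (fun x => rankOne ℝ (featureMap H x) (featureMap H x)) qX := by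
  have hm := stronglyMeasurable_featureMap hk_meas
  refine Integrable.of_bound (C := κ * κ) ?_ (.of_forall fun x => ?_)
  · refine StronglyMeasurable.aestronglyMeasurable ?_
    have hc : Continuous fun v : H => (rankOne ℝ v v : H →L[ℝ] H) :=
      (rankOne ℝ (E := H) (F := H)).continuous.clm_apply continuous_id
    exact hc.comp_stronglyMeasurable hm
  · rw [norm_rankOne]
    have := norm_featureMap_le hκ hk x
    gcongr

theorem covOp_apply (hκ : 0 ≤ κ)
    (hk_meas : ∀ t : X, Measurable fun x => scalarKernel H x t)
    (hk : ∀ x : X, scalarKernel H x x ≤ κ ^ 2) (h : H) :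
    covOp H qX h = ∫ x, ⟪featureMap H x, h⟫_ℝ • featureMap H x ∂qX := by
  rw [covOp, ContinuousLinearMap.integral_apply (integrable_rankOne_featureMap hκ hk_meas hk)]
  simp

theorem integrable_inner_smul_featureMap (hκ : 0 ≤ κ)
    (hk_meas : ∀ t : X, Measurable fun x => scalarKernel H x t)
    (hk : ∀ x : X, scalarKernel H x x ≤ κ ^ 2) (h : H) :
    Integrable (fun x => ⟪featureMap H x, h⟫_ℝ • featureMap H x) qX := by
  simpa using (integrable_rankOne_featureMap (qX := qX) hκ hk_meas hk).apply_continuousLinearMap h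

theorem inner_covOp (hκ : 0 ≤ κ)
    (hk_meas : ∀ t : X, Measurable fun x => scalarKernel H x t)
    (hk : ∀ x : X, scalarKernel H x x ≤ κ ^ 2) (u v : H) :
    ⟪u, covOp H qX v⟫_ℝ = ∫ x, ⟪featureMap H x, u⟫_ℝ * ⟪featureMap H x, v⟫_ℝ ∂qX := by
  rw [covOp_apply hκ hk_meas hk,
    ← integral_inner (integrable_inner_smul_featureMap hκ hk_meas hk v)]
  refine integral_congr_ae (.of_forall fun x => ?_)
  simp only [real_inner_smul_right, real_inner_comm u]
  ring

theorem covOp_isSymmetric (hκ : 0 ≤ κ)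
    (hk_meas : ∀ t : X, Measurable fun x => scalarKernel H x t)
    (hk : ∀ x : X, scalarKernel H x x ≤ κ ^ 2) : (covOp H qX).IsSymmetric := by
  intro u v
  change ⟪covOp H qX u, v⟫_ℝ = ⟪u, covOp H qX v⟫_ℝ
  rw [real_inner_comm, inner_covOp hκ hk_meas hk, inner_covOp hκ hk_meas hk]
  simp only [mul_comm]

theorem isCompactOperator_rankOne (u v : H) : IsCompactOperator (rankOne ℝ u v : H →L[ℝ] H) := by
  rw [rankOne_def']
  exact (isCompactOperator_of_locallyCompactSpace_rng
    (ContinuousLinearMap.toSpanSingleton ℝ u)).comp_clm _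

/-- A Bochner integral of rank one operators stays in the closed convex set of compact operators. -/
theorem isCompactOperator_covOp (hκ : 0 ≤ κ)
    (hk_meas : ∀ t : X, Measurable fun x => scalarKernel H x t)
    (hk : ∀ x : X, scalarKernel H x x ≤ κ ^ 2) : IsCompactOperator (covOp H qX) := by
  have hconv : Convex ℝ (compactOperator (RingHom.id ℝ) H H : Set (H →L[ℝ] H)) :=
    (compactOperator (RingHom.id ℝ) H H).convex
  exact hconv.integral_mem isClosed_setOfPred_isCompactOperator
    (.of_forall fun x => isCompactOperator_rankOne _ _)
    (integrable_rankOne_featureMap hκ hk_meas hk)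

theorem inner_covOp_self_mem (hκ : 0 ≤ κ)
    (hk_meas : ∀ t : X, Measurable fun x => scalarKernel H x t)
    (hk : ∀ x : X, scalarKernel H x x ≤ κ ^ 2) (u : H) :
    ⟪u, covOp H qX u⟫_ℝ ∈ Set.Icc 0 (κ ^ 2 * ‖u‖ ^ 2) := by
  rw [inner_covOp hκ hk_meas hk]
  refine ⟨integral_nonneg fun x => mul_self_nonneg _, ?_⟩
  have h : ∀ x, ‖⟪featureMap H x, u⟫_ℝ * ⟪featureMap H x, u⟫_ℝ‖ ≤ κ ^ 2 * ‖u‖ ^ 2 := fun x => by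
    have h1 := (norm_inner_le_norm (𝕜 := ℝ) (featureMap H x) u).trans
      (mul_le_mul_of_nonneg_right (norm_featureMap_le hκ hk x) (norm_nonneg u))
    rw [norm_mul, ← sq, ← mul_pow]
    gcongr
  refine (le_abs_self _).trans ?_
  have := norm_integral_le_of_norm_le_const (μ := qX) (.of_forall h)
  simpa using this

theorem IsDiag.eigenvalue_eq {e : HilbertBasis ι ℝ H} {a : ι → ℝ} {A : H →L[ℝ] H}
    (hA : IsDiag e a A) (i : ι) : a i = ⟪e i, A (e i)⟫_ℝ := by
  rw [hA i, real_inner_smul_right, real_inner_self_eq_norm_sq, e.orthonormal.1 i]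
  ring

variable {n : ℕ} {β : X → ℝ} {b : ℝ}

theorem empCovOp_apply (z : Fin n → X × Y) (h : H) :
    empCovOp H β z h =
      (1 / n : ℝ) • ∑ i, (β (z i).1 * ⟪featureMap H (z i).1, h⟫_ℝ) • featureMap H (z i).1 := by
  simp [empCovOp, smul_smul]

theorem empCrossCovOp_apply (z : Fin n → X × Y) (h : H) :
    empCrossCovOp H β z h =
      (1 / n : ℝ) • ∑ i, (β (z i).1 * ⟪featureMap H (z i).1, h⟫_ℝ) • (z i).2 := by
  simp [empCrossCovOp, smul_smul]

theorem inner_empCovOp (z : Fin n → X × Y) (u v : H) :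
    ⟪u, empCovOp H β z v⟫_ℝ = (1 / n : ℝ) * ∑ i, β (z i).1 *
      (⟪featureMap H (z i).1, u⟫_ℝ * ⟪featureMap H (z i).1, v⟫_ℝ) := by
  rw [empCovOp_apply, real_inner_smul_right, inner_sum]
  congr 1
  refine Finset.sum_congr rfl fun i _ => ?_
  rw [real_inner_smul_right, real_inner_comm u]
  ring

theorem empCovOp_isSymmetric (z : Fin n → X × Y) : (empCovOp H β z).IsSymmetric := by
  intro u v
  change ⟪empCovOp H β z u, v⟫_ℝ = ⟪u, empCovOp H β z v⟫_ℝ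
  rw [real_inner_comm, inner_empCovOp, inner_empCovOp]
  congr 1
  refine Finset.sum_congr rfl fun i _ => ?_
  ring

theorem isCompactOperator_empCovOp (z : Fin n → X × Y) : IsCompactOperator (empCovOp H β z) := by
  have : empCovOp H β z ∈ compactOperator (RingHom.id ℝ) H H :=
    Submodule.smul_mem _ _ (Submodule.sum_mem _ fun i _ =>
      Submodule.smul_mem _ _ (isCompactOperator_rankOne _ _))
  exact this

theorem inner_empCovOp_self_mem (hn : 1 ≤ n) (hκ : 0 ≤ κ)
    (hk : ∀ x : X, scalarKernel H x x ≤ κ ^ 2) (hβ_nonneg : ∀ x, 0 ≤ β x) (hβ_le : ∀ x, β x ≤ b)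
    (z : Fin n → X × Y) (u : H) :
    ⟪u, empCovOp H β z u⟫_ℝ ∈ Set.Icc 0 (b * κ ^ 2 * ‖u‖ ^ 2) := by
  have hn0 : (0 : ℝ) < n := by exact_mod_cast hn
  rw [inner_empCovOp]
  constructor
  · exact mul_nonneg (by positivity) (Finset.sum_nonneg fun i _ =>
      mul_nonneg (hβ_nonneg _) (mul_self_nonneg _))
  · have h : ∀ i ∈ Finset.univ, β (z i).1 *
        (⟪featureMap H (z i).1, u⟫_ℝ * ⟪featureMap H (z i).1, u⟫_ℝ) ≤ b * κ ^ 2 * ‖u‖ ^ 2 := by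
      intro i _
      have h1 := (norm_inner_le_norm (𝕜 := ℝ) (featureMap H (z i).1) u).trans
        (mul_le_mul_of_nonneg_right (norm_featureMap_le hκ hk (z i).1) (norm_nonneg u))
      have h2 : ⟪featureMap H (z i).1, u⟫_ℝ * ⟪featureMap H (z i).1, u⟫_ℝ ≤ κ ^ 2 * ‖u‖ ^ 2 := by
        rw [← sq, ← sq_abs, ← mul_pow, ← Real.norm_eq_abs]
        gcongr
      rw [mul_assoc]
      exact mul_le_mul (hβ_le _) h2 (mul_self_nonneg _) ((hβ_nonneg _).trans (hβ_le (z i).1))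
    have h2 := Finset.sum_le_card_nsmul _ _ _ h
    rw [Finset.card_univ, Fintype.card_fin, nsmul_eq_mul] at h2
    rw [one_div, ← div_eq_inv_mul, div_le_iff₀ hn0]
    linarith

/-- On the kernel of the empirical covariance operator, all terms of the empirical operators
vanish. -/
theorem mul_inner_featureMap_eq_zero (hn : 1 ≤ n) (hβ_nonneg : ∀ x, 0 ≤ β x) (z : Fin n → X × Y)
    {u : H} (hu : empCovOp H β z u = 0) (i : Fin n) :
    β (z i).1 * ⟪featureMap H (z i).1, u⟫_ℝ = 0 := by
  have hn0 : (0 : ℝ) < n := by exact_mod_cast hn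
  have h := inner_empCovOp (β := β) z u u
  rw [hu, inner_zero_right, eq_comm, mul_eq_zero,
    or_iff_right (show (1 / n : ℝ) ≠ 0 by positivity),
    Finset.sum_eq_zero_iff_of_nonneg fun i _ => mul_nonneg (hβ_nonneg _) (mul_self_nonneg _)] at h
  have := h i (Finset.mem_univ i)
  rcases mul_eq_zero.1 this with h1 | h1
  · rw [h1, zero_mul]
  · rw [mul_self_eq_zero.1 h1, mul_zero]

/-! ### The norm of `L₂(q_X, Y)` and the effective dimension -/

theorem lintegral_inner_featureMap_sq (hκ : 0 ≤ κ)
    (hk_meas : ∀ t : X, Measurable fun x => scalarKernel H x t)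
    (hk : ∀ x : X, scalarKernel H x x ≤ κ ^ 2) (u : H) :
    ∫⁻ x, ‖⟪featureMap H x, u⟫_ℝ‖ₑ ^ 2 ∂qX = ENNReal.ofReal ⟪u, covOp H qX u⟫_ℝ := by
  have hint : Integrable (fun x => ⟪featureMap H x, u⟫_ℝ * ⟪featureMap H x, u⟫_ℝ) qX := by
    have := Integrable.inner_const (𝕜 := ℝ)
      (integrable_inner_smul_featureMap (qX := qX) hκ hk_meas hk u) u
    simpa only [real_inner_smul_left] using this
  rw [inner_covOp hκ hk_meas hk,
    ofReal_integral_eq_lintegral_ofReal hint (.of_forall fun x => mul_self_nonneg _)]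
  refine lintegral_congr fun x => ?_
  rw [← sq, ← sq_abs, ENNReal.ofReal_pow (abs_nonneg _), ← Real.norm_eq_abs, ofReal_norm]

/-- By Parseval in Y, the integral is the sum over a basis (f_j) of ⟨u_j, C_X u_j⟩ = ‖R u_j‖² with
u_j = A* f_j, which is the squared Hilbert–Schmidt norm of (A R)*. -/
theorem lintegral_enorm_apply_featureMap_sq [TopologicalSpace.SeparableSpace Y] (hκ : 0 ≤ κ)
    (hk_meas : ∀ t : X, Measurable fun x => scalarKernel H x t)
    (hk : ∀ x : X, scalarKernel H x x ≤ κ ^ 2) {e : HilbertBasis ι ℝ H} {r : ι → ℝ}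
    {R : H →L[ℝ] H} (hR : IsDiag e r R) (hRR : R ∘L R = covOp H qX) (A : H →L[ℝ] Y) :
    ∫⁻ x, ‖A (featureMap H x)‖ₑ ^ 2 ∂qX = hsNormSq (A ∘L R) := by
  have := hilbertBasis_countable (someBasis Y)
  have hm := stronglyMeasurable_featureMap hk_meas
  rw [hsNormSq, tsum_enorm_sq_eq_adjoint _ (someBasis Y)]
  simp only [← tsum_enorm_inner_sq (someBasis Y) (A _), ← ContinuousLinearMap.adjoint_inner_right]
  rw [lintegral_tsum fun j => (((hm.inner (𝕜 := ℝ)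
    (stronglyMeasurable_const (b := A.adjoint (someBasis Y j)))).enorm).pow_const 2).aemeasurable]
  refine tsum_congr fun j => ?_
  rw [lintegral_inner_featureMap_sq hκ hk_meas hk, ContinuousLinearMap.adjoint_comp,
    hR.adjoint_eq, ← hRR]
  set u := A.adjoint (someBasis Y j)
  change ENNReal.ofReal ⟪u, R (R u)⟫_ℝ = ‖R u‖ₑ ^ 2
  rw [← hR.isSymmetric, real_inner_self_eq_norm_sq, ENNReal.ofReal_pow (norm_nonneg _),
    ofReal_norm]

/-- The condition on s says S² = (C_X + λ)⁻¹. Both sides equal the squared Hilbert–Schmidt norm of S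
R, since C_X S² = (S R)². This is how N(λ) becomes a variance. -/
theorem integral_norm_sq_eq_effDim (hκ : 0 ≤ κ)
    (hk_meas : ∀ t : X, Measurable fun x => scalarKernel H x t)
    (hk : ∀ x : X, scalarKernel H x x ≤ κ ^ 2) {e : HilbertBasis ι ℝ H} {a r s : ι → ℝ}
    {R S : H →L[ℝ] H} (hA : IsDiag e a (covOp H qX)) (hR : IsDiag e r R)
    (hRR : R ∘L R = covOp H qX) {lam : ℝ} (hS : IsDiag e s S)
    (hs : ∀ i, (a i + lam) * (s i * s i) = 1) :
    ∫ x, ‖S (featureMap H x)‖ ^ 2 ∂qX = effDim (covOp H qX) lam := by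
  have hm := stronglyMeasurable_featureMap hk_meas
  have hU : IsDiag e (fun i => a i + lam) (covOp H qX + lam • ContinuousLinearMap.id ℝ H) := by
    simpa using hA.add (IsDiag.id.smul lam)
  have h1 : (covOp H qX + lam • ContinuousLinearMap.id ℝ H) * (S ∘L S) = 1 :=
    (hU.comp (hS.comp hS)).unique fun i => by simp [hs i]
  have h2 : (S ∘L S) * (covOp H qX + lam • ContinuousLinearMap.id ℝ H) = 1 :=
    ((hS.comp hS).comp hU).unique fun i => by
      have := hs i
      rw [mul_comm] at this
      simp [this]
  have hinv : Ring.inverse (covOp H qX + lam • ContinuousLinearMap.id ℝ H) = S ∘L S :=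
    Ring.inverse_unit ⟨_, _, h1, h2⟩
  have hSR : S ∘L R = R ∘L S := (hS.comp hR).unique fun i => by
    rw [(hR.comp hS) i]; simp only [mul_comm]
  have hop : covOp H qX ∘L (S ∘L S) = (S ∘L R) ∘L (S ∘L R) := by
    rw [← hRR]
    refine ((hR.comp hR).comp (hS.comp hS)).unique fun i => ?_
    rw [((hS.comp hR).comp (hS.comp hR)) i]
    congr 1; ring
  have hnn : ∀ i, ⟪((S ∘L R) ∘L (S ∘L R)) (someBasis H i), someBasis H i⟫_ℝ =
      ‖(S ∘L R) (someBasis H i)‖ ^ 2 := fun i => by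
    rw [ContinuousLinearMap.comp_apply, (hS.comp hR).isSymmetric, real_inner_self_eq_norm_sq]
  rw [integral_eq_lintegral_of_nonneg_ae (.of_forall fun x => sq_nonneg _)
    ((S.continuous.comp_stronglyMeasurable hm).norm.pow 2).aestronglyMeasurable, effDim, hinv, hop,
    opTrace]
  have hl := lintegral_enorm_apply_featureMap_sq (qX := qX) hκ hk_meas hk hR hRR S
  simp only [ENNReal.ofReal_pow (norm_nonneg _), ofReal_norm, hnn]
  rw [hl, hsNormSq, ENNReal.tsum_toReal_eq fun i => by finiteness]
  simp

end Covariance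

/-! ### Scalar inequalities for index functions and filters -/

section Scalar

variable {g : ℝ → ℝ → ℝ} {φ : ℝ → ℝ} {s D B γ ν γν c lam σ : ℝ}

theorem IsIndexFunction.pos (hφ : IsIndexFunction φ) {t : ℝ} (ht : 0 < t) : 0 < φ t := by
  rw [← hφ.map_zero]
  exact hφ.strictMonoOn (Set.mem_Ici.2 le_rfl) (Set.mem_Ici.2 ht.le) ht

theorem IsIndexFunction.mono (hφ : IsIndexFunction φ) {t u : ℝ} (ht : 0 ≤ t) (htu : t ≤ u) :
    φ t ≤ φ u :=
  hφ.strictMonoOn.monotoneOn ht (ht.trans htu) htu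

theorem IsIndexFunction.nonneg (hφ : IsIndexFunction φ) {t : ℝ} (ht : 0 ≤ t) : 0 ≤ φ t := by
  rw [← hφ.map_zero]
  exact hφ.mono le_rfl ht

open Filter Topology in
/-- The covering condition forces `ν > 1 / 2`. -/
theorem Covers.half_lt (hφ : IsIndexFunction φ) (hs : 0 < s)
    (hcov : Covers ν s (fun t => φ t * √t) c) : 1 / 2 < ν := by
  by_contra! hν
  -- If ν ≤ 1/2, then t^ν / ψ(t) ≥ 1 / φ(t) for t ≤ 1. This is unbounded as t → 0, whereas covering
  -- with σ = s bounds it by a constant.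
  have hQ : 0 < s ^ ν / (φ s * √s) := by
    have := hφ.pos hs
    positivity
  set Q := s ^ ν / (φ s * √s)
  have hlim : Tendsto φ (𝓝[>] 0) (𝓝 0) := by
    have := hφ.continuousOn 0 (Set.mem_Ici.2 le_rfl)
    rw [ContinuousWithinAt, hφ.map_zero] at this
    exact this.mono_left (nhdsWithin_mono _ Set.Ioi_subset_Ici_self)
  have hev := (hlim.eventually_lt_const (div_pos hcov.1 hQ)).and
    (Ioc_mem_nhdsGT (lt_min hs one_pos))
  obtain ⟨t, ht, ht0, ht1⟩ := hev.exists
  have hts := ht1.trans (min_le_left _ _)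
  have h := hcov.2 t ⟨ht0, hts⟩ s ⟨hts, le_rfl⟩
  have hφt := hφ.pos ht0
  have hpow : √t ≤ t ^ ν := by
    rw [Real.sqrt_eq_rpow]
    exact Real.rpow_le_rpow_of_exponent_ge ht0 (ht1.trans (min_le_right _ _)) hν
  have h2 : c * (1 / φ t) ≤ Q := by
    refine le_trans ?_ h
    have hc := hcov.1
    refine mul_le_mul_of_nonneg_left ?_ hc.le
    rw [div_le_div_iff₀ hφt (by positivity)]
    have := mul_le_mul_of_nonneg_left hpow hφt.le
    linarith
  rw [lt_div_iff₀ hQ] at ht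
  rw [mul_one_div, div_le_iff₀ hφt] at h2
  linarith

/-- As σ → 0 the product σ g_λ(σ) tends to 0, since |g_λ| ≤ B/λ, so the residual tends to 1. This
extends the bound γ to the eigenvalue 0, where none is assumed. -/
theorem IsRegularizationFamily.one_le (hg : IsRegularizationFamily g s D B γ) (hs : 0 < s) :
    1 ≤ γ := by
  by_contra! hγ
  have hB := hg.B_pos
  set σ := min s ((1 - γ) * s / (2 * B)) with hσ
  have hσ0 : 0 < σ := lt_min hs (by have : 0 < 1 - γ := by linarith
                                    positivity)
  have h1 := hg.abs_le s ⟨hs, le_rfl⟩ σ ⟨hσ0, min_le_left _ _⟩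
  have h2 := hg.abs_residual_le s ⟨hs, le_rfl⟩ σ ⟨hσ0, min_le_left _ _⟩
  have h3 : σ * g s σ ≤ (1 - γ) / 2 := by
    calc σ * g s σ ≤ σ * (B / s) := by
          gcongr
          exact (le_abs_self _).trans h1
      _ ≤ (1 - γ) * s / (2 * B) * (B / s) := by
          gcongr
          exact min_le_right _ _
      _ = (1 - γ) / 2 := by field_simp
  have := (le_abs_self _).trans h2
  linarith

theorem HasQualification.const_nonneg (hν : HasQualification g s ν γν) (hs : 0 < s) : 0 ≤ γν := by
  have h := hν.residual_le s ⟨hs, le_rfl⟩ s ⟨hs, le_rfl⟩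
  have h2 : 0 ≤ γν * s ^ ν := le_trans (by positivity) h
  exact nonneg_of_mul_nonneg_left h2 (by positivity)

/-- For p = ν: if σ ≤ λ then σ + λ ≤ 2λ and the bound γ suffices; otherwise σ + λ ≤ 2σ and the
qualification applies. For smaller p, multiply by (σ + λ)^{p−ν} ≤ λ^{p−ν}. -/
theorem abs_residual_mul_rpow_le (hg : IsRegularizationFamily g s D B γ)
    (hν : HasQualification g s ν γν) (hlam : lam ∈ Set.Ioc 0 s) (hσ : σ ∈ Set.Icc 0 s) {p : ℝ}
    (hp : p ≤ ν) :
    |1 - σ * g lam σ| * (σ + lam) ^ p ≤ 2 ^ ν * (γν + γ) * lam ^ p := by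
  have hs : 0 < s := hlam.1.trans_le hlam.2
  have hγ := hg.one_le hs
  have hγν := hν.const_nonneg hs
  have hl := hlam.1
  have hσ0 := hσ.1
  have hres : |1 - σ * g lam σ| ≤ γ := by
    rcases hσ0.eq_or_lt with h | h
    · rw [← h]; simpa using hγ
    · exact hg.abs_residual_le lam hlam σ ⟨h, hσ.2⟩
  have hν0 := hν.pos
  have key : |1 - σ * g lam σ| * (σ + lam) ^ ν ≤ 2 ^ ν * (γν + γ) * lam ^ ν := by
    rcases le_total σ lam with h | h
    · calc |1 - σ * g lam σ| * (σ + lam) ^ ν ≤ γ * (2 * lam) ^ ν := by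
            gcongr
            linarith
        _ = 2 ^ ν * γ * lam ^ ν := by rw [Real.mul_rpow (by norm_num) hl.le]; ring
        _ ≤ _ := by gcongr; linarith
    · have hq := hν.residual_le lam hlam σ ⟨hl.trans_le h, hσ.2⟩
      calc |1 - σ * g lam σ| * (σ + lam) ^ ν ≤ |1 - σ * g lam σ| * (2 * σ) ^ ν := by
            gcongr
            linarith
        _ = 2 ^ ν * (|1 - σ * g lam σ| * σ ^ ν) := by
            rw [Real.mul_rpow (by norm_num) hσ0]; ring
        _ ≤ 2 ^ ν * (γν * lam ^ ν) := by gcongr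
        _ ≤ 2 ^ ν * ((γν + γ) * lam ^ ν) := by gcongr; linarith
        _ = _ := by ring
  have hsum : 0 < σ + lam := by linarith
  have h2 : (σ + lam) ^ (p - ν) ≤ lam ^ (p - ν) :=
    Real.rpow_le_rpow_of_nonpos hl (by linarith) (by linarith)
  calc |1 - σ * g lam σ| * (σ + lam) ^ p
      = |1 - σ * g lam σ| * (σ + lam) ^ ν * (σ + lam) ^ (p - ν) := by
        rw [mul_assoc, ← Real.rpow_add hsum]; congr 2; ring
    _ ≤ 2 ^ ν * (γν + γ) * lam ^ ν * lam ^ (p - ν) := by gcongr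
    _ = _ := by rw [mul_assoc, ← Real.rpow_add hl]; congr 2; ring

/-- Monotonicity of φ handles σ ≤ λ. For σ ≥ λ, cancelling the square roots in the covering
condition shows that ν − 1/2 covers φ. -/
theorem IsIndexFunction.le_mul_rpow (hφ : IsIndexFunction φ)
    (hcov : Covers ν s (fun t => φ t * √t) c) (hlam : lam ∈ Set.Ioc 0 s) (hσ : σ ∈ Set.Icc 0 s) :
    φ σ ≤ max 1 (1 / c) * φ lam * lam ^ (-(ν - 1 / 2)) * (σ + lam) ^ (ν - 1 / 2) := by
  have hs : 0 < s := hlam.1.trans_le hlam.2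
  have hν := hcov.half_lt hφ hs
  have hl := hlam.1
  have hσ0 := hσ.1
  have hφl := hφ.pos hl
  have hexp : 0 ≤ ν - 1 / 2 := by linarith
  have hl1 : lam ^ (-(ν - 1 / 2)) * lam ^ (ν - 1 / 2) = 1 := by
    rw [← Real.rpow_add hl, neg_add_cancel, Real.rpow_zero]
  rcases le_total σ lam with h | h
  · calc φ σ ≤ φ lam := hφ.mono hσ0 h
      _ = 1 * φ lam * lam ^ (-(ν - 1 / 2)) * lam ^ (ν - 1 / 2) := by rw [mul_assoc, hl1]; ring
      _ ≤ _ := by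
        gcongr
        · exact le_max_left _ _
        · linarith
  · have hσp := hl.trans_le h
    have hφσ := hφ.pos hσp
    have hc := hcov.1
    have hq := hcov.2 lam hlam σ ⟨h, hσ.2⟩
    have hsplit : ∀ x : ℝ, 0 < x → x ^ ν = x ^ (ν - 1 / 2) * √x := fun x hx => by
      rw [Real.sqrt_eq_rpow, ← Real.rpow_add hx]; congr 1; ring
    have hq' : c * (lam ^ (ν - 1 / 2) / φ lam) ≤ σ ^ (ν - 1 / 2) / φ σ := by
      simp only [hsplit lam hl, hsplit σ hσp] at hq
      rwa [mul_div_mul_right _ _ (by positivity), mul_div_mul_right _ _ (by positivity)] at hq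
    rw [← mul_div_assoc, div_le_div_iff₀ hφl hφσ] at hq'
    have hlp := Real.rpow_pos_of_pos hl (ν - 1 / 2)
    calc φ σ = 1 / c * lam ^ (-(ν - 1 / 2)) * (c * lam ^ (ν - 1 / 2) * φ σ) := by
          rw [Real.rpow_neg hl.le]; field_simp
      _ ≤ 1 / c * lam ^ (-(ν - 1 / 2)) * (σ ^ (ν - 1 / 2) * φ lam) := by gcongr
      _ = 1 / c * φ lam * lam ^ (-(ν - 1 / 2)) * σ ^ (ν - 1 / 2) := by ring
      _ ≤ _ := by
        gcongr
        · exact le_max_right _ _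
        · linarith

theorem IsRegularizationFamily.abs_add_mul_le (hg : IsRegularizationFamily g s D B γ)
    (hlam : lam ∈ Set.Ioc 0 s) (hσ : σ ∈ Set.Ioc 0 s) : |(σ + lam) * g lam σ| ≤ B + D := by
  have h1 := hg.abs_le lam hlam σ hσ
  have h2 := hg.abs_mul_le lam hlam σ hσ
  have h3 : |lam * g lam σ| ≤ B := by
    rw [abs_mul, abs_of_pos hlam.1, mul_comm]
    exact (le_div_iff₀ hlam.1).1 h1
  rw [add_mul]
  linarith [abs_add_le (σ * g lam σ) (lam * g lam σ)]

end Scalar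

/-! ### Comparing powers of T + λ and T̂ + λ; sample error and bias -/

section Comparison

variable {ι κ H Y : Type*} [NormedAddCommGroup H] [InnerProductSpace ℝ H] [CompleteSpace H]
  [NormedAddCommGroup Y] [InnerProductSpace ℝ Y] [CompleteSpace Y]

/-- The power `(T + lam) ^ p` of the diagonal operator `T` with eigenvalues `a`. -/
def shiftPow (e : HilbertBasis ι ℝ H) (a : ι → ℝ) (lam p : ℝ) : H →L[ℝ] H :=
  diagOp e fun i => (a i + lam) ^ p

theorem rpow_add_le {s lam x p : ℝ} (hlam : 0 < lam) (hx : x ∈ Set.Icc 0 s) :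
    |(x + lam) ^ p| ≤ lam ^ p + (s + lam) ^ p := by
  have hx0 := hx.1
  have hs : 0 < s + lam := by linarith [hx.2]
  rw [abs_of_nonneg (by positivity)]
  rcases le_total 0 p with hp | hp
  · have : (x + lam) ^ p ≤ (s + lam) ^ p := by gcongr; exact hx.2
    have := Real.rpow_pos_of_pos hlam p
    linarith
  · have : (x + lam) ^ p ≤ lam ^ p := Real.rpow_le_rpow_of_nonpos hlam (by linarith) hp
    have := Real.rpow_pos_of_pos hs p
    linarith

variable {e : HilbertBasis ι ℝ H} {e' : HilbertBasis κ ℝ H} {a : ι → ℝ} {b : κ → ℝ}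
  {T Th R : H →L[ℝ] H} {s lam η : ℝ}

theorem isDiag_shiftPow (hlam : 0 < lam) (ha : ∀ i, a i ∈ Set.Icc 0 s) (p : ℝ) :
    IsDiag e (fun i => (a i + lam) ^ p) (shiftPow e a lam p) :=
  isDiag_diagOp e fun i => rpow_add_le hlam (ha i)

theorem IsDiag.add_smul_id (hT : IsDiag e a T) (lam : ℝ) :
    IsDiag e (fun i => a i + lam) (T + lam • ContinuousLinearMap.id ℝ H) := by
  simpa using hT.add (IsDiag.id.smul lam)

theorem IsDiag.mul {f g : ι → ℝ} {A C : H →L[ℝ] H} (hA : IsDiag e f A) (hC : IsDiag e g C) :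
    IsDiag e (fun i => f i * g i) (A * C) := hA.comp hC

theorem IsDiag.one : IsDiag e (fun _ => 1) (1 : H →L[ℝ] H) := IsDiag.id

theorem IsDiag.congr {f g : ι → ℝ} {A : H →L[ℝ] H} (hA : IsDiag e f A) (h : ∀ i, f i = g i) :
    IsDiag e g A := fun i => by rw [hA i, h i]

theorem IsDiag.pow {f : ι → ℝ} {A : H →L[ℝ] H} (hA : IsDiag e f A) (k : ℕ) :
    IsDiag e (fun i => f i ^ k) (A ^ k) := by
  induction k with
  | zero => simpa using IsDiag.one
  | succ k ih => simpa only [pow_succ] using ih.mul hA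

theorem shiftPow_mul (hlam : 0 < lam) (ha : ∀ i, a i ∈ Set.Icc 0 s) (p q : ℝ) :
    shiftPow e a lam p * shiftPow e a lam q = shiftPow e a lam (p + q) := by
  refine ((isDiag_shiftPow hlam ha p).mul (isDiag_shiftPow hlam ha q)).unique
    ((isDiag_shiftPow hlam ha (p + q)).congr fun i => ?_)
  have hpos : 0 < a i + lam := by linarith [(ha i).1]
  exact Real.rpow_add hpos p q

theorem shiftPow_zero (hlam : 0 < lam) (ha : ∀ i, a i ∈ Set.Icc 0 s) :
    shiftPow e a lam 0 = 1 :=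
  (isDiag_shiftPow hlam ha 0).unique (by simpa using IsDiag.one)

theorem norm_shiftPow_le (hlam : 0 < lam) (ha : ∀ i, a i ∈ Set.Icc 0 s) {p : ℝ} (hp : p ≤ 0) :
    ‖shiftPow e a lam p‖ ≤ lam ^ p := by
  refine (isDiag_shiftPow hlam ha p).norm_le (by positivity) fun i => ?_
  have h0 := (ha i).1
  rw [abs_of_nonneg (by positivity)]
  exact Real.rpow_le_rpow_of_nonpos hlam (by linarith) hp

/-- Factor T − T̂ as (T − T̂)(T + λ)^{-1/2} · (T + λ)^{-1/2} · (T + λ). The first two factors have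
norms at most √λ/2 and λ^{-1/2}, so the perturbation is at most half of ‖(T + λ)x‖. -/
theorem norm_add_smul_apply_le (hT : IsDiag e a T)
    (hlam : 0 < lam) (ha : ∀ i, a i ∈ Set.Icc 0 s)
    (hη : ‖(T - Th) * shiftPow e a lam (-(1 / 2))‖ ≤ √lam / 2) (x : H) :
    ‖(T + lam • ContinuousLinearMap.id ℝ H) x‖ ≤
      2 * ‖(Th + lam • ContinuousLinearMap.id ℝ H) x‖ := by
  set U := T + lam • ContinuousLinearMap.id ℝ H with hU
  set Uh := Th + lam • ContinuousLinearMap.id ℝ H with hUh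
  have hUd : IsDiag e (fun i => a i + lam) U := hT.add_smul_id lam
  have hid : shiftPow e a lam (-(1 / 2)) * shiftPow e a lam (-(1 / 2)) * U = 1 := by
    rw [shiftPow_mul hlam ha]
    refine ((isDiag_shiftPow hlam ha _).mul hUd).unique (IsDiag.one.congr fun i => ?_)
    have hpos : 0 < a i + lam := by linarith [(ha i).1]
    rw [show (-(1 / 2) + -(1 / 2) : ℝ) = -1 by norm_num, Real.rpow_neg_one,
      inv_mul_cancel₀ hpos.ne']
  have hsub : U - Uh = T - Th := by simp [hU, hUh]
  have h1 : ‖(U - Uh) x‖ ≤ 1 / 2 * ‖U x‖ := by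
    have hx : (U - Uh) x = (((T - Th) * shiftPow e a lam (-(1 / 2))) *
        shiftPow e a lam (-(1 / 2))) (U x) := by
      rw [hsub]
      conv_lhs => rw [← mul_one (T - Th), ← hid]
      rfl
    rw [hx]
    refine (ContinuousLinearMap.le_opNorm _ _).trans ?_
    gcongr
    refine (norm_mul_le _ _).trans ?_
    calc _ ≤ √lam / 2 * lam ^ (-(1 / 2) : ℝ) := by
          gcongr
          exact norm_shiftPow_le hlam ha (by norm_num)
      _ = 1 / 2 := by
          rw [Real.rpow_neg hlam.le, ← Real.sqrt_eq_rpow]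
          have := Real.sqrt_pos.2 hlam
          field_simp
  have h2 : ‖U x‖ ≤ ‖Uh x‖ + ‖(U - Uh) x‖ := by
    have := norm_add_le (Uh x) ((U - Uh) x)
    simpa using this
  linarith

variable [Countable ι] [Countable κ]

theorem norm_shiftPow_mul_shiftPow_neg_le (hT : IsDiag e a T) (hTh : IsDiag e' b Th)
    (hlam : 0 < lam) (ha : ∀ i, a i ∈ Set.Icc 0 s) (hb : ∀ i, b i ∈ Set.Icc 0 s)
    (hη : ‖(T - Th) * shiftPow e a lam (-(1 / 2))‖ ≤ √lam / 2) {θ : ℝ} (h0 : 0 ≤ θ) (h1 : θ ≤ 1) :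
    ‖shiftPow e a lam θ * shiftPow e' b lam (-θ)‖ ≤ 2 ^ θ := by
  refine ContinuousLinearMap.opNorm_le_bound _ (by positivity) fun x => ?_
  have hpa : ∀ i, 0 < a i + lam := fun i => by linarith [(ha i).1]
  have hpb : ∀ i, 0 < b i + lam := fun i => by linarith [(hb i).1]
  have h := heinz (hT.add_smul_id lam) (hTh.add_smul_id lam) hpa hpb two_pos
    (norm_add_smul_apply_le hT hlam ha hη) h0 h1 (isDiag_shiftPow hlam ha θ)
    (isDiag_shiftPow hlam hb θ) (shiftPow e' b lam (-θ) x)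
  have hx : shiftPow e' b lam θ (shiftPow e' b lam (-θ) x) = x := by
    have := DFunLike.congr_fun (shiftPow_mul (e := e') hlam hb θ (-θ)) x
    rwa [add_neg_cancel, shiftPow_zero hlam hb] at this
  rwa [hx] at h

/-- The adjoint is R (T̂ + λ)^{-1/2}, and ‖R y‖ ≤ ‖(T + λ)^{1/2} y‖, so the comparison with θ = 1/2
applies. -/
theorem norm_shiftPow_neg_half_mul_le (hT : IsDiag e a T) (hTh : IsDiag e' b Th)
    (hlam : 0 < lam) (ha : ∀ i, a i ∈ Set.Icc 0 s) (hb : ∀ i, b i ∈ Set.Icc 0 s)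
    (hη : ‖(T - Th) * shiftPow e a lam (-(1 / 2))‖ ≤ √lam / 2)
    (hR : IsDiag e (fun i => √(a i)) R) :
    ‖shiftPow e' b lam (-(1 / 2)) * R‖ ≤ √2 := by
  have hS := isDiag_shiftPow (e := e') hlam hb (-(1 / 2))
  have hadj : ContinuousLinearMap.adjoint (R * shiftPow e' b lam (-(1 / 2))) =
      shiftPow e' b lam (-(1 / 2)) * R := by
    change ContinuousLinearMap.adjoint (R ∘L shiftPow e' b lam (-(1 / 2))) = _
    rw [ContinuousLinearMap.adjoint_comp, hS.adjoint_eq, hR.adjoint_eq]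
    rfl
  rw [← hadj, LinearIsometryEquiv.norm_map]
  refine ContinuousLinearMap.opNorm_le_bound _ (by positivity) fun x => ?_
  have h := (shiftPow e a lam (1 / 2) * shiftPow e' b lam (-(1 / 2))).le_of_opNorm_le
    (norm_shiftPow_mul_shiftPow_neg_le hT hTh hlam ha hb hη (by norm_num) (by norm_num)) x
  rw [← Real.sqrt_eq_rpow] at h
  refine le_trans ?_ h
  refine hR.norm_apply_le_of_le (isDiag_shiftPow hlam ha (1 / 2)) (fun i => ?_) _
  rw [← Real.sqrt_eq_rpow, abs_of_nonneg (Real.sqrt_nonneg _), abs_of_nonneg (Real.sqrt_nonneg _)]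
  exact Real.sqrt_le_sqrt (by linarith)

/-- Telescoping without commutativity. The powers of y stand on the right so that, in the bias,
powers of T̂ + λ meet the residual of the filter. -/
theorem pow_sub_pow_eq_sum {A : Type*} [Ring A] (x y : A) (m : ℕ) :
    x ^ m - y ^ m = ∑ j ∈ Finset.range m, x ^ (m - 1 - j) * (x - y) * y ^ j := by
  induction m with
  | zero => simp
  | succ m ih =>
    have h : ∀ j ∈ Finset.range m, x ^ (m + 1 - 1 - j) * (x - y) * y ^ j =
        x * (x ^ (m - 1 - j) * (x - y) * y ^ j) := fun j hj => by
      rw [show m + 1 - 1 - j = (m - 1 - j) + 1 by have := Finset.mem_range.1 hj; omega, pow_succ']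
      simp only [mul_assoc]
    rw [Finset.sum_range_succ, Finset.sum_congr rfl h, ← Finset.mul_sum, ← ih]
    simp only [Nat.add_sub_cancel, Nat.sub_self, pow_zero, one_mul, pow_succ']
    noncomm_ring

/-- The sample error. -/
theorem hsENorm_sample_le {ε : H →L[ℝ] Y} {G : H →L[ℝ] H} {f : κ → ℝ} {v C : ℝ}
    (hT : IsDiag e a T) (hTh : IsDiag e' b Th)
    (hlam : 0 < lam) (ha : ∀ i, a i ∈ Set.Icc 0 s) (hb : ∀ i, b i ∈ Set.Icc 0 s)
    (hη : ‖(T - Th) * shiftPow e a lam (-(1 / 2))‖ ≤ √lam / 2)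
    (hR : IsDiag e (fun i => √(a i)) R) (hv : 0 ≤ v)
    (hε : hsENorm (ε ∘L shiftPow e a lam (-(1 / 2))) ≤ ENNReal.ofReal v)
    (hG : IsDiag e' f G) (hC : 0 ≤ C) (hf : ∀ j, |(b j + lam) * f j| ≤ C) :
    hsENorm (ε ∘L (G * R)) ≤ ENNReal.ofReal (2 * C * v) := by
  have hUG := (hTh.add_smul_id lam).mul hG
  have hGeq : G = shiftPow e' b lam (-(1 / 2)) *
      ((Th + lam • ContinuousLinearMap.id ℝ H) * G) * shiftPow e' b lam (-(1 / 2)) := by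
    refine hG.unique ((((isDiag_shiftPow hlam hb _).mul hUG).mul
      (isDiag_shiftPow hlam hb _)).congr fun j => ?_)
    have hpos : 0 < b j + lam := by linarith [(hb j).1]
    rw [mul_right_comm, ← Real.rpow_add hpos, show (-(1 / 2) + -(1 / 2) : ℝ) = -1 by norm_num,
      Real.rpow_neg_one]
    field_simp
  -- The two comparison factors contribute √2 each, the filter factor (T̂ + λ)G contributes C.
  have heq : ε ∘L (G * R) = (ε ∘L shiftPow e a lam (-(1 / 2))) ∘L
      ((shiftPow e a lam (1 / 2) * shiftPow e' b lam (-(1 / 2))) *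
        ((Th + lam • ContinuousLinearMap.id ℝ H) * G) * (shiftPow e' b lam (-(1 / 2)) * R)) := by
    have hid : shiftPow e a lam (-(1 / 2)) * shiftPow e a lam (1 / 2) = 1 := by
      rw [shiftPow_mul hlam ha, neg_add_cancel, shiftPow_zero hlam ha]
    change _ = ε ∘L (shiftPow e a lam (-(1 / 2)) * _)
    rw [mul_assoc, mul_assoc, ← mul_assoc (shiftPow e a lam (-(1 / 2))), hid, one_mul]
    conv_lhs => rw [hGeq]
    simp only [mul_assoc]
  rw [heq]
  refine (hsENorm_comp_le_ofReal hv hε (d := √2 * C * √2) ?_).trans_eq ?_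
  · refine (norm_mul_le _ _).trans ?_
    gcongr
    · refine (norm_mul_le _ _).trans ?_
      gcongr
      · have := norm_shiftPow_mul_shiftPow_neg_le hT hTh hlam ha hb hη (θ := 1 / 2) (by norm_num)
          (by norm_num)
        rwa [← Real.sqrt_eq_rpow] at this
      · exact hUG.norm_le hC hf
    · exact norm_shiftPow_neg_half_mul_le hT hTh hlam ha hb hη hR
  · congr 1
    linear_combination (v * C) * Real.mul_self_sqrt (show (0 : ℝ) ≤ 2 by norm_num)

/-- The bias. -/
theorem hsENorm_bias_le {W Z : H →L[ℝ] Y} {Rh : H →L[ℝ] H} {r : κ → ℝ} {w z C θ : ℝ} {m : ℕ}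
    (hT : IsDiag e a T) (hTh : IsDiag e' b Th)
    (hlam : 0 < lam) (ha : ∀ i, a i ∈ Set.Icc 0 s) (hb : ∀ i, b i ∈ Set.Icc 0 s)
    (hη : ‖(T - Th) * shiftPow e a lam (-(1 / 2))‖ ≤ η) (hηlam : η ≤ √lam / 2)
    (hR : IsDiag e (fun i => √(a i)) R) (hw : 0 ≤ w) (hz : 0 ≤ z) (hC : 0 ≤ C)
    (hθ0 : 0 ≤ θ) (hθ1 : θ ≤ 1)
    (hW : hsENorm W ≤ ENNReal.ofReal w) (hZ : hsENorm Z ≤ ENNReal.ofReal z)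
    (hWZ : W = Z ∘L shiftPow e a lam (θ + m)) (hRh : IsDiag e' r Rh)
    (hr : ∀ j, ∀ p : ℝ, p ≤ θ + m + 1 / 2 → |r j| * (b j + lam) ^ p ≤ C * lam ^ p) :
    hsENorm (W ∘L (Rh * R)) ≤
      ENNReal.ofReal (√2 * C * (m * (w * η) + 2 ^ θ * z * lam ^ (θ + m + 1 / 2))) := by
  have hη0 : 0 ≤ η := (norm_nonneg _).trans hη
  have hη' := hη.trans hηlam
  set U := T + lam • ContinuousLinearMap.id ℝ H with hU
  set Uh := Th + lam • ContinuousLinearMap.id ℝ H with hUh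
  have hUd : IsDiag e (fun i => a i + lam) U := hT.add_smul_id lam
  have hUhd : IsDiag e' (fun i => b i + lam) Uh := hTh.add_smul_id lam
  have hpb : ∀ i, 0 < b i + lam := fun i => by linarith [(hb i).1]
  have hUpow : ∀ k : ℕ, U ^ k = shiftPow e a lam k := fun k => (hUd.pow k).unique fun i => by
    simpa using isDiag_shiftPow (e := e) hlam ha k i
  have hUhpow : ∀ k : ℕ, Uh ^ k = shiftPow e' b lam k := fun k => (hUhd.pow k).unique fun i => by
    simpa using isDiag_shiftPow (e := e') hlam hb k i
  have hB := norm_shiftPow_neg_half_mul_le hT hTh hlam ha hb hη' hR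
  have hres : ∀ p : ℝ, p ≤ θ + m + 1 / 2 → ‖shiftPow e' b lam p * Rh‖ ≤ C * lam ^ p := fun p hp => by
    refine ((isDiag_shiftPow hlam hb p).mul hRh).norm_le (by positivity) fun j => ?_
    have := hpb j
    rw [abs_mul, abs_of_nonneg (by positivity), mul_comm]
    exact hr j p hp
  have hcomm : Commute (shiftPow e' b lam (-(1 / 2))) Rh :=
    ((isDiag_shiftPow hlam hb _).mul hRh).unique
      ((hRh.mul (isDiag_shiftPow hlam hb _)).congr fun j => mul_comm _ _)
  have hsplit : ∀ q : ℝ, shiftPow e' b lam q * Rh * R =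
      (shiftPow e' b lam (q + 1 / 2) * Rh) * (shiftPow e' b lam (-(1 / 2)) * R) := fun q => by
    have : shiftPow e' b lam q = shiftPow e' b lam (q + 1 / 2) * shiftPow e' b lam (-(1 / 2)) := by
      rw [shiftPow_mul hlam hb]; congr 1; ring
    rw [this, mul_assoc (shiftPow e' b lam (q + 1 / 2)), hcomm.eq]
    simp only [mul_assoc]
  have hright : ∀ q : ℝ, q ≤ θ + m → ‖shiftPow e' b lam q * Rh * R‖ ≤ C * lam ^ (q + 1 / 2) * √2 :=
    fun q hq => by
      rw [hsplit]
      refine (norm_mul_le _ _).trans ?_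
      gcongr
      exact hres _ (by linarith)
  have hdiff : ‖shiftPow e a lam (-(1 / 2)) * (U - Uh)‖ ≤ η := by
    have hsub : U - Uh = T - Th := by simp [hU, hUh]
    have hadj : ContinuousLinearMap.adjoint ((T - Th) * shiftPow e a lam (-(1 / 2))) =
        shiftPow e a lam (-(1 / 2)) * (T - Th) := by
      change ContinuousLinearMap.adjoint ((T - Th) ∘L shiftPow e a lam (-(1 / 2))) = _
      rw [ContinuousLinearMap.adjoint_comp, (isDiag_shiftPow hlam ha _).adjoint_eq, map_sub,
        hT.adjoint_eq, hTh.adjoint_eq]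
      rfl
    rw [hsub, ← hadj, LinearIsometryEquiv.norm_map]
    exact hη
  have hterm : ∀ j ∈ Finset.range m,
      hsENorm (Z ∘L (shiftPow e a lam θ * (U ^ (m - 1 - j) * (U - Uh) * Uh ^ j) * Rh * R)) ≤
        ENNReal.ofReal (√2 * C * (w * η)) := fun j hj => by
    have hjm := Finset.mem_range.1 hj
    have hcast : ((m - 1 - j : ℕ) : ℝ) = m - 1 - j := by
      rw [Nat.cast_sub (by omega), Nat.cast_sub (by omega)]
      simp
    -- Reassembling W leaves (T + λ)^{-(j+1)}. Half a power goes to U − Uh and gives η; the other j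
    -- + 1/2 give λ^{-(j+1/2)}, which cancels the λ^{j+1/2} of the residual. Each term thus costs
    -- the same for every j.
    have hop : Z ∘L (shiftPow e a lam θ * (U ^ (m - 1 - j) * (U - Uh) * Uh ^ j) * Rh * R) =
        W ∘L (shiftPow e a lam (-(j + 1 / 2)) * (shiftPow e a lam (-(1 / 2)) * (U - Uh)) *
          (shiftPow e' b lam j * Rh * R)) := by
      rw [hWZ]
      change _ = Z ∘L (shiftPow e a lam (θ + m) * _)
      have h1 : shiftPow e a lam θ * U ^ (m - 1 - j) =
          shiftPow e a lam (θ + m) * shiftPow e a lam (-(j + 1 / 2)) *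
            shiftPow e a lam (-(1 / 2)) := by
        rw [hUpow, shiftPow_mul hlam ha, shiftPow_mul hlam ha, shiftPow_mul hlam ha, hcast]
        congr 1
        ring
      congr 1
      rw [← hUhpow]
      simp only [← mul_assoc]
      rw [h1]
    rw [hop]
    refine (hsENorm_comp_le_ofReal hw hW
      (d := lam ^ (-(j + 1 / 2) : ℝ) * η * (C * lam ^ (j + 1 / 2 : ℝ) * √2)) ?_).trans_eq ?_
    · refine (norm_mul_le _ _).trans ?_
      gcongr
      · refine (norm_mul_le _ _).trans ?_
        gcongr
        exact norm_shiftPow_le hlam ha (by linarith [(Nat.cast_nonneg j : (0 : ℝ) ≤ j)])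
      · have : (j : ℝ) ≤ m := by exact_mod_cast hjm.le
        exact hright _ (by linarith)
    · congr 1
      have : lam ^ (-(j + 1 / 2) : ℝ) * lam ^ (j + 1 / 2 : ℝ) = 1 := by
        rw [← Real.rpow_add hlam, neg_add_cancel, Real.rpow_zero]
      linear_combination (w * η * C * √2) * this
  have hlast : hsENorm (Z ∘L (shiftPow e a lam θ * Uh ^ m * Rh * R)) ≤
      ENNReal.ofReal (√2 * C * (2 ^ θ * z * lam ^ (θ + m + 1 / 2))) := by
    -- Only the fractional power θ ≤ 1 is still in T, and the Heinz comparison moves it to T̂.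
    have hop : shiftPow e a lam θ * Uh ^ m * Rh * R =
        (shiftPow e a lam θ * shiftPow e' b lam (-θ)) * (shiftPow e' b lam (θ + m) * Rh * R) := by
      have : Uh ^ m = shiftPow e' b lam (-θ) * shiftPow e' b lam (θ + m) := by
        rw [hUhpow, shiftPow_mul hlam hb]; congr 1; ring
      rw [this]
      simp only [mul_assoc]
    rw [hop]
    refine (hsENorm_comp_le_ofReal hz hZ
      (d := 2 ^ θ * (C * lam ^ (θ + m + 1 / 2 : ℝ) * √2)) ?_).trans_eq ?_
    · refine (norm_mul_le _ _).trans ?_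
      gcongr
      · exact norm_shiftPow_mul_shiftPow_neg_le hT hTh hlam ha hb hη' hθ0 hθ1
      · exact hright _ le_rfl
    · congr 1; ring
  have hdecomp : W ∘L (Rh * R) =
      ∑ j ∈ Finset.range m,
        Z ∘L (shiftPow e a lam θ * (U ^ (m - 1 - j) * (U - Uh) * Uh ^ j) * Rh * R) +
      Z ∘L (shiftPow e a lam θ * Uh ^ m * Rh * R) := by
    have h1 : shiftPow e a lam (θ + m) = shiftPow e a lam θ *
        (∑ j ∈ Finset.range m, U ^ (m - 1 - j) * (U - Uh) * Uh ^ j) +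
          shiftPow e a lam θ * Uh ^ m := by
      rw [← pow_sub_pow_eq_sum, ← mul_add, sub_add_cancel, hUpow, shiftPow_mul hlam ha]
    rw [hWZ, ← ContinuousLinearMap.comp_finsetSum, ← ContinuousLinearMap.comp_add]
    change Z ∘L (shiftPow e a lam (θ + m) * (Rh * R)) = _
    rw [h1]
    congr 1
    simp only [Finset.mul_sum, Finset.sum_mul, add_mul, mul_assoc]
  rw [hdecomp]
  refine (hsENorm_add_le _ _).trans ((add_le_add ((hsENorm_sum_le _ _).trans
    (Finset.sum_le_sum hterm)) hlast).trans_eq ?_)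
  rw [Finset.sum_const, Finset.card_range, nsmul_eq_mul, ← ENNReal.ofReal_natCast,
    ← ENNReal.ofReal_mul (by positivity), ← ENNReal.ofReal_add (by positivity) (by positivity)]
  congr 1
  ring

end Comparison

/-! ### Probabilistic bounds for the two empirical operators -/

section Deviation

variable {ι X H Y V : Type*} [MeasurableSpace X] [NormedAddCommGroup H] [InnerProductSpace ℝ H]
  [CompleteSpace H] [TopologicalSpace.SeparableSpace H] [RKHS ℝ H X ℝ]
  [NormedAddCommGroup Y] [InnerProductSpace ℝ Y] [CompleteSpace Y]
  [TopologicalSpace.SeparableSpace Y] [MeasurableSpace Y] [BorelSpace Y]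
  [NormedAddCommGroup V] [InnerProductSpace ℝ V] [CompleteSpace V]
  {pX qX : Measure X} [IsProbabilityMeasure pX] [IsProbabilityMeasure qX]
  {K : Kernel X Y} [IsMarkovKernel K] {β : X → ℝ} {b κ : ℝ} {n : ℕ}

theorem integral_smul_density (hβ_meas : Measurable β) (hβ_nonneg : ∀ x, 0 ≤ β x)
    (hqX : qX = pX.withDensity fun x => ENNReal.ofReal (β x)) (f : X → V) :
    ∫ x, β x • f x ∂pX = ∫ x, f x ∂qX := by
  rw [hqX, integral_withDensity_eq_integral_toReal_smul hβ_meas.ennreal_ofReal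
    (.of_forall fun x => ENNReal.ofReal_lt_top)]
  simp only [ENNReal.toReal_ofReal (hβ_nonneg _)]

theorem integral_fst_compProd {f : X → V} (hf : StronglyMeasurable f) :
    ∫ z, f z.1 ∂(pX ⊗ₘ K) = ∫ x, f x ∂pX := by
  have h := Measure.fst_compProd pX K
  rw [Measure.fst] at h
  conv_rhs => rw [← h]
  rw [integral_map measurable_fst.aemeasurable hf.aestronglyMeasurable]

/-- The density β integrates to 1. This places the spectrum of C_X, bounded by κ² ≤ b κ², in [0, s].
-/
theorem one_le_of_density (hβ_le : ∀ x, β x ≤ b)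
    (hqX : qX = pX.withDensity fun x => ENNReal.ofReal (β x)) : 1 ≤ b := by
  have h1 : qX Set.univ = 1 := measure_univ
  rw [hqX, withDensity_apply _ MeasurableSet.univ, Measure.restrict_univ] at h1
  have h2 : ∫⁻ x, ENNReal.ofReal (β x) ∂pX ≤ ∫⁻ _, ENNReal.ofReal b ∂pX :=
    lintegral_mono fun x => ENNReal.ofReal_le_ofReal (hβ_le x)
  rw [h1, lintegral_const, measure_univ, mul_one, ENNReal.one_le_ofReal] at h2
  exact h2

/-- The weighted tensor `v ⊗ S φ(x)` whose average is the empirical operator composed with `S`. -/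
def sampleTensor (e : HilbertBasis ι ℝ H) (S : H →L[ℝ] H) (v : X × Y → V) (z : X × Y) :
    lp (fun _ : ι => V) 2 :=
  hsTensor e (v z) (S (featureMap H z.1))

theorem stronglyMeasurable_sampleTensor
    (hk_meas : ∀ t : X, Measurable fun x => scalarKernel H x t)
    (e : HilbertBasis ι ℝ H) (S : H →L[ℝ] H) {v : X × Y → V} (hv : StronglyMeasurable v) :
    StronglyMeasurable (sampleTensor e S v) := by
  have hS : StronglyMeasurable fun z : X × Y => S (featureMap H z.1) :=
    S.continuous.comp_stronglyMeasurable
      ((stronglyMeasurable_featureMap hk_meas).comp_measurable measurable_fst)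
  exact (hsTensor e).continuous₂.comp_stronglyMeasurable (hv.prodMk hS)

theorem norm_sampleTensor_le (e : HilbertBasis ι ℝ H) {S : H →L[ℝ] H} {v : X × Y → V} {M l : ℝ}
    (hM : 0 ≤ M) (hb : 0 ≤ b) (hκ : 0 ≤ κ) (hk : ∀ x : X, scalarKernel H x x ≤ κ ^ 2)
    (hβ_le : ∀ x, β x ≤ b) (hS : ‖S‖ ≤ l)
    (hvM : ∀ᵐ z ∂(pX ⊗ₘ K), ‖v z‖ ≤ β z.1 * M) :
    ∀ᵐ z ∂(pX ⊗ₘ K), ‖sampleTensor e S v z‖ ≤ b * M * (l * κ) := by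
  filter_upwards [hvM] with z hz
  refine (norm_hsTensor_le e _ _).trans ?_
  have h1 : ‖S (featureMap H z.1)‖ ≤ l * κ := S.le_of_opNorm_le_of_le hS (norm_featureMap_le hκ hk _)
  have h2 : ‖v z‖ ≤ b * M := hz.trans (mul_le_mul_of_nonneg_right (hβ_le _) hM)
  gcongr

/-- Of the two factors β in the square, one is bounded by b and the other turns p_X into q_X, so the
variance involves the target distribution with only one factor b. -/
theorem integral_norm_sq_sampleTensor_le (e : HilbertBasis ι ℝ H) {S : H →L[ℝ] H}
    {v : X × Y → V} {M : ℝ} (hκ : 0 ≤ κ)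
    (hk_meas : ∀ t : X, Measurable fun x => scalarKernel H x t)
    (hk : ∀ x : X, scalarKernel H x x ≤ κ ^ 2)
    (hβ_meas : Measurable β) (hβ_nonneg : ∀ x, 0 ≤ β x)
    (hβ_le : ∀ x, β x ≤ b) (hqX : qX = pX.withDensity fun x => ENNReal.ofReal (β x))
    (hvM : ∀ᵐ z ∂(pX ⊗ₘ K), ‖v z‖ ≤ β z.1 * M) :
    ∫ z, ‖sampleTensor e S v z‖ ^ 2 ∂(pX ⊗ₘ K) ≤
      b * M ^ 2 * ∫ x, ‖S (featureMap H x)‖ ^ 2 ∂qX := by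
  have hS : StronglyMeasurable fun x : X => S (featureMap H x) :=
    S.continuous.comp_stronglyMeasurable (stronglyMeasurable_featureMap hk_meas)
  have hf : StronglyMeasurable fun x : X => β x • ‖S (featureMap H x)‖ ^ 2 :=
    hβ_meas.stronglyMeasurable.smul (hS.norm.pow 2)
  rw [← integral_smul_density hβ_meas hβ_nonneg hqX, ← integral_fst_compProd (K := K) hf,
    ← integral_const_mul]
  refine integral_mono_of_nonneg (.of_forall fun z => sq_nonneg _) ?_ ?_
  · refine Integrable.const_mul ?_ _
    refine Integrable.of_bound (C := b * (‖S‖ * κ) ^ 2)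
      (hf.comp_measurable measurable_fst).aestronglyMeasurable (.of_forall fun z => ?_)
    have h1 : ‖S (featureMap H z.1)‖ ≤ ‖S‖ * κ :=
      S.le_opNorm_of_le (norm_featureMap_le hκ hk _)
    rw [norm_smul, norm_pow, norm_norm, Real.norm_of_nonneg (hβ_nonneg _)]
    have hb : 0 ≤ b := (hβ_nonneg z.1).trans (hβ_le z.1)
    have := hβ_le z.1
    gcongr
  · filter_upwards [hvM] with z hz
    have hβ0 := hβ_nonneg z.1
    have hβb := hβ_le z.1
    calc ‖sampleTensor e S v z‖ ^ 2 ≤ (‖v z‖ * ‖S (featureMap H z.1)‖) ^ 2 := by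
          gcongr
          exact norm_hsTensor_le e _ _
      _ ≤ (β z.1 * M * ‖S (featureMap H z.1)‖) ^ 2 := by gcongr
      _ = β z.1 * (β z.1 * (M ^ 2 * ‖S (featureMap H z.1)‖ ^ 2)) := by ring
      _ ≤ b * (β z.1 * (M ^ 2 * ‖S (featureMap H z.1)‖ ^ 2)) := by gcongr
      _ = _ := by rw [smul_eq_mul]; ring

theorem sampleTensor_deviation (e : HilbertBasis ι ℝ H) {S : H →L[ℝ] H} {v : X × Y → V}
    {M l N : ℝ} (hv : StronglyMeasurable v) (hM : 0 ≤ M) (hl : 0 ≤ l) (hκ : 0 ≤ κ)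
    (hk_meas : ∀ t : X, Measurable fun x => scalarKernel H x t)
    (hk : ∀ x : X, scalarKernel H x x ≤ κ ^ 2)
    (hβ_meas : Measurable β) (hβ_nonneg : ∀ x, 0 ≤ β x)
    (hβ_le : ∀ x, β x ≤ b) (hqX : qX = pX.withDensity fun x => ENNReal.ofReal (β x))
    (hS : ‖S‖ ≤ l) (hN : ∫ x, ‖S (featureMap H x)‖ ^ 2 ∂qX = N)
    (hvM : ∀ᵐ z ∂(pX ⊗ₘ K), ‖v z‖ ≤ β z.1 * M) (hn : 1 ≤ n) {a t : ℝ} (ha : 2 ≤ a) (ht : 0 < t) :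
    (Measure.pi fun _ : Fin n => pX ⊗ₘ K) {z | a * M * (2 * b * κ * l / n + √(b * N / n)) * t <
        ‖(1 / n : ℝ) • ∑ i, sampleTensor e S v (z i) - ∫ z, sampleTensor e S v z ∂(pX ⊗ₘ K)‖} ≤
      ENNReal.ofReal (min (2 * Real.exp (1 - 2 * t)) (1 / (a * t) ^ 2)) := by
  have hb : 0 ≤ b := zero_le_one.trans (one_le_of_density hβ_le hqX)
  have hN0 : 0 ≤ N := hN ▸ integral_nonneg fun x => sq_nonneg _
  have h := measure_pi_norm_average_sub_gt_le (pX ⊗ₘ K)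
    (stronglyMeasurable_sampleTensor (Y := Y) hk_meas e S hv) (L := b * M * (l * κ)) (by positivity)
    (norm_sampleTensor_le e hM hb hκ hk hβ_le hS hvM) (σ := M * √(b * N)) (by positivity)
    (by
      refine (integral_norm_sq_sampleTensor_le e hκ hk_meas hk hβ_meas hβ_nonneg hβ_le hqX
        hvM).trans_eq ?_
      rw [hN, mul_pow, Real.sq_sqrt (by positivity)]
      ring) hn ha ht
  convert h using 5
  rw [Real.sqrt_div (by positivity)]
  ring

/-! ### The two empirical operators -/

theorem integral_lp_apply {Z : Type*} [MeasurableSpace Z] {μ : Measure Z}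
    {F : Z → lp (fun _ : ι => V) 2} (hF : Integrable F μ) (i : ι) :
    (∫ z, F z ∂μ) i = ∫ z, F z i ∂μ :=
  ((lp.evalCLM ℝ (fun _ : ι => V) 2 i).integral_comp_comm hF).symm

theorem average_sampleTensor_apply (e : HilbertBasis ι ℝ H) (S : H →L[ℝ] H) (v : X × Y → V)
    (z : Fin n → X × Y) (i : ι) :
    ((1 / n : ℝ) • ∑ j, sampleTensor e S v (z j)) i =
      (1 / n : ℝ) • ∑ j, ⟪e i, S (featureMap H (z j).1)⟫_ℝ • v (z j) := by
  rw [lp.coeFn_smul, Pi.smul_apply, lp.coeFn_sum, Finset.sum_apply]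
  rfl

theorem hsENorm_empCovOp_sub {e : HilbertBasis ι ℝ H} {S : H →L[ℝ] H}
    (hSsymm : ∀ u v, ⟪S u, v⟫_ℝ = ⟪u, S v⟫_ℝ) (hκ : 0 ≤ κ)
    (hk_meas : ∀ t : X, Measurable fun x => scalarKernel H x t)
    (hk : ∀ x : X, scalarKernel H x x ≤ κ ^ 2)
    (hβ_meas : Measurable β) (hβ_nonneg : ∀ x, 0 ≤ β x)
    (hqX : qX = pX.withDensity fun x => ENNReal.ofReal (β x))
    (hint : Integrable (sampleTensor e S fun z : X × Y => β z.1 • featureMap H z.1) (pX ⊗ₘ K))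
    (z : Fin n → X × Y) :
    hsENorm ((empCovOp H β z - covOp H qX) ∘L S) = ENNReal.ofReal
      ‖(1 / n : ℝ) • ∑ i, sampleTensor e S (fun z : X × Y => β z.1 • featureMap H z.1) (z i) -
        ∫ z, sampleTensor e S (fun z : X × Y => β z.1 • featureMap H z.1) z ∂(pX ⊗ₘ K)‖ := by
  refine hsENorm_eq_of_coord e _ _ fun i => ?_
  have hm := stronglyMeasurable_featureMap hk_meas
  have hSm : StronglyMeasurable fun x : X => ⟪e i, S (featureMap H x)⟫_ℝ :=
    stronglyMeasurable_const.inner (S.continuous.comp_stronglyMeasurable hm)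
  rw [lp.coeFn_sub, Pi.sub_apply, average_sampleTensor_apply, integral_lp_apply hint]
  change empCovOp H β z (S (e i)) - covOp H qX (S (e i)) = _
  congr 1
  · rw [empCovOp_apply]
    congr 1
    refine Finset.sum_congr rfl fun j _ => ?_
    rw [← hSsymm, real_inner_comm, smul_smul, mul_comm]
  · rw [covOp_apply hκ hk_meas hk, ← integral_smul_density hβ_meas hβ_nonneg hqX,
      ← integral_fst_compProd (K := K)]
    · refine integral_congr_ae (.of_forall fun z => ?_)
      change _ = ⟪e i, S (featureMap H z.1)⟫_ℝ • β z.1 • featureMap H z.1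
      simp only
      rw [← hSsymm, real_inner_comm, smul_comm]
    · exact hβ_meas.stronglyMeasurable.smul
        ((hm.inner (𝕜 := ℝ) (stronglyMeasurable_const (b := S (e i)))).smul hm)

/-- Integrating over y first replaces y by f*(x). The weight then turns p_X into q_X, which matters
because f* = W φ is known only q_X-almost everywhere. -/
theorem integral_sampleTensor_residual_eq_zero {e : HilbertBasis ι ℝ H} {S : H →L[ℝ] H}
    {W : H →L[ℝ] Y} {M' : ℝ}
    (hβ_meas : Measurable β) (hβ_nonneg : ∀ x, 0 ≤ β x)
    (hqX : qX = pX.withDensity fun x => ENNReal.ofReal (β x))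
    (hM' : ∀ᵐ z ∂(pX ⊗ₘ K), ‖z.2‖ ≤ M')
    (hreg : ∀ᵐ x ∂qX, regressionFun K x = W (featureMap H x))
    (hint : Integrable (sampleTensor e S fun z : X × Y => β z.1 • (z.2 - W (featureMap H z.1)))
      (pX ⊗ₘ K)) :
    ∫ z, sampleTensor e S (fun z : X × Y => β z.1 • (z.2 - W (featureMap H z.1))) z ∂(pX ⊗ₘ K) =
      0 := by
  have : SecondCountableTopology Y := UniformSpace.secondCountable_of_separable Y
  refine lp.ext (funext fun i => ?_)
  rw [integral_lp_apply hint]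
  have hint_i : Integrable (fun z => sampleTensor e S
      (fun z : X × Y => β z.1 • (z.2 - W (featureMap H z.1))) z i) (pX ⊗ₘ K) :=
    (lp.evalCLM ℝ (fun _ : ι => Y) 2 i).integrable_comp hint
  rw [Measure.integral_compProd hint_i]
  have hinner : ∀ᵐ x ∂pX, ∫ y, sampleTensor e S
      (fun z : X × Y => β z.1 • (z.2 - W (featureMap H z.1))) (x, y) i ∂(K x) =
      β x • (⟪e i, S (featureMap H x)⟫_ℝ • (regressionFun K x - W (featureMap H x))) := by
    filter_upwards [Measure.ae_ae_of_ae_compProd hM'] with x hx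
    have hid : Integrable (fun y : Y => y) (K x) :=
      Integrable.of_bound stronglyMeasurable_id.aestronglyMeasurable M' hx
    change ∫ y, ⟪e i, S (featureMap H x)⟫_ℝ • β x • (y - W (featureMap H x)) ∂(K x) = _
    rw [integral_smul, integral_smul, integral_sub hid (integrable_const _), integral_const,
      probReal_univ, one_smul, smul_comm]
    rfl
  rw [integral_congr_ae hinner, integral_smul_density hβ_meas hβ_nonneg hqX]
  refine integral_eq_zero_of_ae ?_
  filter_upwards [hreg] with x hx
  rw [hx, sub_self, smul_zero]
  rfl

theorem hsENorm_residual {e : HilbertBasis ι ℝ H} {S : H →L[ℝ] H}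
    (hSsymm : ∀ u v, ⟪S u, v⟫_ℝ = ⟪u, S v⟫_ℝ) (W : H →L[ℝ] Y) (z : Fin n → X × Y) :
    hsENorm ((empCrossCovOp H β z - W ∘L empCovOp H β z) ∘L S) = ENNReal.ofReal
      ‖(1 / n : ℝ) • ∑ i, sampleTensor e S
        (fun z : X × Y => β z.1 • (z.2 - W (featureMap H z.1))) (z i)‖ := by
  refine hsENorm_eq_of_coord e _ _ fun i => ?_
  rw [average_sampleTensor_apply]
  change empCrossCovOp H β z (S (e i)) - W (empCovOp H β z (S (e i))) = _
  rw [empCovOp_apply, empCrossCovOp_apply, map_smul, map_sum, ← smul_sub, ← Finset.sum_sub_distrib]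
  congr 1
  refine Finset.sum_congr rfl fun j _ => ?_
  rw [map_smul, ← smul_sub, ← hSsymm, real_inner_comm, smul_smul, mul_comm]

/-- With high probability, the empirical covariance operator and the residual operator
`Ĉ_YX - W Ĉ_X` are close to their expectations. -/
theorem exists_event {M' w l N δ : ℝ} {W : H →L[ℝ] Y} {S : H →L[ℝ] H}
    (hSsymm : ∀ u v, ⟪S u, v⟫_ℝ = ⟪u, S v⟫_ℝ) (hl : 0 ≤ l) (hκ : 0 ≤ κ)
    (hk_meas : ∀ t : X, Measurable fun x => scalarKernel H x t)
    (hk : ∀ x : X, scalarKernel H x x ≤ κ ^ 2)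
    (hβ_meas : Measurable β) (hβ_nonneg : ∀ x, 0 ≤ β x)
    (hβ_le : ∀ x, β x ≤ b) (hqX : qX = pX.withDensity fun x => ENNReal.ofReal (β x))
    (hM' : ∀ᵐ z ∂(pX ⊗ₘ K), ‖z.2‖ ≤ M') (hW : ‖W‖ ≤ w)
    (hreg : ∀ᵐ x ∂qX, regressionFun K x = W (featureMap H x))
    (hS : ‖S‖ ≤ l) (hN : ∫ x, ‖S (featureMap H x)‖ ^ 2 ∂qX = N) (hn : 1 ≤ n)
    (hδ0 : 0 < δ) (hδ1 : δ < 1) :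
    ∃ E : Set (Fin n → X × Y), MeasurableSet E ∧
      ENNReal.ofReal (1 - δ) ≤ Measure.pi (fun _ : Fin n => pX ⊗ₘ K) E ∧
      ∀ z ∈ E,
        hsENorm ((empCovOp H β z - covOp H qX) ∘L S) ≤ ENNReal.ofReal
          (2 * κ * (2 * b * κ * l / n + √(b * N / n)) * Real.log (2 / δ)) ∧
        hsENorm ((empCrossCovOp H β z - W ∘L empCovOp H β z) ∘L S) ≤ ENNReal.ofReal
          (5 / 2 * (M' + w * κ) * (2 * b * κ * l / n + √(b * N / n)) * Real.log (2 / δ)) := by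
  have : SecondCountableTopology Y := UniformSpace.secondCountable_of_separable Y
  have hm := stronglyMeasurable_featureMap hk_meas
  have hm1 : StronglyMeasurable fun z : X × Y => featureMap H z.1 :=
    hm.comp_measurable measurable_fst
  have hβ1 : StronglyMeasurable fun z : X × Y => β z.1 :=
    (hβ_meas.comp measurable_fst).stronglyMeasurable
  have hb : 0 ≤ b := zero_le_one.trans (one_le_of_density hβ_le hqX)
  have hM'0 : 0 ≤ M' := by
    obtain ⟨z, hz⟩ := hM'.exists
    exact (norm_nonneg _).trans hz
  have hw : 0 ≤ w := (norm_nonneg _).trans hW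
  have ht : 0 < Real.log (2 / δ) := Real.log_pos (by rw [lt_div_iff₀ hδ0]; linarith)
  set e := someBasis H
  set v1 : X × Y → H := fun z => β z.1 • featureMap H z.1 with hv1_def
  set v2 : X × Y → Y := fun z => β z.1 • (z.2 - W (featureMap H z.1)) with hv2_def
  have hv1 : StronglyMeasurable v1 := hβ1.smul hm1
  have hv2 : StronglyMeasurable v2 :=
    hβ1.smul (measurable_snd.stronglyMeasurable.sub (W.continuous.comp_stronglyMeasurable hm1))
  have hvM1 : ∀ᵐ z ∂(pX ⊗ₘ K), ‖v1 z‖ ≤ β z.1 * κ := .of_forall fun z => by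
    rw [norm_smul, Real.norm_of_nonneg (hβ_nonneg _)]
    exact mul_le_mul_of_nonneg_left (norm_featureMap_le hκ hk _) (hβ_nonneg _)
  have hvM2 : ∀ᵐ z ∂(pX ⊗ₘ K), ‖v2 z‖ ≤ β z.1 * (M' + w * κ) := by
    filter_upwards [hM'] with z hz
    rw [norm_smul, Real.norm_of_nonneg (hβ_nonneg _)]
    refine mul_le_mul_of_nonneg_left ((norm_sub_le _ _).trans (add_le_add hz ?_)) (hβ_nonneg _)
    exact W.le_of_opNorm_le_of_le hW (norm_featureMap_le hκ hk _)
  have hF1 := stronglyMeasurable_sampleTensor hk_meas e S hv1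
  have hF2 := stronglyMeasurable_sampleTensor hk_meas e S hv2
  have hi1 : Integrable (sampleTensor e S v1) (pX ⊗ₘ K) :=
    integrable_of_norm_le hF1 (norm_sampleTensor_le e hκ hb hκ hk hβ_le hS hvM1)
  have hi2 : Integrable (sampleTensor e S v2) (pX ⊗ₘ K) :=
    integrable_of_norm_le hF2 (norm_sampleTensor_le e (by positivity) hb hκ hk hβ_le hS hvM2)
  -- The factor 2 here is forced by the condition on λ; the factor 5/2 for the second deviation
  -- comes from the coefficient 5 = 2 · 5/2 in A₂.
  have h1 := sampleTensor_deviation e hv1 hκ hl hκ hk_meas hk hβ_meas hβ_nonneg hβ_le hqX hS hN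
    hvM1 hn le_rfl ht
  have h2 := sampleTensor_deviation e hv2 (by positivity) hl hκ hk_meas hk hβ_meas hβ_nonneg hβ_le
    hqX hS hN hvM2 hn (show (2 : ℝ) ≤ 5 / 2 by norm_num) ht
  rw [integral_sampleTensor_residual_eq_zero hβ_meas hβ_nonneg hqX hM' hreg hi2] at h2
  simp only [sub_zero] at h2
  set r1 := 2 * κ * (2 * b * κ * l / n + √(b * N / n)) * Real.log (2 / δ)
  set r2 := 5 / 2 * (M' + w * κ) * (2 * b * κ * l / n + √(b * N / n)) * Real.log (2 / δ)
  set B1 : Set (Fin n → X × Y) := {z | r1 < ‖(1 / n : ℝ) • ∑ i, sampleTensor e S v1 (z i) -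
    ∫ z, sampleTensor e S v1 z ∂(pX ⊗ₘ K)‖} with hB1
  set B2 : Set (Fin n → X × Y) := {z | r2 < ‖(1 / n : ℝ) • ∑ i, sampleTensor e S v2 (z i)‖} with hB2
  have hB1m : MeasurableSet B1 := measurableSet_lt measurable_const
    (((stronglyMeasurable_pi_sum hF1 n).const_smul (1 / n : ℝ)).sub
      stronglyMeasurable_const).norm.measurable
  have hB2m : MeasurableSet B2 := measurableSet_lt measurable_const
    ((stronglyMeasurable_pi_sum hF2 n).const_smul (1 / n : ℝ)).norm.measurable
  refine ⟨(B1 ∪ B2)ᶜ, (hB1m.union hB2m).compl, ?_, fun z hz => ?_⟩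
  · rw [prob_compl_eq_one_sub (hB1m.union hB2m), ENNReal.ofReal_sub _ hδ0.le, ENNReal.ofReal_one]
    refine tsub_le_tsub_left ((measure_union_le _ _).trans ((add_le_add h1 h2).trans ?_)) _
    rw [← ENNReal.ofReal_add (by positivity) (by positivity)]
    exact ENNReal.ofReal_le_ofReal (deviation_prob_add_le hδ0 hδ1)
  · simp only [Set.mem_compl_iff, Set.mem_union, not_or] at hz
    constructor
    · rw [hsENorm_empCovOp_sub (e := e) hSsymm hκ hk_meas hk hβ_meas hβ_nonneg hqX hi1]
      exact ENNReal.ofReal_le_ofReal (not_lt.1 hz.1)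
    · rw [hsENorm_residual (e := e) hSsymm]
      exact ENNReal.ofReal_le_ofReal (not_lt.1 hz.2)

end Deviation

/-! ### The deterministic error bound and its constants -/

section Main

/-- The constants of the error bound. -/
theorem error_constants_le {ν θ γ' cc b κ w co x BD M N n lam t : ℝ} {m : ℕ}
    (hν : ν = θ + m + 1 / 2) (hθ : 0 ≤ θ) (hγ : 0 ≤ γ') (hcc : 1 ≤ cc) (hb : 0 ≤ b) (hκ : 0 ≤ κ)
    (hw : 0 ≤ w) (hlam : 0 < lam) (hn : 0 < n) (ht : 0 ≤ t) :
    √2 * (2 ^ ν * γ') * (m * (w * (2 * κ * (2 * b * κ * lam ^ (-(1 / 2) : ℝ) / n +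
          √(b * N / n)) * t)) +
        2 ^ θ * (co * (cc * x * lam ^ (-(ν - 1 / 2)))) * lam ^ (θ + m + 1 / 2)) +
      2 * BD * (5 / 2 * M * (2 * b * κ * lam ^ (-(1 / 2) : ℝ) / n + √(b * N / n)) * t) ≤
    ((2 ^ (2 * ν - m + 2) * γ' * cc * m * b * κ ^ 2 * w + 10 * b * M * κ * BD) / n * √(1 / lam) +
        (2 ^ (2 * ν - m + 1) * γ' * cc * m * √b * κ * w + 5 * M * √b * BD) * √(N / n)) * t +
      2 ^ (2 * ν - m) * γ' * cc * co * √lam * x := by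
  have h2 : (0 : ℝ) < 2 := two_pos
  have hl : √(1 / lam) = lam ^ (-(1 / 2) : ℝ) := by
    rw [Real.rpow_neg hlam.le, ← Real.sqrt_eq_rpow, one_div, Real.sqrt_inv]
  have hsq : √(b * N / n) = √b * √(N / n) := by rw [mul_div_assoc, Real.sqrt_mul hb]
  have hp1 : (2 : ℝ) ^ (2 * ν - m + 1) = 2 ^ (2 * ν - m) * 2 := by
    rw [Real.rpow_add h2, Real.rpow_one]
  have hp2 : (2 : ℝ) ^ (2 * ν - m + 2) = 2 ^ (2 * ν - m) * 4 := by
    rw [Real.rpow_add h2]; norm_num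
  -- √2 comes from (T̂ + λ)^{-1/2} T^{1/2}, 2^ν from the residual bound and 2^θ from Heinz, with θ =
  -- ν − m − 1/2.
  have hp3 : √2 * 2 ^ ν * 2 ^ θ = (2 : ℝ) ^ (2 * ν - m) := by
    rw [Real.sqrt_eq_rpow, ← Real.rpow_add h2, ← Real.rpow_add h2]
    congr 1
    rw [hν]; ring
  have hlam2 : lam ^ (-(ν - 1 / 2)) * lam ^ (θ + m + 1 / 2) = √lam := by
    rw [← Real.rpow_add hlam, Real.sqrt_eq_rpow]
    congr 1
    rw [hν]; ring
  -- The telescoping terms carry neither 2^θ nor max(1, 1/c); both are at least 1 and are inserted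
  -- to reach the stated constants.
  have hle : √2 * 2 ^ ν ≤ (2 : ℝ) ^ (2 * ν - m) * cc := by
    rw [← hp3]
    have h1 : (1 : ℝ) ≤ 2 ^ θ := Real.one_le_rpow one_le_two hθ
    have h0 : 0 ≤ √2 * (2 : ℝ) ^ ν := by positivity
    calc √2 * (2 : ℝ) ^ ν = √2 * 2 ^ ν * 1 * 1 := by ring
      _ ≤ _ := by gcongr
  rw [hl, hsq, hp1, hp2]
  set L := lam ^ (-(1 / 2) : ℝ)
  have hL : 0 ≤ L := by positivity
  set P := (2 : ℝ) ^ (2 * ν - m)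
  set s := √(N / n)
  have hq : 0 ≤ γ' * (m * (w * (2 * κ * (2 * b * κ * L / n + √b * s) * t))) := by positivity
  have hmul := mul_le_mul_of_nonneg_right hle hq
  have hb2 : 2 ^ θ * (co * (cc * x * lam ^ (-(ν - 1 / 2)))) * lam ^ (θ + m + 1 / 2) =
      2 ^ θ * (co * (cc * x)) * √lam := by
    rw [← hlam2]; ring
  rw [hb2]
  have e1 : √2 * (2 ^ ν * γ') * (m * (w * (2 * κ * (2 * b * κ * L / n + √b * s) * t)) +
      2 ^ θ * (co * (cc * x)) * √lam) =
      √2 * 2 ^ ν * (γ' * (m * (w * (2 * κ * (2 * b * κ * L / n + √b * s) * t)))) +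
        P * γ' * cc * co * √lam * x := by
    rw [← hp3]; ring
  rw [e1]
  refine (add_le_add_left (add_le_add_left hmul _) _).trans_eq ?_
  ring

variable {X H Y : Type*} [MeasurableSpace X] [NormedAddCommGroup H] [InnerProductSpace ℝ H]
  [CompleteSpace H] [TopologicalSpace.SeparableSpace H] [RKHS ℝ H X ℝ]
  [NormedAddCommGroup Y] [InnerProductSpace ℝ Y] [CompleteSpace Y]

theorem IsDiag.mem_Icc {ι : Type*} {e : HilbertBasis ι ℝ H} {a : ι → ℝ} {A : H →L[ℝ] H} {C s : ℝ}
    (hA : IsDiag e a A) (h : ∀ u, ⟪u, A u⟫_ℝ ∈ Set.Icc 0 (C * ‖u‖ ^ 2)) (hC : C ≤ s) (i : ι) :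
    a i ∈ Set.Icc 0 s := by
  have := h (e i)
  rw [← hA.eigenvalue_eq, e.orthonormal.1 i] at this
  exact ⟨this.1, by linarith [this.2]⟩

/-- The deterministic error bound, on samples for which the empirical operators are close to their
expectations. -/
theorem hsENorm_error_le {ι κ' : Type*} [Countable ι] [Countable κ']
    {e : HilbertBasis ι ℝ H} {e' : HilbertBasis κ' ℝ H} {a : ι → ℝ} {a' : κ' → ℝ}
    {T Th R G : H →L[ℝ] H} {Cyx W Co : H →L[ℝ] Y}
    {g : ℝ → ℝ → ℝ} {φ : ℝ → ℝ} {s D B γ ν γν c lam η v w co θ : ℝ} {m : ℕ}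
    (hT : IsDiag e a T) (hTh : IsDiag e' a' Th) (hR : IsDiag e (fun i => √(a i)) R)
    (hG : IsDiag e' (fun j => g lam (a' j)) G)
    (ha : ∀ i, a i ∈ Set.Icc 0 s) (ha' : ∀ i, a' i ∈ Set.Icc 0 s) (hlam : lam ∈ Set.Ioc 0 s)
    (hker : ∀ u, Th u = 0 → Cyx u = 0)
    (hg : IsRegularizationFamily g s D B γ) (hν : HasQualification g s ν γν)
    (hφ : IsIndexFunction φ) (hcov : Covers ν s (fun t => φ t * √t) c)
    (hνθ : ν = θ + m + 1 / 2) (hθ0 : 0 ≤ θ) (hθ1 : θ ≤ 1)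
    (hsource : ∀ h, W h = Co (specFun φ T h))
    (hw0 : 0 ≤ w) (hco0 : 0 ≤ co) (hv0 : 0 ≤ v)
    (hw : hsENorm W ≤ ENNReal.ofReal w) (hco : hsENorm Co ≤ ENNReal.ofReal co)
    (hη : ‖(T - Th) * shiftPow e a lam (-(1 / 2))‖ ≤ η) (hηlam : η ≤ √lam / 2)
    (hv : hsENorm ((Cyx - W ∘L Th) ∘L shiftPow e a lam (-(1 / 2))) ≤ ENNReal.ofReal v) :
    hsENorm ((W - Cyx ∘L G) ∘L R) ≤ ENNReal.ofReal
      (√2 * (2 ^ ν * (γν + γ)) * (m * (w * η) +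
        2 ^ θ * (co * (max 1 (1 / c) * φ lam * lam ^ (-(ν - 1 / 2)))) * lam ^ (θ + m + 1 / 2)) +
      2 * (B + D) * v) := by
  have hl := hlam.1
  have hs : 0 < s := hl.trans_le hlam.2
  have hγν := hν.const_nonneg hs
  have hγ := hg.γ_pos
  have hB := hg.B_pos
  have hD := hg.D_pos
  have hφl := hφ.pos hl
  have hη0 : 0 ≤ η := (norm_nonneg _).trans hη
  set C := 2 ^ ν * (γν + γ) with hC
  have hC0 : 0 ≤ C := by positivity
  -- the part of the filter away from the kernel
  set f : κ' → ℝ := fun j => if a' j = 0 then 0 else g lam (a' j) with hf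
  have hpos : ∀ j, a' j ≠ 0 → a' j ∈ Set.Ioc 0 s := fun j hj =>
    ⟨lt_of_le_of_ne (ha' j).1 (Ne.symm hj), (ha' j).2⟩
  have hG0 : IsDiag e' f (diagOp e' f) := isDiag_diagOp e' (C := B / lam) fun j => by
    by_cases hj : a' j = 0
    · simp only [hf, hj, if_true, abs_zero]
      positivity
    · simp only [hf, hj, if_false]
      exact hg.abs_le lam hlam _ (hpos j hj)
  set ε := Cyx - W ∘L Th with hε
  -- The value g_λ(0) is unconstrained. It may be replaced by 0 because ε vanishes on the kernel of
  -- T̂.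
  have hεG : ε ∘L G = ε ∘L diagOp e' f := by
    refine clm_ext_hilbertBasis e' fun j => ?_
    rw [ContinuousLinearMap.comp_apply, ContinuousLinearMap.comp_apply, hG j, hG0 j, map_smul,
      map_smul]
    by_cases hj : a' j = 0
    · have h0 : Th (e' j) = 0 := by rw [hTh j, hj, zero_smul]
      have h1 : ε (e' j) = 0 := by
        change Cyx (e' j) - W (Th (e' j)) = 0
        rw [hker _ h0, h0, map_zero, sub_zero]
      rw [h1, smul_zero, smul_zero]
    · simp only [hf, hj, if_false]
  have hsample := hsENorm_sample_le (C := B + D) hT hTh hl ha ha' (hη.trans hηlam) hR hv0 hv hG0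
    (by positivity) fun j => by
      by_cases hj : a' j = 0
      · simp only [hf, hj, if_true, mul_zero, abs_zero]
        positivity
      · simp only [hf, hj, if_false]
        exact hg.abs_add_mul_le hlam (hpos j hj)
  -- the source condition
  set Φ := diagOp e fun i => φ (a i) with hΦ
  have hΦd : IsDiag e (fun i => φ (a i)) Φ := isDiag_diagOp e (C := φ s) fun i => by
    rw [abs_of_nonneg (hφ.nonneg (ha i).1)]
    exact hφ.mono (ha i).1 (ha i).2
  have hα : ν - 1 / 2 = θ + m := by rw [hνθ]; ring
  have hZ : hsENorm (Co ∘L (Φ * shiftPow e a lam (-(ν - 1 / 2)))) ≤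
      ENNReal.ofReal (co * (max 1 (1 / c) * φ lam * lam ^ (-(ν - 1 / 2)))) := by
    refine hsENorm_comp_le_ofReal hco0 hco ?_
    refine (hΦd.mul (isDiag_shiftPow hl ha _)).norm_le (by positivity) fun i => ?_
    have hai := (ha i).1
    have hpa : 0 < a i + lam := by linarith
    rw [abs_of_nonneg (mul_nonneg (hφ.nonneg hai) (by positivity))]
    refine (mul_le_mul_of_nonneg_right (hφ.le_mul_rpow hcov hlam (ha i)) (by positivity)).trans_eq ?_
    rw [mul_assoc, ← Real.rpow_add hpa, add_neg_cancel, Real.rpow_zero, mul_one]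
  have hWZ : W = (Co ∘L (Φ * shiftPow e a lam (-(ν - 1 / 2)))) ∘L shiftPow e a lam (θ + m) := by
    change W = Co ∘L (Φ * shiftPow e a lam (-(ν - 1 / 2)) * shiftPow e a lam (θ + m))
    rw [mul_assoc, shiftPow_mul hl ha, hα, neg_add_cancel, shiftPow_zero hl ha, mul_one]
    ext h
    rw [hsource, hT.specFun_eq φ hΦd]
    rfl
  have hRh : IsDiag e' (fun j => 1 - a' j * g lam (a' j)) (1 - Th * G) :=
    IsDiag.one.sub (hTh.mul hG)
  have hbias := hsENorm_bias_le (C := C) hT hTh hl ha ha' hη hηlam hR hw0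
    (show 0 ≤ co * (max 1 (1 / c) * φ lam * lam ^ (-(ν - 1 / 2))) by positivity) hC0 hθ0 hθ1 hw hZ
    hWZ hRh fun j p hp =>
      abs_residual_mul_rpow_le hg hν hlam (ha' j) (hp.trans_eq hνθ.symm)
  have hdecomp : (W - Cyx ∘L G) ∘L R = W ∘L ((1 - Th * G) * R) - ε ∘L (diagOp e' f * R) := by
    have h1 : ε ∘L (diagOp e' f * R) = ε ∘L (G * R) := by
      change (ε ∘L diagOp e' f) ∘L R = (ε ∘L G) ∘L R
      rw [hεG]
    rw [h1]
    ext h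
    simp [hε]
  rw [hdecomp]
  refine (hsENorm_sub_le _ _).trans ((add_le_add hbias hsample).trans_eq ?_)
  rw [← ENNReal.ofReal_add (by positivity) (by positivity)]

end Main

end CovariateShift

end

open CovariateShift in
theorem mainTheorem1
    {X H Y : Type*} [MeasurableSpace X]
    -- the scalar reproducing kernel Hilbert space and the output space
    [NormedAddCommGroup H] [InnerProductSpace ℝ H] [CompleteSpace H]
    [TopologicalSpace.SeparableSpace H] [RKHS ℝ H X ℝ]
    [NormedAddCommGroup Y] [InnerProductSpace ℝ Y] [CompleteSpace Y]
    [TopologicalSpace.SeparableSpace Y] [MeasurableSpace Y] [BorelSpace Y]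
    -- source and target input distributions, and the common conditional distribution
    (pX qX : Measure X) [IsProbabilityMeasure pX] [IsProbabilityMeasure qX]
    (K : Kernel X Y) [IsMarkovKernel K]
    -- bounded measurable kernel
    (κ : ℝ) (hκ : 0 ≤ κ)
    (hk_meas : ∀ t : X, Measurable fun x => scalarKernel H x t)
    (hk : ∀ x : X, scalarKernel H x x ≤ κ ^ 2)
    -- bounded importance weight
    (β : X → ℝ) (b : ℝ) (hβ_meas : Measurable β) (hβ_nonneg : ∀ x, 0 ≤ β x)
    (hβ_le : ∀ x, β x ≤ b) (hqX : qX = pX.withDensity fun x => ENNReal.ofReal (β x))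
    -- bounded outputs
    (M' : ℝ) (hM' : ∀ᵐ z ∂(pX ⊗ₘ K), ‖z.2‖ ≤ M')
    -- the regression function is `C_* φ(·)`, with the general source condition
    (φ : ℝ → ℝ) (hφ : IsIndexFunction φ) (Cstar Co : H →L[ℝ] Y)
    (hCstar : IsHilbertSchmidt Cstar) (hCo : IsHilbertSchmidt Co)
    (hreg : ∀ᵐ x ∂qX, regressionFun K x = Cstar (featureMap H x))
    (hsource : ∀ h : H, Cstar h = Co (specFun φ (covOp H qX) h))
    -- regularization family on an interval that contains the spectra
    (g : ℝ → ℝ → ℝ) (s D B γ ν γν c : ℝ) (hs : b * κ ^ 2 ≤ s)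
    (hg : IsRegularizationFamily g s D B γ) (hν : HasQualification g s ν γν)
    (hcov : Covers ν s (fun t => φ t * √t) c)
    -- sample size, confidence level, regularization parameter
    (n : ℕ) (hn : 1 ≤ n) (δ : ℝ) (hδ0 : 0 < δ) (hδ1 : δ < 1)
    (lam : ℝ) (hlam : 0 < lam) (hlams : lam ≤ s)
    (hcond : Bnl n lam b κ (effDim (covOp H qX) lam) * Real.log (2 / δ) ≤ √lam / 2)
    -- the constants
    (νbar M A₁ A₂ A₃ : ℝ) (hνbar : νbar = (⌊ν - 1 / 2⌋ : ℤ))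
    (hM : M = M' + hsNorm Cstar * κ)
    (hA₁ : A₁ = 2 ^ (2 * ν - νbar + 2) * (γν + γ) * max 1 (1 / c) * νbar * b * κ ^ 2
        * hsNorm Cstar + 10 * b * M * κ * (B + D))
    (hA₂ : A₂ = 2 ^ (2 * ν - νbar + 1) * (γν + γ) * max 1 (1 / c) * νbar * √b * κ
        * hsNorm Cstar + 5 * M * √b * (B + D))
    (hA₃ : A₃ = 2 ^ (2 * ν - νbar) * (γν + γ) * max 1 (1 / c) * hsNorm Co) :
    ∃ E : Set (Fin n → X × Y), MeasurableSet E ∧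
      ENNReal.ofReal (1 - δ) ≤ Measure.pi (fun _ : Fin n => pX ⊗ₘ K) E ∧
      ∀ z ∈ E,
        eLpNorm (fun x => regressionFun K x - estimator H β (g lam) z x) 2 qX ≤
          ENNReal.ofReal
            ((A₁ / n * √(1 / lam) + A₂ * √(effDim (covOp H qX) lam / n)) * Real.log (2 / δ)
              + A₃ * √lam * φ lam) := by
  have hs0 : 0 < s := hlam.trans_le hlams
  have hlamI : lam ∈ Set.Ioc 0 s := ⟨hlam, hlams⟩
  have hn0 : (0 : ℝ) < n := by exact_mod_cast hn
  have hb1 := one_le_of_density hβ_le hqX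
  have hb0 : 0 ≤ b := zero_le_one.trans hb1
  have ht : 0 < Real.log (2 / δ) := Real.log_pos (by rw [lt_div_iff₀ hδ0]; linarith)
  have hw0 : 0 ≤ hsNorm Cstar := Real.sqrt_nonneg _
  have hco0 : 0 ≤ hsNorm Co := Real.sqrt_nonneg _
  have hM'0 : 0 ≤ M' := by
    obtain ⟨z, hz⟩ := hM'.exists
    exact (norm_nonneg _).trans hz
  have hM0 : 0 ≤ M := by rw [hM]; positivity
  -- the covariance operator
  obtain ⟨ι, e, a, hT⟩ := exists_hilbertBasis_isDiag (A := covOp H qX)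
    (isCompactOperator_covOp hκ hk_meas hk) (covOp_isSymmetric hκ hk_meas hk)
  have := hilbertBasis_countable e
  have ha : ∀ i, a i ∈ Set.Icc 0 s := hT.mem_Icc (inner_covOp_self_mem hκ hk_meas hk) (by nlinarith)
  have hR : IsDiag e (fun i => √(a i)) (diagOp e fun i => √(a i)) :=
    isDiag_diagOp e (C := √s) fun i => by
      rw [abs_of_nonneg (Real.sqrt_nonneg _)]
      exact Real.sqrt_le_sqrt (ha i).2
  set R := diagOp e fun i => √(a i)
  have hRR : R ∘L R = covOp H qX :=
    (hR.comp hR).unique (hT.congr fun i => (Real.mul_self_sqrt (ha i).1).symm)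
  have hS := isDiag_shiftPow (e := e) hlam ha (-(1 / 2))
  have hN := integral_norm_sq_eq_effDim hκ hk_meas hk hT hR hRR (lam := lam) hS fun i => by
    have hpos : 0 < a i + lam := by linarith [(ha i).1]
    rw [← Real.rpow_add hpos, show (-(1 / 2) + -(1 / 2) : ℝ) = -1 by norm_num, Real.rpow_neg_one,
      mul_inv_cancel₀ hpos.ne']
  set N := effDim (covOp H qX) lam
  have hWE := hsENorm_eq_ofReal_hsNorm hCstar
  have hCoE := hsENorm_eq_ofReal_hsNorm hCo
  obtain ⟨E, hE, hEp, hEz⟩ := exists_event (n := n) hS.isSymmetric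
    (show 0 ≤ lam ^ (-(1 / 2) : ℝ) by positivity) hκ hk_meas hk hβ_meas hβ_nonneg hβ_le hqX hM'
    (opNorm_le_of_hsENorm_le hw0 hWE.le) hreg
    (norm_shiftPow_le hlam ha (by norm_num)) hN hn hδ0 hδ1
  refine ⟨E, hE, hEp, fun z hz => ?_⟩
  obtain ⟨hz1, hz2⟩ := hEz z hz
  -- the empirical covariance operator
  obtain ⟨ι', e', a', hTh⟩ := exists_hilbertBasis_isDiag (A := empCovOp H β z)
    (isCompactOperator_empCovOp z) (empCovOp_isSymmetric z)
  have := hilbertBasis_countable e'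
  have ha' : ∀ i, a' i ∈ Set.Icc 0 s :=
    hTh.mem_Icc (inner_empCovOp_self_mem hn hκ hk hβ_nonneg hβ_le z) hs
  have hG : IsDiag e' (fun j => g lam (a' j)) (diagOp e' fun j => g lam (a' j)) :=
    isDiag_diagOp e' (C := |g lam 0| + B / lam) fun j => by
      have hB := hg.B_pos
      rcases (ha' j).1.eq_or_lt with h | h
      · rw [← h]
        exact le_add_of_nonneg_right (by positivity)
      · exact (hg.abs_le lam hlamI _ ⟨h, (ha' j).2⟩).trans (le_add_of_nonneg_left (abs_nonneg _))
  set G := diagOp e' fun j => g lam (a' j)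
  have hker : ∀ u, empCovOp H β z u = 0 → empCrossCovOp H β z u = 0 := fun u hu => by
    rw [empCrossCovOp_apply]
    simp [mul_inner_featureMap_eq_zero hn hβ_nonneg z hu]
  -- the exponent
  have hνhalf := hcov.half_lt hφ hs0
  -- Since ν > 1/2, the natural and integer floors agree and θ = ν − 1/2 − m lies in [0, 1).
  set m := ⌊ν - 1 / 2⌋₊ with hm
  have hm1 : (m : ℝ) ≤ ν - 1 / 2 := Nat.floor_le (by linarith)
  have hm2 : ν - 1 / 2 < m + 1 := Nat.lt_floor_add_one _
  have hνm : νbar = m := by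
    rw [hνbar, hm, natCast_floor_eq_intCast_floor (by linarith)]
  have hνθ : ν = (ν - 1 / 2 - m) + m + 1 / 2 := by ring
  -- the two deviations
  set η := 2 * κ * (2 * b * κ * lam ^ (-(1 / 2) : ℝ) / n + √(b * N / n)) * Real.log (2 / δ) with hη
  have hη0 : 0 ≤ η := by positivity
  have hηlam : η ≤ √lam / 2 := by
    refine le_trans (le_of_eq ?_) hcond
    have h1 : √(b * κ ^ 2 * N / n) = κ * √(b * N / n) := by
      rw [show b * κ ^ 2 * N / n = κ ^ 2 * (b * N / n) by ring, Real.sqrt_mul (sq_nonneg κ),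
        Real.sqrt_sq hκ]
    have h2 : lam ^ (-(1 / 2) : ℝ) = (√lam)⁻¹ := by
      rw [Real.rpow_neg hlam.le, ← Real.sqrt_eq_rpow]
    rw [hη, Bnl, h1, h2]
    have := Real.sqrt_pos.2 hlam
    field_simp
  have hηop : ‖(covOp H qX - empCovOp H β z) * shiftPow e a lam (-(1 / 2))‖ ≤ η := by
    rw [← neg_sub, neg_mul, norm_neg]
    exact opNorm_le_of_hsENorm_le hη0 hz1
  have hmain := hsENorm_error_le (m := m) (θ := ν - 1 / 2 - m) hT hTh hR hG ha ha' hlamI hker hg hν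
    hφ hcov hνθ (by linarith) (by linarith) hsource hw0 hco0
    (by rw [← hM]; positivity) hWE.le hCoE.le hηop hηlam hz2
  -- the norm in `L₂(q_X, Y)`
  have hnorm : eLpNorm (fun x => regressionFun K x - estimator H β (g lam) z x) 2 qX =
      hsENorm ((Cstar - empCrossCovOp H β z ∘L G) ∘L R) := by
    have hae : (fun x => regressionFun K x - estimator H β (g lam) z x) =ᵐ[qX]
        fun x => (Cstar - empCrossCovOp H β z ∘L G) (featureMap H x) := by
      filter_upwards [hreg] with x hx
      rw [hx, estimator, hTh.specFun_eq (g lam) hG]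
      rfl
    rw [eLpNorm_congr_ae hae, eLpNorm_eq_lintegral_rpow_enorm_toReal (by norm_num) (by norm_num),
      hsENorm, ← lintegral_enorm_apply_featureMap_sq hκ hk_meas hk hR hRR]
    simp only [ENNReal.toReal_ofNat, ENNReal.rpow_two]
  rw [hnorm]
  refine hmain.trans (ENNReal.ofReal_le_ofReal ?_)
  rw [← hM, hA₁, hA₂, hA₃, hνm]
  have hγν := hν.const_nonneg hs0
  have hγ := hg.γ_pos
  exact error_constants_le hνθ (by linarith) (by positivity) (le_max_left _ _) hb0 hκ hw0 hlam hn0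
    ht.le
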